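/- Let ${\cal L}_{SC}=\{0,1,\vee,\wedge,-\}\cup\{C^i\}_{i\in\mathbb N}$, where $-$ is a binary and each $C^i$ a unary function symbol. A co-Heyting algebra is a bounded lattice in which, for all $a,b$, there is a least $c$ with $a\le b\vee c$; this element is $a-b$. For $a\neq 0$ write $b\ll a$ if $b\vee c<a$ for every $c<a$. In an ${\cal L}_{SC}$-structure put $\mathrm{scdim}\,0=-\infty$ and, for $a\ne0$, $\mathrm{scdim}\,a=\min\{k : a=\bigvee_{i\le k}C^i(a)\}$ ($+\infty$ if there is no such $k$). Let $d\ge 0$ be an integer. A *$d$-subscaled lattice* is an ${\cal L}_{SC}$-structure whose reduct to $\{0,1,\vee,\wedge,-\}$ is a co-Heyting algebra (the one-element algebra is allowed) and such that for all elements $a,b$ and all $i,j,k\in\mathbb N$: 1. $\bigvee_{i\le d}C^i(a)=a$, and $C^i(a)=0$ for $i>d$; 2. for every $I\subseteq\{0,\dots,d\}$, $C^k(\bigvee_{i\in I}C^i(a))$ equals $C^k(a)$ if $k\in I$ and $0$ otherwise; 3. if $k\ge\max(\mathrm{scdim}\,a,\mathrm{scdim}\,b)$ then $C^k(a\vee b)=C^k(a)\vee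 C^k(b)$; 4. if $i\ne j$ then $\mathrm{scdim}(C^i(a)\wedge C^j(a))<\min(i,j)$; 5. if $k\ge \mathrm{scdim}\,b$ then $C^k(a)-b=C^k(a)-C^k(b)$; 6. if $a\neq0$ and $b\ll a$ then $\mathrm{scdim}\,b<\mathrm{scdim}\,a$. An element $a$ is *$k$-sc-pure* if $\mathrm{scdim}(a-b)=k$ for every $b$ with $a-b\neq0$. A *super $d$-scaled lattice* is a $d$-subscaled lattice with the following two properties. * *Catenarity:* for all integers $0\le r\le q\le p$ and all $c\le a\ne0$ with $c$ $r$-sc-pure and $a$ $p$-sc-pure, there is a nonzero $q$-sc-pure $b$ with $c\le b\le a$. * *Splitting:* whenever $a\ne0$ and $b_1\vee b_2\ll a$, there are nonzero $a_1\ge b_1$, $a_2\ge b_2$ with $a_1=a-a_2$, $a_2=a-a_1$ and $a_1\wedge a_2=b_1\wedge b_2$. A *prime $d$-subscaled lattice* is a $d$-subscaled lattice generated by the empty set. **Theorem.** Let $d\ge0$ be an integer. (i) The classes of $d$-subscaled lattices and of super $d$-scaled lattices are elementary, with theories $T_d$ and $\bar T_d$ respectively, and $T_d$ has a universal axiomatization.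 (ii) $\bar T_d$ is the model-completion of $T_d$: it implies $T_d$, and for every model $M$ of $T_d$ the theory $\bar T_d\cup\mathrm{Diag}(M)$ is complete (in particular consistent). (iii) $\bar T_d$ eliminates quantifiers in ${\cal L}_{SC}$. (iv) $\bar T_d$ is axiomatized by finitely many sentences together with the identities $C^i(x)=0$ for $i>d$. (v) There are, up to isomorphism, only finitely many prime $d$-subscaled lattices, and they are finite. For each prime $d$-subscaled lattice $P$, the class of super $d$-scaled lattices containing a copy of $P$ is elementary, and its theory is complete. Every complete theory $T\supseteq\bar T_d$ has the same consequences as one of these theories, is $\aleph_0$-categorical (any two models of cardinality $\aleph_0$ are isomorphic), and is decidable. (vi) Up to isomorphism there are only finitely many prime models of completions of $\bar T_d$ (models of $\bar T_d$ that embed elementarily in every structure elementarily equivalent to them), and every super $d$-scaled lattice has one of them as an elementary substructure, up to isomorphism. (vii) $\bar T_d$ is decidable. -/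

import Mathlib

open FirstOrder FirstOrder.Language

universe u

namespace Subscaled

/-! ### The language of subscaled lattices -/

/-- Function symbols: `0`, `1`, join, meet, relative complement `-`, and the pure component
symbols `C^i`, one for every natural number `i`. -/
inductive SCFunc : ℕ → Type
  | zero : SCFunc 0
  | one : SCFunc 0
  | join : SCFunc 2
  | meet : SCFunc 2
  | sub : SCFunc 2
  | comp (i : ℕ) : SCFunc 1

/-- The language `L_SC`; it has no relation symbols besides equality. -/
def LSC : FirstOrder.Language.{0, 0} := ⟨SCFunc, fun _ => Empty⟩

section Operations

/-- The element `0` of an `L_SC`-structure. -/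
def zeroOp (M : Type u) [LSC.Structure M] : M :=
  Structure.funMap (L := LSC) (M := M) SCFunc.zero ![]

/-- The element `1` of an `L_SC`-structure. -/
def oneOp (M : Type u) [LSC.Structure M] : M :=
  Structure.funMap (L := LSC) (M := M) SCFunc.one ![]

/-- The join operation of an `L_SC`-structure. -/
def joinOp {M : Type u} [LSC.Structure M] (a b : M) : M :=
  Structure.funMap (L := LSC) (M := M) SCFunc.join ![a, b]

/-- The meet operation of an `L_SC`-structure. -/
def meetOp {M : Type u} [LSC.Structure M] (a b : M) : M :=
  Structure.funMap (L := LSC) (M := M) SCFunc.meet ![a, b]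

/-- The operation `a - b` of an `L_SC`-structure. -/
def subOp {M : Type u} [LSC.Structure M] (a b : M) : M :=
  Structure.funMap (L := LSC) (M := M) SCFunc.sub ![a, b]

/-- The operation `C^i` of an `L_SC`-structure. -/
def compOp {M : Type u} [LSC.Structure M] (i : ℕ) (a : M) : M :=
  Structure.funMap (L := LSC) (M := M) (SCFunc.comp i) ![a]

/-- The symbols of `L_TC` are interpreted in `M` by the operations of the given co-Heyting
algebra: `a \ b` is the least `c` with `a ≤ b ⊔ c`. -/
def Compatible (M : Type u) [LSC.Structure M] [CoheytingAlgebra M] : Prop :=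
  zeroOp M = ⊥ ∧ oneOp M = ⊤ ∧
    ∀ a b : M, joinOp a b = a ⊔ b ∧ meetOp a b = a ⊓ b ∧ subOp a b = a \ b

end Operations

/-! ### Subscaled lattices: axioms -/

section Axioms

/-- The sc-dimension: `-∞` at `0`; otherwise the least `k` such that `a` is the join of
`C^0(a), …, C^k(a)`, and `+∞` if there is no such `k`. -/
noncomputable def scdim {L : Type u} [CoheytingAlgebra L] (C : ℕ → L → L) (a : L) :
    WithBot ℕ∞ :=
  open Classical in
  if a = ⊥ then ⊥
  else ((⨅ (k : ℕ) (_ : a = (Finset.range (k + 1)).sup fun i => C i a), (k : ℕ∞) : ℕ∞) :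
    WithBot ℕ∞)

/-- The relation `b ≪ a`. It is only used for `a ≠ ⊥`, where it is equivalent to `b ≤ a \ b`. -/
def WayBelow {L : Type u} [CoheytingAlgebra L] (b a : L) : Prop :=
  ∀ c : L, c < a → b ⊔ c < a

/-- The axioms of `d`-subscaled lattices for a co-Heyting algebra with operations `C^i`. -/
structure SubscaledAxioms {L : Type u} [CoheytingAlgebra L] (d : ℕ) (C : ℕ → L → L) :
    Prop where
  sup_comp : ∀ a : L, ((Finset.range (d + 1)).sup fun i => C i a) = a
  comp_eq_bot : ∀ i : ℕ, d < i → ∀ a : L, C i a = ⊥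
  comp_sup_comp : ∀ I : Finset ℕ, I ⊆ Finset.range (d + 1) → ∀ (k : ℕ) (a : L),
    C k (I.sup fun i => C i a) = if k ∈ I then C k a else ⊥
  comp_sup : ∀ (a b : L) (k : ℕ), max (scdim C a) (scdim C b) ≤ ((k : ℕ∞) : WithBot ℕ∞) →
    C k (a ⊔ b) = C k a ⊔ C k b
  scdim_comp_inf_comp : ∀ (a : L) (i j : ℕ), i ≠ j →
    scdim C (C i a ⊓ C j a) < ((min i j : ℕ) : WithBot ℕ∞)
  comp_sdiff : ∀ (a b : L) (k : ℕ), scdim C b ≤ ((k : ℕ∞) : WithBot ℕ∞) →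
    C k a \ b = C k a \ C k b
  scdim_lt : ∀ a b : L, a ≠ ⊥ → WayBelow b a → scdim C b < scdim C a

/-- `a` is `k`-sc-pure; in particular `⊥` is `k`-sc-pure for every `k`. -/
def IsScPure {L : Type u} [CoheytingAlgebra L] (C : ℕ → L → L) (k : ℕ) (a : L) : Prop :=
  ∀ b : L, a \ b ≠ ⊥ → scdim C (a \ b) = ((k : ℕ∞) : WithBot ℕ∞)

/-- The Catenarity Property. -/
def Catenarity {L : Type u} [CoheytingAlgebra L] (C : ℕ → L → L) : Prop :=
  ∀ (r q p : ℕ), r ≤ q → q ≤ p → ∀ c a : L, c ≤ a → a ≠ ⊥ →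
    IsScPure C r c → IsScPure C p a → ∃ b : L, b ≠ ⊥ ∧ IsScPure C q b ∧ c ≤ b ∧ b ≤ a

/-- The Splitting Property. -/
def Splitting (L : Type u) [CoheytingAlgebra L] : Prop :=
  ∀ b₁ b₂ a : L, WayBelow (b₁ ⊔ b₂) a → a ≠ ⊥ →
    ∃ a₁ a₂ : L, a₁ ≠ ⊥ ∧ a₂ ≠ ⊥ ∧ b₁ ≤ a₁ ∧ b₂ ≤ a₂ ∧
      a₁ = a \ a₂ ∧ a₂ = a \ a₁ ∧ a₁ ⊓ a₂ = b₁ ⊓ b₂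

/-- The `L_SC`-structure `M` is a `d`-subscaled lattice. -/
def IsSubscaled (d : ℕ) (M : Type u) [LSC.Structure M] : Prop :=
  ∃ _ : CoheytingAlgebra M, Compatible M ∧ SubscaledAxioms d (compOp (M := M))

/-- The `L_SC`-structure `M` is a super `d`-scaled lattice. -/
def IsSuperScaled (d : ℕ) (M : Type u) [LSC.Structure M] : Prop :=
  ∃ _ : CoheytingAlgebra M, Compatible M ∧ SubscaledAxioms d (compOp (M := M)) ∧
    Catenarity (compOp (M := M)) ∧ Splitting M

/-- `M` is a prime `d`-subscaled lattice: a `d`-subscaled lattice generated by the empty set. -/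
def IsPrimeSubscaled (d : ℕ) (M : Type u) [LSC.Structure M] : Prop :=
  IsSubscaled d M ∧ Substructure.closure LSC (∅ : Set M) = ⊤

end Axioms

/-! ### The theories -/

/-- The theory of a class of `L_SC`-structures: all sentences true in every member. -/
def theoryOf (K : (M : Type) → [LSC.Structure M] → Prop) : LSC.Theory :=
  {φ | ∀ (M : Type) [LSC.Structure M], K M → M ⊨ φ}

/-- The theory of `d`-subscaled lattices. -/
def subscaledTheory (d : ℕ) : LSC.Theory :=
  theoryOf fun M _ => IsSubscaled d M

/-- The theory of super `d`-scaled lattices. -/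
def superTheory (d : ℕ) : LSC.Theory :=
  theoryOf fun M _ => IsSuperScaled d M

/-- The theory of super `d`-scaled lattices containing a copy of `P`. -/
def superTheoryOver (d : ℕ) (P : Type) [LSC.Structure P] : LSC.Theory :=
  theoryOf fun M _ => IsSuperScaled d M ∧ Nonempty (P ↪[LSC] M)

/-! ### Model-theoretic notions -/

section ModelTheory

/-- The diagram of `M`: all quantifier-free sentences with parameters in `M` that hold in `M`. -/
def diagram (L : FirstOrder.Language.{0, 0}) (M : Type u) [L.Structure M] : L[[M]].Theory :=
  {φ | φ.IsQF ∧ M ⊨ φ}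

/-- `T'` is a model-completion of `T`: it implies `T`, and for every model `M` of `T` the theory
`T' ∪ Diag(M)` is complete. (Completeness includes satisfiability, so that every model of `T`
embeds into a model of `T'`.) -/
def IsModelCompletion {L : FirstOrder.Language.{0, 0}} (T T' : L.Theory) : Prop :=
  (∀ φ ∈ T, T' ⊨ᵇ φ) ∧
    ∀ (M : Type u) [L.Structure M] [Nonempty M], M ⊨ T →
      ((L.lhomWithConstants M).onTheory T' ∪ diagram L M).IsComplete

/-- `T` eliminates quantifiers. -/
def EliminatesQuantifiers {L : FirstOrder.Language.{0, 0}} (T : L.Theory) : Prop :=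
  ∀ (n : ℕ) (φ : L.Formula (Fin n)), ∃ ψ : L.Formula (Fin n), ψ.IsQF ∧ T ⊨ᵇ φ.iff ψ

/-- `M` is a prime model of one of the completions of `T`: a model of `T` that embeds elementarily
into every structure elementarily equivalent to it. -/
def IsPrimeModel {L : FirstOrder.Language.{0, 0}} (T : L.Theory) (M : Type) [L.Structure M] : Prop :=
  M ⊨ T ∧ ∀ (N : Type) [L.Structure N], M ≅[L] N → Nonempty (M ↪ₑ[L] N)

end ModelTheory

/-! ### Decidability, through a Gödel numbering -/

/-- Code of the term with head symbol `f` from the codes of its arguments. -/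
def funcCode : {n : ℕ} → SCFunc n → (Fin n → ℕ) → ℕ
  | _, .zero, _ => Nat.pair 1 0
  | _, .one, _ => Nat.pair 2 0
  | _, .join, c => Nat.pair 3 (Nat.pair (c 0) (c 1))
  | _, .meet, c => Nat.pair 4 (Nat.pair (c 0) (c 1))
  | _, .sub, c => Nat.pair 5 (Nat.pair (c 0) (c 1))
  | _, .comp i, c => Nat.pair 6 (Nat.pair i (c 0))

/-- Gödel number of a term. -/
def termCode {n : ℕ} : LSC.Term (Empty ⊕ Fin n) → ℕ
  | .var (.inl e) => e.elim
  | .var (.inr i) => Nat.pair 0 i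
  | .func f ts => funcCode f fun i => termCode (ts i)

/-- Gödel number of a formula without free variables other than the indexed ones. -/
def formulaCode : {n : ℕ} → LSC.BoundedFormula Empty n → ℕ
  | _, .falsum => Nat.pair 0 0
  | _, .equal t₁ t₂ => Nat.pair 1 (Nat.pair (termCode t₁) (termCode t₂))
  | _, .rel R _ => Empty.elim R
  | _, .imp φ ψ => Nat.pair 2 (Nat.pair (formulaCode φ) (formulaCode ψ))
  | _, .all φ => Nat.pair 3 (formulaCode φ)

/-- `T` is decidable: the set of Gödel numbers of its consequences is computable. -/
def IsDecidable (T : LSC.Theory) : Prop :=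
  ComputablePred fun k : ℕ => ∃ φ : LSC.Sentence, formulaCode φ = k ∧ T ⊨ᵇ φ

end Subscaled

/-! The theorem reduces to finite combinatorics through a duality. A finite poset with a strictly
increasing rank function into {0,…,d} yields a finite d-subscaled lattice, its algebra of lower
sets, where C^i(A) is generated by the maximal elements of A that have rank i
(`Down.subscaledAxioms`). Embeddings of such algebras are dual to monotone surjections f : K → J
with rank k ≤ rank (f k) and a lifting property: if f k ≤ j, some k' ≥ k lies over j and has the
rank of j (`exists_pmap`). Inside an arbitrary subscaled lattice, a copy of such an algebra is the
same thing as a family of nonzero pure elements whose pairwise meets are joins of members, with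
total join 1 (`IsSystem.embedding`, `isSystem_of_embedding`).

Local finiteness (`exists_system`): n elements always lie in a copy of the algebra of a ranked poset
whose size is bounded in terms of n and d. The elements cut the lattice into cells. The
top-dimensional parts of distinct cells meet in smaller dimension, so everything except these parts
lies under an element of smaller dimension, and induction on dimension applies.

Extension (`exists_system_extension`): in a super scaled lattice N, every embedding of a finite
algebra extends along every embedding of that algebra into another finite one. By duality, points
must be added to a poset already realized in N. A point whose rank is smaller than that of the point
below it in the projection is produced by Catenarity inside a piece cut out by Splitting; the points
of full rank over j are produced together by splitting the element attached to j.

Existence (`exists_superScaled`): each instance of Splitting or Catenarity over a finite algebra can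
be realized in a larger finite algebra, by doubling part of the poset or inserting points. The limit
of a chain of such algebras is a countable super scaled lattice. An ultraproduct then extends an
arbitrary subscaled lattice to a super scaled one (`exists_superScaled_extension`).

Extension gives a back-and-forth between super scaled lattices that share a finite subalgebra
(`realize_iff`). Hence a tuple's type is determined by its quantifier-free type, and
model-completeness, quantifier elimination, completeness over each prime lattice, categoricity in
cardinality ℵ₀ and the description of prime models follow. Prime lattices are algebras of posets of
bounded size, so they are finite in number.

For decidability, the same back-and-forth replaces a quantifier over N by one over a finite list of
coded extensions of a coded ranked poset. Truth becomes a primitive recursive function (`truth_iff`,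
`primrec_truth`), and a sentence follows from the theory exactly when it is true over each of the
finitely many prime lattices. -/

namespace Subscaled

/-! ### Dimension and purity in a subscaled lattice -/

section Calculus

variable {M : Type u} [CoheytingAlgebra M] {C : ℕ → M → M} {d : ℕ}

/-- The sc-dimension of `a` is less than `k`. -/
def Low (C : ℕ → M → M) (k : ℕ) (a : M) : Prop :=
  ((Finset.range k).sup fun i => C i a) = a

/-- `a` is its own `k`-th pure component. -/
def Pure (C : ℕ → M → M) (k : ℕ) (a : M) : Prop := C k a = a

/-- Every element is the join of its components of index at most `d`, the others being trivial. -/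
structure IsGraded (d : ℕ) (C : ℕ → M → M) : Prop where
  sup_comp : ∀ a : M, ((Finset.range (d + 1)).sup fun i => C i a) = a
  comp_eq_bot : ∀ i : ℕ, d < i → ∀ a : M, C i a = ⊥

namespace IsGraded

theorem comp_le (h : IsGraded d C) (i : ℕ) (a : M) : C i a ≤ a := by
  rcases Nat.lt_or_ge d i with hi | hi
  · rw [h.comp_eq_bot i hi]; exact bot_le
  · conv_rhs => rw [← h.sup_comp a]
    exact Finset.le_sup (f := fun i => C i a) (Finset.mem_range.2 (Nat.lt_succ_of_le hi))

theorem comp_bot (h : IsGraded d C) (i : ℕ) : C i ⊥ = ⊥ :=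
  le_bot_iff.1 (h.comp_le i ⊥)

theorem low_top (h : IsGraded d C) (a : M) : Low C (d + 1) a := h.sup_comp a

theorem low_bot (h : IsGraded d C) (k : ℕ) : Low C k ⊥ :=
  le_bot_iff.1 (Finset.sup_le fun i _ => h.comp_le i ⊥)

theorem low_zero_iff {a : M} : Low C 0 a ↔ a = ⊥ := by
  simp [Low, eq_comm]

theorem low_mono (h : IsGraded d C) {k l : ℕ} {a : M} (hkl : k ≤ l) (ha : Low C k a) :
    Low C l a := by
  refine le_antisymm (Finset.sup_le fun i _ => h.comp_le i a) ?_
  conv_lhs => rw [← ha]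
  exact Finset.sup_mono (Finset.range_mono hkl)

theorem scdim_le_iff (h : IsGraded d C) {k : ℕ} {a : M} :
    scdim C a ≤ ((k : ℕ∞) : WithBot ℕ∞) ↔ Low C (k + 1) a := by
  unfold scdim
  split_ifs with ha
  · subst ha; simp [h.low_bot]
  · rw [WithBot.coe_le_coe]
    constructor
    · intro hle
      by_contra hk
      have : ((k + 1 : ℕ) : ℕ∞) ≤
          ⨅ (k : ℕ) (_ : a = (Finset.range (k + 1)).sup fun i => C i a), (k : ℕ∞) := by
        refine le_iInf fun l => le_iInf fun hl => ?_
        by_contra hlt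
        apply hk
        have : l < k + 1 := by exact_mod_cast not_le.1 hlt
        exact h.low_mono (by omega) hl.symm
      have h2 := this.trans hle
      have : k + 1 ≤ k := by exact_mod_cast h2
      omega
    · intro hk
      exact iInf_le_of_le k (iInf_le_of_le hk.symm le_rfl)

theorem scdim_lt_iff (h : IsGraded d C) {k : ℕ} {a : M} :
    scdim C a < ((k : ℕ) : WithBot ℕ∞) ↔ Low C k a := by
  cases k with
  | zero =>
    rw [low_zero_iff]
    unfold scdim
    split_ifs with ha
    · subst ha; simp
    · constructor
      · intro hlt
        exfalso
        have : ((0 : ℕ) : WithBot ℕ∞) = ((0 : ℕ∞) : WithBot ℕ∞) := by norm_cast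
        rw [this, WithBot.coe_lt_coe] at hlt
        simp at hlt
      · intro hb; exact absurd hb ha
  | succ k =>
    rw [← h.scdim_le_iff]
    rcases hs : scdim C a with _ | x
    · constructor
      · intro _; exact bot_le
      · intro _; exact WithBot.bot_lt_coe _
    · have e1 : ((k + 1 : ℕ) : WithBot ℕ∞) = (((k + 1 : ℕ) : ℕ∞) : WithBot ℕ∞) := by norm_cast
      rw [e1]
      change ((x : ℕ∞) : WithBot ℕ∞) < _ ↔ ((x : ℕ∞) : WithBot ℕ∞) ≤ _
      rw [WithBot.coe_lt_coe, WithBot.coe_le_coe]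
      push_cast
      exact ENat.lt_add_one_iff (ENat.natCast_ne_top k)

/-- Dimensions are compared through the thresholds `Low`. Since a is nonzero, the least n with `Low
C n a` is positive, and its predecessor is the dimension of a. -/
theorem scdim_lt_scdim_iff (h : IsGraded d C) {a b : M} (ha : a ≠ ⊥) :
    scdim C b < scdim C a ↔ ∀ k, Low C (k + 1) a → Low C k b := by
  constructor
  · intro hlt k hk
    rw [← h.scdim_lt_iff]
    exact hlt.trans_le (h.scdim_le_iff.2 hk)
  · intro hk
    have hd := h.low_top a
    obtain ⟨k, hk1, hk2⟩ : ∃ k, Low C (k + 1) a ∧ ¬ Low C k a := by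
      classical
      have hex : ∃ k, Low C k a := ⟨_, hd⟩
      have hpos : Nat.find hex ≠ 0 := fun h0 => by
        have := Nat.find_spec hex
        rw [h0, low_zero_iff] at this
        exact ha this
      obtain ⟨k, hk⟩ := Nat.exists_eq_succ_of_ne_zero hpos
      refine ⟨k, ?_, Nat.find_min hex (by omega)⟩
      have := Nat.find_spec hex
      rwa [hk] at this
    have h1 := h.scdim_lt_iff.2 (hk k hk1)
    refine h1.trans_le (not_lt.1 fun hh => hk2 (h.scdim_lt_iff.1 hh))

end IsGraded

namespace SubscaledAxioms

theorem isGraded (h : SubscaledAxioms d C) : IsGraded d C := ⟨h.sup_comp, h.comp_eq_bot⟩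

theorem comp_le (h : SubscaledAxioms d C) (i : ℕ) (a : M) : C i a ≤ a := h.isGraded.comp_le i a

theorem comp_bot (h : SubscaledAxioms d C) (i : ℕ) : C i ⊥ = ⊥ := h.isGraded.comp_bot i

theorem low_top (h : SubscaledAxioms d C) (a : M) : Low C (d + 1) a := h.sup_comp a

theorem low_bot (h : SubscaledAxioms d C) (k : ℕ) : Low C k ⊥ := h.isGraded.low_bot k

theorem low_mono (h : SubscaledAxioms d C) {k l : ℕ} {a : M} (hkl : k ≤ l) (ha : Low C k a) :
    Low C l a := h.isGraded.low_mono hkl ha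

theorem scdim_le_iff (h : SubscaledAxioms d C) {k : ℕ} {a : M} :
    scdim C a ≤ ((k : ℕ∞) : WithBot ℕ∞) ↔ Low C (k + 1) a := h.isGraded.scdim_le_iff

theorem scdim_lt_iff (h : SubscaledAxioms d C) {k : ℕ} {a : M} :
    scdim C a < ((k : ℕ) : WithBot ℕ∞) ↔ Low C k a := h.isGraded.scdim_lt_iff

/-- Axiom 2 only covers index sets inside {0,…,d}; the range is truncated first, the discarded
components being zero. -/
theorem comp_low (h : SubscaledAxioms d C) (n k : ℕ) (a : M) :
    C k ((Finset.range n).sup fun i => C i a) = if k < n then C k a else ⊥ := by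
  have e : ((Finset.range n).sup fun i => C i a) =
      (Finset.range (min n (d + 1))).sup fun i => C i a := by
    apply le_antisymm
    · refine Finset.sup_le fun i hi => ?_
      rcases Nat.lt_or_ge d i with hid | hid
      · rw [h.comp_eq_bot i hid]; exact bot_le
      · exact Finset.le_sup (f := fun i => C i a)
          (Finset.mem_range.2 (lt_min (Finset.mem_range.1 hi) (by omega)))
    · exact Finset.sup_mono (Finset.range_mono (min_le_left _ _))
  rw [e, h.comp_sup_comp _ (Finset.range_mono (min_le_right _ _))]
  simp only [Finset.mem_range, lt_min_iff]
  by_cases hk : k < n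
  · by_cases hkd : k < d + 1
    · simp [hk, hkd]
    · simp [hk, hkd, h.comp_eq_bot k (by omega)]
  · simp [hk]

theorem low_iff (h : SubscaledAxioms d C) {k : ℕ} {a : M} :
    Low C k a ↔ ∀ j, k ≤ j → C j a = ⊥ := by
  constructor
  · intro ha j hj
    rw [← ha, h.comp_low, if_neg (by omega)]
  · intro ha
    refine le_antisymm (Finset.sup_le fun i _ => h.comp_le i a) ?_
    conv_lhs => rw [← h.sup_comp a]
    refine Finset.sup_le fun i _ => ?_
    rcases Nat.lt_or_ge i k with hi | hi
    · exact Finset.le_sup (f := fun i => C i a) (Finset.mem_range.2 hi)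
    · rw [ha i hi]; exact bot_le

theorem comp_sup_of_low (h : SubscaledAxioms d C) {k : ℕ} {a b : M} (ha : Low C (k + 1) a)
    (hb : Low C (k + 1) b) : C k (a ⊔ b) = C k a ⊔ C k b :=
  h.comp_sup a b k (max_le (h.scdim_le_iff.2 ha) (h.scdim_le_iff.2 hb))

theorem comp_sdiff_of_low (h : SubscaledAxioms d C) {k : ℕ} {a b : M} (hb : Low C (k + 1) b) :
    C k a \ b = C k a \ C k b :=
  h.comp_sdiff a b k (h.scdim_le_iff.2 hb)

theorem low_inf (h : SubscaledAxioms d C) (a : M) {i j : ℕ} (hij : i ≠ j) :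
    Low C (min i j) (C i a ⊓ C j a) :=
  h.scdim_lt_iff.1 (h.scdim_comp_inf_comp a i j hij)

theorem low_sup (h : SubscaledAxioms d C) {k : ℕ} {a b : M} (ha : Low C k a) (hb : Low C k b) :
    Low C k (a ⊔ b) := by
  rw [h.low_iff]
  intro j hj
  rw [h.comp_sup_of_low (h.low_mono (by omega) ha) (h.low_mono (by omega) hb),
    h.low_iff.1 ha j hj, h.low_iff.1 hb j hj, bot_sup_eq]

theorem low_finset_sup (h : SubscaledAxioms d C) {ι : Type*} {k : ℕ} (s : Finset ι) (f : ι → M)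
    (hf : ∀ i ∈ s, Low C k (f i)) : Low C k (s.sup f) := by
  classical
  induction s using Finset.induction_on with
  | empty => exact h.low_bot k
  | insert i s _ ih =>
    rw [Finset.sup_insert]
    exact h.low_sup (hf i (Finset.mem_insert_self i s))
      (ih fun j hj => hf j (Finset.mem_insert_of_mem hj))

/-- For j ≥ k, axiom 5 reads C^j(b) - a = C^j(b) - C^j(a). The left side is zero because C^j(b) ≤ b
≤ a, and C^j(a) is zero, so C^j(b) is zero. -/
theorem low_of_le (h : SubscaledAxioms d C) {k : ℕ} {a b : M} (hb : b ≤ a) (ha : Low C k a) :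
    Low C k b := by
  rw [h.low_iff]
  intro j hj
  have e := h.comp_sdiff_of_low (k := j) (a := b) (h.low_mono (by omega : k ≤ j + 1) ha)
  rw [h.low_iff.1 ha j hj, sdiff_bot, sdiff_eq_bot_iff.2 ((h.comp_le j b).trans hb)] at e
  exact e.symm

theorem comp_comp (h : SubscaledAxioms d C) (k i : ℕ) (a : M) :
    C k (C i a) = if k = i then C i a else ⊥ := by
  rcases Nat.lt_or_ge d i with hi | hi
  · simp [h.comp_eq_bot i hi, h.comp_bot]
  · have := h.comp_sup_comp {i} (by simp; omega) k a
    simp only [Finset.sup_singleton, Finset.mem_singleton] at this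
    rw [this]
    split_ifs with hk
    · rw [hk]
    · rfl

theorem pure_comp (h : SubscaledAxioms d C) (i : ℕ) (a : M) : Pure C i (C i a) := by
  simp [Pure, h.comp_comp]

theorem pure_bot (h : SubscaledAxioms d C) (k : ℕ) : Pure C k ⊥ := h.comp_bot k

theorem pure_low (h : SubscaledAxioms d C) {k : ℕ} {a : M} (ha : Pure C k a) :
    Low C (k + 1) a := by
  rw [h.low_iff]
  intro j hj
  rw [← ha, h.comp_comp, if_neg (by omega)]

theorem pure_dim_le (h : SubscaledAxioms d C) {k : ℕ} {a : M} (ha : Pure C k a) (h0 : a ≠ ⊥) :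
    k ≤ d := by
  by_contra hk
  exact h0 (by rw [← ha]; exact h.comp_eq_bot k (by omega) a)

theorem eq_bot_of_pure_of_low (h : SubscaledAxioms d C) {k : ℕ} {a : M} (ha : Pure C k a)
    (hl : Low C k a) : a = ⊥ := by
  rw [← ha]; exact h.low_iff.1 hl k le_rfl

/-- Axiom 5 replaces b by C^k(b), which is zero. Elements of dimension less than k are thus
negligible when subtracted from k-pure ones, which is what drives most of the later computations. -/
theorem pure_sdiff_low (h : SubscaledAxioms d C) {k : ℕ} {a b : M} (ha : Pure C k a)
    (hb : Low C k b) : a \ b = a := by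
  have e := h.comp_sdiff_of_low (a := a) (h.low_mono (Nat.le_succ k) hb)
  rwa [h.low_iff.1 hb k le_rfl, sdiff_bot, show C k a = a from ha] at e

theorem pure_sup (h : SubscaledAxioms d C) {k : ℕ} {a b : M} (ha : Pure C k a) (hb : Pure C k b) :
    Pure C k (a ⊔ b) := by
  unfold Pure
  rw [h.comp_sup_of_low (h.pure_low ha) (h.pure_low hb), ha, hb]

theorem pure_finset_sup (h : SubscaledAxioms d C) {ι : Type*} {k : ℕ} (s : Finset ι) (f : ι → M)
    (hf : ∀ i ∈ s, Pure C k (f i)) : Pure C k (s.sup f) := by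
  classical
  induction s using Finset.induction_on with
  | empty => exact h.pure_bot k
  | insert i s _ ih =>
    rw [Finset.sup_insert]
    exact h.pure_sup (hf i (Finset.mem_insert_self i s))
      (ih fun j hj => hf j (Finset.mem_insert_of_mem hj))

/-- Let r be the join of the components of a - b of index below k. Subtracting r from a changes
nothing, hence neither from a - b; so a - b lies under its own k-th component. -/
theorem pure_sdiff (h : SubscaledAxioms d C) {k : ℕ} {a : M} (ha : Pure C k a) (b : M) :
    Pure C k (a \ b) := by
  have hl : Low C (k + 1) (a \ b) := h.low_of_le sdiff_le (h.pure_low ha)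
  have hr : Low C k ((Finset.range k).sup fun i => C i (a \ b)) := by
    rw [h.low_iff]
    intro j hj
    rw [h.comp_low, if_neg (by omega)]
  refine le_antisymm (h.comp_le _ _) ?_
  set r := (Finset.range k).sup fun i => C i (a \ b) with hrdef
  have e1 : a \ b = r ⊔ C k (a \ b) := by
    conv_lhs => rw [← hl]
    rw [Finset.range_add_one, Finset.sup_insert, sup_comm]
  have e2 : (a \ b) \ r = a \ b := by
    rw [sdiff_right_comm, h.pure_sdiff_low ha hr]
  rw [← e2, sdiff_le_iff]
  exact e1.le.trans (by rw [e2])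

/-- The remainder a - C^k(a) lies under the components of index below k, so sc-purity forces it to
vanish. Conversely, differences of a remain pure by `pure_sdiff`, and a nonzero k-pure element
cannot have dimension less than k. Purity becomes an equation. -/
theorem isScPure_iff (h : SubscaledAxioms d C) {k : ℕ} {a : M} : IsScPure C k a ↔ Pure C k a := by
  constructor
  · intro ha
    have hl : Low C (k + 1) a := by
      by_cases h0 : a = ⊥
      · subst h0; exact h.low_bot _
      · have := ha ⊥ (by simpa using h0)
        rw [sdiff_bot] at this
        exact h.scdim_le_iff.1 this.le
    have hr : Low C k ((Finset.range k).sup fun i => C i a) := by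
      rw [h.low_iff]
      intro j hj
      rw [h.comp_low, if_neg (by omega)]
    have hle : a \ C k a ≤ (Finset.range k).sup fun i => C i a := by
      rw [sdiff_le_iff]
      conv_lhs => rw [← hl]
      rw [Finset.range_add_one, Finset.sup_insert]
    refine le_antisymm (h.comp_le _ _) (sdiff_eq_bot_iff.1 ?_)
    by_contra hne
    have h1 := ha _ hne
    have h2 : scdim C (a \ C k a) < ((k : ℕ) : WithBot ℕ∞) :=
      h.scdim_lt_iff.2 (h.low_of_le hle hr)
    rw [h1] at h2
    exact lt_irrefl _ h2
  · intro ha b hne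
    have hp := h.pure_sdiff ha b
    refine le_antisymm (h.scdim_le_iff.2 (h.pure_low hp)) (not_lt.1 fun hlt => ?_)
    exact hne (h.eq_bot_of_pure_of_low hp (h.scdim_lt_iff.1 hlt))

end SubscaledAxioms

theorem wayBelow_of_le_sdiff {a b : M} (hb : b ≤ a \ b) : WayBelow b a := by
  intro c hc
  refine lt_of_le_of_ne (sup_le (hb.trans sdiff_le) hc.le) fun e => ?_
  have h1 : a \ b ≤ c := sdiff_le_iff.2 e.ge
  exact hc.not_ge (e.ge.trans (sup_le (hb.trans h1) le_rfl))

/-- Testing c = 0 gives b ≤ a, and testing c = a - b gives a - b = a. The relation becomes an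
inequality of terms. -/
theorem wayBelow_iff {a b : M} (ha : a ≠ ⊥) : WayBelow b a ↔ b ≤ a \ b := by
  refine ⟨fun hw => ?_, wayBelow_of_le_sdiff⟩
  have h1 : b ≤ a := le_sup_left.trans (hw ⊥ (bot_lt_iff_ne_bot.2 ha)).le
  have h2 : a \ b = a := by
    by_contra hne
    have := hw (a \ b) (lt_of_le_of_ne sdiff_le hne)
    exact this.not_ge le_sup_sdiff
  rwa [h2]

namespace SubscaledAxioms

theorem wayBelow_of_low (h : SubscaledAxioms d C) {k : ℕ} {a b : M} (ha : Pure C k a)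
    (hb : Low C k b) (hle : b ≤ a) : WayBelow b a :=
  wayBelow_of_le_sdiff (by rwa [h.pure_sdiff_low ha hb])

theorem pure_sdiff_eq_self (h : SubscaledAxioms d C) {k : ℕ} {a b : M} (ha : Pure C k a)
    (hb : Low C k (a ⊓ b)) : a \ b = a := by
  rw [← sdiff_inf_self_left, h.pure_sdiff_low ha hb]

theorem finset_sup_sdiff {ι : Type*} (s : Finset ι) (f : ι → M) (b : M) :
    s.sup f \ b = s.sup fun i => f i \ b := by
  classical
  induction s using Finset.induction_on with
  | empty => simp
  | insert i s _ ih => rw [Finset.sup_insert, Finset.sup_insert, sup_sdiff, ih]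

/-- Pure elements of pairwise small intersection are the pure components of their join. -/
theorem comp_sup_pure (h : SubscaledAxioms d C) (m : ℕ → M) (hm : ∀ i, Pure C i (m i))
    (hi : ∀ i j, i < j → Low C i (m i ⊓ m j)) (n k : ℕ) :
    C k ((Finset.range n).sup m) = if k < n then m k else ⊥ := by
  induction n generalizing k with
  | zero => simp [h.comp_bot]
  | succ n ih =>
    have hlow : Low C n ((Finset.range n).sup m) :=
      h.low_finset_sup _ _ fun i hi => h.low_mono (Finset.mem_range.1 hi) (h.pure_low (hm i))
    have hlow' : Low C (n + 1) ((Finset.range (n + 1)).sup m) :=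
      h.low_finset_sup _ _ fun i hi => h.low_mono (Finset.mem_range.1 hi) (h.pure_low (hm i))
    have e : (Finset.range (n + 1)).sup m = (Finset.range n).sup m ⊔ m n := by
      rw [Finset.range_add_one, Finset.sup_insert, sup_comm]
    have hn : C n ((Finset.range (n + 1)).sup m) = m n := by
      rw [e, h.comp_sup_of_low (h.low_mono (Nat.le_succ n) hlow) (h.pure_low (hm n)),
        h.low_iff.1 hlow n le_rfl, bot_sup_eq, hm n]
    rcases lt_trichotomy k n with hk | hk | hk
    · rw [if_pos (by omega)]
      -- Below the top index the top part is subtracted on both sides: m n from the given join,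
      -- C^n(x) from the join of the components. The small intersections make the other terms
      -- insensitive to this, and the induction hypothesis identifies what is left.
      have e1 : (Finset.range (n + 1)).sup m \ m n = (Finset.range n).sup m := by
        rw [e, sup_sdiff, sdiff_self, sup_bot_eq, finset_sup_sdiff]
        exact Finset.sup_congr rfl fun i hin =>
          h.pure_sdiff_eq_self (hm i) (hi i n (Finset.mem_range.1 hin))
      set x := (Finset.range (n + 1)).sup m with hx
      have e2 : x \ C n x = (Finset.range n).sup fun i => C i x := by
        calc x \ C n x = ((Finset.range (n + 1)).sup fun i => C i x) \ C n x := by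
              rw [show ((Finset.range (n + 1)).sup fun i => C i x) = x from hlow']
          _ = (Finset.range n).sup fun i => C i x \ C n x := by
              rw [finset_sup_sdiff, Finset.range_add_one, Finset.sup_insert, sdiff_self,
                bot_sup_eq]
          _ = _ := ?_
        refine Finset.sup_congr rfl fun i hin => ?_
        have := h.low_inf x (i := i) (j := n) (Finset.mem_range.1 hin).ne
        rw [min_eq_left (Finset.mem_range.1 hin).le] at this
        exact h.pure_sdiff_eq_self (h.pure_comp i x) this
      have e3 := h.comp_low n k x
      rw [← e2, if_pos hk, hn, e1, ih, if_pos hk] at e3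
      exact e3.symm
    · subst hk; rw [if_pos (by omega)]; exact hn
    · rw [if_neg (by omega)]
      exact h.low_iff.1 hlow' k hk

end SubscaledAxioms

/-- The axioms of subscaled lattices, with bounded indices and without reference to `scdim`. -/
structure LowAxioms {L : Type u} [CoheytingAlgebra L] (d : ℕ) (C : ℕ → L → L) : Prop where
  sup_comp : ∀ a : L, ((Finset.range (d + 1)).sup fun i => C i a) = a
  comp_eq_bot : ∀ i : ℕ, d < i → ∀ a : L, C i a = ⊥
  comp_sup_comp : ∀ I : Finset ℕ, I ⊆ Finset.range (d + 1) → ∀ k ≤ d, ∀ a : L,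
    C k (I.sup fun i => C i a) = if k ∈ I then C k a else ⊥
  comp_sup : ∀ k ≤ d, ∀ a b : L, Low C (k + 1) a → Low C (k + 1) b →
    C k (a ⊔ b) = C k a ⊔ C k b
  low_inf : ∀ i j, i < j → j ≤ d → ∀ a : L, Low C i (C i a ⊓ C j a)
  comp_sdiff : ∀ k ≤ d, ∀ a b : L, Low C (k + 1) b → C k a \ b = C k a \ C k b
  low_of_le_sdiff : ∀ k ≤ d, ∀ a b : L, a ≠ ⊥ → b ≤ a \ b → Low C (k + 1) a → Low C k b

/-- Indices above d add nothing because those components vanish, and `scdim` only matters through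
the thresholds `Low`. Apart from the vanishing identities, finitely many first-order conditions
remain. -/
theorem subscaledAxioms_iff {L : Type u} [CoheytingAlgebra L] {d : ℕ} {C : ℕ → L → L} :
    SubscaledAxioms d C ↔ LowAxioms d C := by
  constructor
  · intro h
    refine ⟨h.sup_comp, h.comp_eq_bot, fun I hI k _ => h.comp_sup_comp I hI k,
      fun k _ a b ha hb => h.comp_sup_of_low ha hb, fun i j hij _ a => ?_,
      fun k _ a b hb => h.comp_sdiff_of_low hb, fun k _ a b ha hb hk => ?_⟩
    · have := h.low_inf a hij.ne
      rwa [min_eq_left hij.le] at this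
    · exact (h.isGraded.scdim_lt_scdim_iff ha).1
        (h.scdim_lt a b ha (wayBelow_of_le_sdiff hb)) k hk
  · intro h
    have hg : IsGraded d C := ⟨h.sup_comp, h.comp_eq_bot⟩
    refine ⟨h.sup_comp, h.comp_eq_bot, fun I hI k a => ?_, fun a b k hk => ?_, fun a i j hij => ?_,
      fun a b k hk => ?_, fun a b ha hw => ?_⟩
    · rcases Nat.lt_or_ge d k with hk | hk
      · rw [h.comp_eq_bot k hk, h.comp_eq_bot k hk, ite_self]
      · exact h.comp_sup_comp I hI k hk a
    · rcases Nat.lt_or_ge d k with hkd | hkd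
      · simp [h.comp_eq_bot k hkd]
      · exact h.comp_sup k hkd a b (hg.scdim_le_iff.1 ((le_max_left _ _).trans hk))
          (hg.scdim_le_iff.1 ((le_max_right _ _).trans hk))
    · rw [hg.scdim_lt_iff]
      rcases Nat.lt_or_ge d (max i j) with hd | hd
      · have : C i a ⊓ C j a = ⊥ := by
          rcases lt_max_iff.1 hd with hd | hd
          · rw [h.comp_eq_bot i hd, bot_inf_eq]
          · rw [h.comp_eq_bot j hd, inf_bot_eq]
        rw [this]
        exact hg.low_bot _
      · rcases hij.lt_or_gt with hlt | hlt
        · rw [min_eq_left hlt.le]; exact h.low_inf i j hlt (le_of_max_le_right hd) a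
        · rw [min_eq_right hlt.le, inf_comm]; exact h.low_inf j i hlt (le_of_max_le_left hd) a
    · rcases Nat.lt_or_ge d k with hkd | hkd
      · simp [h.comp_eq_bot k hkd]
      · exact h.comp_sdiff k hkd a b (hg.scdim_le_iff.1 hk)
    · rw [hg.scdim_lt_scdim_iff ha]
      intro k hk
      have hb := (wayBelow_iff ha).1 hw
      rcases Nat.lt_or_ge d k with hkd | hkd
      · exact hg.low_mono hkd (hg.low_top b)
      · exact h.low_of_le_sdiff k hkd a b ha hb hk

end Calculus

end Subscaled

namespace Subscaled

/-! ### Systems of pure elements, and iterated use of Splitting and Catenarity -/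

section SupOn

variable {M : Type u} [CoheytingAlgebra M] {J K : Type} [Fintype J] [Fintype K]

/-- The join of the `x j` over all `j` satisfying `p`. -/
noncomputable def supOn (x : J → M) (p : J → Prop) : M :=
  open Classical in (Finset.univ.filter p).sup x

theorem supOn_le_iff {x : J → M} {p : J → Prop} {a : M} :
    supOn x p ≤ a ↔ ∀ j, p j → x j ≤ a := by
  simp [supOn, Finset.sup_le_iff]

theorem le_supOn {x : J → M} {p : J → Prop} {j : J} (hj : p j) : x j ≤ supOn x p :=
  supOn_le_iff.1 le_rfl j hj

theorem supOn_le_supOn {x y : J → M} {p q : J → Prop} (h : ∀ j, p j → q j ∧ x j ≤ y j) :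
    supOn x p ≤ supOn y q :=
  supOn_le_iff.2 fun j hj => (h j hj).2.trans (le_supOn (h j hj).1)

theorem supOn_inf_le {x : J → M} {p : J → Prop} {a b : M} (h : ∀ j, p j → x j ⊓ a ≤ b) :
    supOn x p ⊓ a ≤ b := by
  classical
  unfold supOn
  rw [Finset.sup_inf_distrib_right]
  exact Finset.sup_le fun j hj => h j (by simpa using hj)

theorem inf_supOn_le {x : J → M} {p : J → Prop} {a b : M} (h : ∀ j, p j → a ⊓ x j ≤ b) :
    a ⊓ supOn x p ≤ b := by
  rw [inf_comm]
  exact supOn_inf_le fun j hj => by rw [inf_comm]; exact h j hj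

variable {C : ℕ → M → M} {d : ℕ}

theorem SubscaledAxioms.low_supOn (h : SubscaledAxioms d C) {k : ℕ} {x : J → M} {p : J → Prop}
    (hx : ∀ j, p j → Low C k (x j)) : Low C k (supOn x p) :=
  h.low_finset_sup _ _ fun j hj => hx j (by simpa using hj)

theorem SubscaledAxioms.pure_supOn (h : SubscaledAxioms d C) {k : ℕ} {x : J → M} {p : J → Prop}
    (hx : ∀ j, p j → Pure C k (x j)) : Pure C k (supOn x p) :=
  h.pure_finset_sup _ _ fun j hj => hx j (by simpa using hj)

/-- A family of nonzero pure elements indexed by a finite ranked poset, closed under meets up to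
joins, with join `E`. -/
structure IsSystem [PartialOrder J] (C : ℕ → M → M) (δ : J → ℕ) (x : J → M) (E : M) : Prop where
  pure : ∀ j, Pure C (δ j) (x j)
  ne_bot : ∀ j, x j ≠ ⊥
  mono : ∀ i j, i ≤ j → x i ≤ x j
  inf_le : ∀ i j, x i ⊓ x j ≤ supOn x fun l => l ≤ i ∧ l ≤ j
  sup_eq : (supOn x fun _ => True) = E

/-- The maps of ranked posets dual to embeddings. -/
structure IsPMap [PartialOrder J] [PartialOrder K] (δK : K → ℕ) (δJ : J → ℕ) (f : K → J) :
    Prop where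
  mono : Monotone f
  dim_le : ∀ k, δK k ≤ δJ (f k)
  lift : ∀ k j, f k ≤ j → ∃ k', k ≤ k' ∧ f k' = j ∧ δK k' = δJ j
  surj : Function.Surjective f

/-- Splitting applied once for each element after the first: A t is separated from a remainder
prescribed to contain all the other B s, and the remainder is split further. It produces all
full-rank points over a given point simultaneously. -/
theorem exists_split (h : SubscaledAxioms d C) (hs : Splitting M) {ι : Type*} {p : ℕ}
    {T : Finset ι} (hT : T.Nonempty) (B : ι → M) (a : M) (ha : Pure C p a) (ha0 : a ≠ ⊥)
    (hB : ∀ t ∈ T, Low C p (B t)) (hBa : ∀ t ∈ T, B t ≤ a) :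
    ∃ A : ι → M, (∀ t ∈ T, Pure C p (A t) ∧ A t ≠ ⊥ ∧ B t ≤ A t) ∧ T.sup A = a ∧
      ∀ s ∈ T, ∀ t ∈ T, s ≠ t → A s ⊓ A t ≤ B s ⊓ B t := by
  classical
  induction hT using Finset.Nonempty.cons_induction generalizing a with
  | singleton t =>
    refine ⟨fun _ => a, ?_, by simp, ?_⟩
    · intro s hs
      exact ⟨ha, ha0, hBa s hs⟩
    · intro s hs t ht hne
      rw [Finset.mem_singleton] at hs ht
      exact absurd (hs.trans ht.symm) hne
  | cons t T htT hT ih =>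
    have hb1 : Low C p (B t) := hB t (Finset.mem_cons_self t T)
    have hb2 : Low C p (T.sup B) :=
      h.low_finset_sup _ _ fun s hs => hB s (Finset.mem_cons_of_mem hs)
    have hle : B t ⊔ T.sup B ≤ a :=
      sup_le (hBa t (Finset.mem_cons_self t T))
        (Finset.sup_le fun s hs => hBa s (Finset.mem_cons_of_mem hs))
    obtain ⟨a1, a2, h1, h2, hb1a, hb2a, e1, e2, e3⟩ :=
      hs (B t) (T.sup B) a (h.wayBelow_of_low ha (h.low_sup hb1 hb2) hle) ha0
    have hp1 : Pure C p a1 := by rw [e1]; exact h.pure_sdiff ha _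
    have hp2 : Pure C p a2 := by rw [e2]; exact h.pure_sdiff ha _
    obtain ⟨A, hA1, hA2, hA3⟩ := ih a2 hp2 h2 (fun s hs => hB s (Finset.mem_cons_of_mem hs))
      (fun s hs => (Finset.le_sup hs).trans hb2a)
    have hA2' : ∀ s ∈ T, A s ≤ a2 := fun s hs => hA2 ▸ Finset.le_sup hs
    -- Splitting only bounds the meet by the join of all B s'. Within A s, however, a term with s' ≠
    -- s lies under A s' ⊓ A s, hence under B s.
    have key : ∀ s ∈ T, a1 ⊓ A s ≤ B t ⊓ B s := by
      intro s hs
      have h4 : a1 ⊓ A s ≤ B t ⊓ T.sup B := by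
        rw [← e3]; exact inf_le_inf_left _ (hA2' s hs)
      refine le_inf (h4.trans inf_le_left) ?_
      have h5 : a1 ⊓ A s ≤ T.sup B ⊓ A s := le_inf (h4.trans inf_le_right) inf_le_right
      refine h5.trans ?_
      rw [Finset.sup_inf_distrib_right]
      refine Finset.sup_le fun s' hs' => ?_
      by_cases hss : s' = s
      · subst hss; exact inf_le_left
      · exact ((inf_le_inf_right _ (hA1 s' hs').2.2).trans (hA3 s' hs' s hs hss)).trans inf_le_right
    have hne : ∀ s ∈ T, s ≠ t := fun s hs e => htT (e ▸ hs)
    refine ⟨Function.update A t a1, ?_, ?_, ?_⟩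
    · intro s hs
      rcases Finset.mem_cons.1 hs with rfl | hs
      · rw [Function.update_self]; exact ⟨hp1, h1, hb1a⟩
      · rw [Function.update_of_ne (hne s hs)]; exact hA1 s hs
    · rw [Finset.sup_cons, Function.update_self,
        Finset.sup_congr rfl fun s hs => Function.update_of_ne (hne s hs) a1 A, hA2]
      apply le_antisymm
      · exact sup_le (e1 ▸ sdiff_le) (e2 ▸ sdiff_le)
      · rw [← sdiff_le_iff, ← e2]
    · intro s hs s' hs' hss
      rcases Finset.mem_cons.1 hs with e | hsT <;> rcases Finset.mem_cons.1 hs' with e' | hsT'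
      · exact absurd (e.trans e'.symm) hss
      · subst e
        rw [Function.update_self, Function.update_of_ne (hne s' hsT')]
        exact key s' hsT'
      · subst e'
        rw [Function.update_self, Function.update_of_ne (hne s hsT), inf_comm, inf_comm (B s)]
        exact key s hsT
      · rw [Function.update_of_ne (hne s hsT), Function.update_of_ne (hne s' hsT')]
        exact hA3 s hsT s' hsT' hss

/-- Splitting a along c and b gives a piece a1 containing c that meets b only in c. Catenarity
between each pure component of c and a1 gives q-pure elements inside a1, whose join works. It
produces a single point of rank q less than p. -/
theorem exists_pure_inf_eq (h : SubscaledAxioms d C) (hc : Catenarity C) (hs : Splitting M)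
    {p q : ℕ} (hqp : q < p) {a b c : M} (ha : Pure C p a) (ha0 : a ≠ ⊥) (hb : Low C p b)
    (hba : b ≤ a) (hcq : Low C q c) (hcb : c ≤ b) :
    ∃ y, Pure C q y ∧ y ≠ ⊥ ∧ c ≤ y ∧ y ≤ a ∧ y ⊓ b ≤ c := by
  obtain ⟨a1, a2, h1, -, hca, hba2, e1, -, e3⟩ :=
    hs c b a (by rw [sup_eq_right.2 hcb]; exact h.wayBelow_of_low ha hb hba) ha0
  have hp1 : Pure C p a1 := by rw [e1]; exact h.pure_sdiff ha _
  have hy : ∀ i : ℕ, ∃ y, i ≤ q → y ≠ ⊥ ∧ Pure C q y ∧ C i c ≤ y ∧ y ≤ a1 := by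
    intro i
    by_cases hi : i ≤ q
    · obtain ⟨y, hy0, hyp, hy1, hy2⟩ := hc i q p hi hqp.le (C i c) a1 ((h.comp_le i c).trans hca) h1
        (h.isScPure_iff.2 (h.pure_comp i c)) (h.isScPure_iff.2 hp1)
      exact ⟨y, fun _ => ⟨hy0, h.isScPure_iff.1 hyp, hy1, hy2⟩⟩
    · exact ⟨⊥, fun h => absurd h hi⟩
  choose y hy using hy
  -- The index q, at which the component of c is zero, is included so that the join is nonzero even
  -- for q = 0.
  have hya : (Finset.range (q + 1)).sup y ≤ a1 :=
    Finset.sup_le fun i hi => (hy i (Nat.lt_succ_iff.1 (Finset.mem_range.1 hi))).2.2.2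
  refine ⟨(Finset.range (q + 1)).sup y, ?_, ?_, ?_, hya.trans (e1 ▸ sdiff_le), ?_⟩
  · exact h.pure_finset_sup _ _ fun i hi => (hy i (Nat.lt_succ_iff.1 (Finset.mem_range.1 hi))).2.1
  · intro h0
    have : y 0 ≤ ⊥ := h0 ▸ Finset.le_sup (Finset.mem_range.2 (Nat.succ_pos q))
    exact (hy 0 (Nat.zero_le q)).1 (le_bot_iff.1 this)
  · have hcq' : ((Finset.range q).sup fun i => C i c) = c := hcq
    conv_lhs => rw [← hcq']
    refine Finset.sup_le fun i hi => ?_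
    have hi' := Finset.mem_range.1 hi
    exact (hy i hi'.le).2.2.1.trans (Finset.le_sup (Finset.mem_range.2 (by omega)))
  · calc (Finset.range (q + 1)).sup y ⊓ b ≤ a1 ⊓ a2 := inf_le_inf hya hba2
      _ = c ⊓ b := e3
      _ ≤ c := inf_le_left

end SupOn

/-! ### Realizing extensions of ranked posets in super scaled lattices -/

section Extension

variable {M : Type u} [CoheytingAlgebra M] {J K : Type} [Fintype J] [Fintype K]
  [PartialOrder J] [PartialOrder K] {C : ℕ → M → M} {d : ℕ}

/-- A system indexed by a lower part `P` of `K`, compatible with the system `x`. -/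
structure IsPartialSystem (C : ℕ → M → M) (δK : K → ℕ) (δJ : J → ℕ) (f : K → J) (x : J → M)
    (P : Finset K) (y : K → M) : Prop where
  down : ∀ k ∈ P, ∀ m ≤ k, m ∈ P
  pure : ∀ k ∈ P, Pure C (δK k) (y k)
  ne_bot : ∀ k ∈ P, y k ≠ ⊥
  mono : ∀ k ∈ P, ∀ m ≤ k, y m ≤ y k
  le : ∀ k ∈ P, y k ≤ x (f k)
  inf_le : ∀ k ∈ P, ∀ k' ∈ P, y k ⊓ y k' ≤ supOn y fun m => m ≤ k ∧ m ≤ k'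
  xinf_le : ∀ k ∈ P, ∀ j, x j ⊓ y k ≤ supOn y fun m => m ≤ k ∧ f m ≤ j
  fill : ∀ k ∈ P, δK k = δJ (f k) →
    (∀ k', f k' = f k → k' ∈ P) ∧ x (f k) ≤ supOn y fun m => f m ≤ f k

variable {δK : K → ℕ} {δJ : J → ℕ} {f : K → J} {x : J → M} {E : M} {P : Finset K} {y : K → M}

/-- Points over j whose strict predecessors are all placed may be added as soon as each new v t
meets the part of x j already in use, namely the x l with l < j and the placed elements over j, only
inside the join of the predecessors of t. Meets with all other elements are then controlled because
v t lies in x j. The `fill` clause is kept by adding full-rank points over j only when the fibre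
becomes complete and covers x j. -/
theorem IsPartialSystem.extend (hx : IsSystem C δJ x E)
    (hf : IsPMap δK δJ f) (hP : IsPartialSystem C δK δJ f x P y) (j : J) (T : Finset K) (v : K → M)
    (hTP : ∀ t ∈ T, t ∉ P) (hTf : ∀ t ∈ T, f t = j) (hTd : ∀ t ∈ T, ∀ m < t, m ∈ P)
    (hv : ∀ t ∈ T, Pure C (δK t) (v t) ∧ v t ≠ ⊥ ∧ (supOn y fun m => m < t) ≤ v t ∧ v t ≤ x j ∧
      v t ⊓ ((supOn x fun l => l < j) ⊔ supOn y fun m => m ∈ P ∧ f m = j) ≤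
        supOn y fun m => m < t)
    (hvv : ∀ s ∈ T, ∀ t ∈ T, s ≠ t →
      v s ⊓ v t ≤ (supOn y fun m => m < s) ⊓ supOn y fun m => m < t)
    (hfill : ∀ t ∈ T, δK t = δJ j → (∀ k, f k = j → k ∈ P ∨ k ∈ T) ∧ x j ≤ T.sup v) :
    ∃ P' y', P ⊆ P' ∧ T ⊆ P' ∧ IsPartialSystem C δK δJ f x P' y' := by
  classical
  set b := (supOn x fun l => l < j) ⊔ supOn y fun m => m ∈ P ∧ f m = j with hb
  set y' : K → M := fun k => if k ∈ T then v k else y k with hy'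
  have yT : ∀ t ∈ T, y' t = v t := fun t ht => by simp [hy', ht]
  have yP : ∀ k ∈ P, y' k = y k := fun k hk => by
    have : k ∉ T := fun h => hTP k h hk
    simp [hy', this]
  have hyb : ∀ n ∈ P, f n ≤ j → y n ≤ b := by
    intro n hn hnj
    rcases hnj.lt_or_eq with hlt | heq
    · exact ((hP.le n hn).trans (le_supOn hlt)).trans le_sup_left
    · exact (le_supOn (p := fun m => m ∈ P ∧ f m = j) ⟨hn, heq⟩).trans le_sup_right
  -- Since v t ≤ x j, `xinf_le` splits the meet into pieces y n with f n ≤ j. These lie in the used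
  -- part of x j, so v t meets them only below its own predecessors.
  have k1 : ∀ t ∈ T, ∀ m ∈ P, v t ⊓ y m ≤ supOn y fun n => n < t ∧ n ≤ m := by
    intro t ht m hm
    have h1 : v t ⊓ y m ≤ v t ⊓ supOn y fun n => n ≤ m ∧ f n ≤ j :=
      le_inf inf_le_left ((inf_le_inf_right _ (hv t ht).2.2.2.1).trans (hP.xinf_le m hm j))
    refine h1.trans (inf_supOn_le fun n hn => ?_)
    have hnP := hP.down m hm n hn.1
    have h2 : v t ⊓ y n ≤ (supOn y fun m => m < t) ⊓ y n :=
      le_inf ((inf_le_inf_left _ (hyb n hnP hn.2)).trans (hv t ht).2.2.2.2) inf_le_right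
    refine h2.trans (supOn_inf_le fun m' hm' => ?_)
    refine (hP.inf_le m' (hTd t ht m' hm') n hnP).trans (supOn_le_supOn fun l hl => ?_)
    exact ⟨⟨hl.1.trans_lt hm', hl.2.trans hn.1⟩, le_rfl⟩
  have k2 : ∀ t ∈ T, ∀ j', ¬ j ≤ j' → x j' ⊓ v t ≤ supOn y fun n => n < t ∧ f n ≤ j' := by
    intro t ht j' hj'
    have h1 : x j' ⊓ v t ≤ supOn y fun m => m < t := by
      refine le_trans ?_ (hv t ht).2.2.2.2
      refine le_inf inf_le_right ?_
      refine (inf_le_inf_left _ (hv t ht).2.2.2.1).trans ((hx.inf_le j' j).trans ?_)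
      refine le_trans ?_ le_sup_left
      refine supOn_le_supOn fun l hl => ⟨lt_of_le_of_ne hl.2 fun e => hj' (e ▸ hl.1), le_rfl⟩
    refine (le_inf inf_le_left h1).trans (inf_supOn_le fun m hm => ?_)
    refine (hP.xinf_le m (hTd t ht m hm) j').trans (supOn_le_supOn fun n hn => ?_)
    exact ⟨⟨hn.1.trans_lt hm, hn.2⟩, le_rfl⟩
  have hlift : ∀ {p q : K → Prop}, (∀ m, p m → q m ∧ m ∈ P) → supOn y p ≤ supOn y' q := by
    intro p q hpq
    exact supOn_le_supOn fun m hm => ⟨(hpq m hm).1, (yP m (hpq m hm).2).ge⟩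
  refine ⟨P ∪ T, y', Finset.subset_union_left, Finset.subset_union_right, ?_⟩
  constructor
  · intro k hk m hm
    rcases Finset.mem_union.1 hk with hk | hk
    · exact Finset.mem_union_left _ (hP.down k hk m hm)
    · rcases hm.lt_or_eq with hlt | heq
      · exact Finset.mem_union_left _ (hTd k hk m hlt)
      · exact heq ▸ Finset.mem_union_right _ hk
  · intro k hk
    rcases Finset.mem_union.1 hk with hk | hk
    · rw [yP k hk]; exact hP.pure k hk
    · rw [yT k hk]; exact (hv k hk).1
  · intro k hk
    rcases Finset.mem_union.1 hk with hk | hk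
    · rw [yP k hk]; exact hP.ne_bot k hk
    · rw [yT k hk]; exact (hv k hk).2.1
  · intro k hk m hm
    rcases Finset.mem_union.1 hk with hk | hk
    · rw [yP k hk, yP m (hP.down k hk m hm)]; exact hP.mono k hk m hm
    · rcases hm.lt_or_eq with hlt | heq
      · rw [yT k hk, yP m (hTd k hk m hlt)]
        exact (le_supOn (p := fun m => m < k) hlt).trans (hv k hk).2.2.1
      · rw [heq]
  · intro k hk
    rcases Finset.mem_union.1 hk with hk | hk
    · rw [yP k hk]; exact hP.le k hk
    · rw [yT k hk, hTf k hk]; exact (hv k hk).2.2.2.1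
  · have aux : ∀ t ∈ T, ∀ m ∈ P, y' t ⊓ y' m ≤ supOn y' fun n => n ≤ t ∧ n ≤ m := by
      intro t ht m hm
      rw [yT t ht, yP m hm]
      exact (k1 t ht m hm).trans
        (hlift fun n hn => ⟨⟨hn.1.le, hn.2⟩, hTd t ht n hn.1⟩)
    intro k hk k' hk'
    rcases Finset.mem_union.1 hk with hk | hk <;> rcases Finset.mem_union.1 hk' with hk' | hk'
    · rw [yP k hk, yP k' hk']
      exact (hP.inf_le k hk k' hk').trans (hlift fun n hn => ⟨hn, hP.down k hk n hn.1⟩)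
    · rw [inf_comm]
      refine (aux k' hk' k hk).trans (supOn_le_supOn fun n hn => ⟨⟨hn.2, hn.1⟩, le_rfl⟩)
    · exact aux k hk k' hk'
    · by_cases hkk : k = k'
      · subst hkk
        exact inf_le_left.trans (le_supOn (p := fun m => m ≤ k ∧ m ≤ k) ⟨le_rfl, le_rfl⟩)
      · rw [yT k hk, yT k' hk']
        refine (hvv k hk k' hk' hkk).trans (supOn_inf_le fun m hm => inf_supOn_le fun m' hm' => ?_)
        refine (hP.inf_le m (hTd k hk m hm) m' (hTd k' hk' m' hm')).trans (hlift fun n hn => ?_)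
        exact ⟨⟨hn.1.trans hm.le, hn.2.trans hm'.le⟩, hTd k hk n (hn.1.trans_lt hm)⟩
  · intro k hk j'
    rcases Finset.mem_union.1 hk with hk | hk
    · rw [yP k hk]
      exact (hP.xinf_le k hk j').trans (hlift fun n hn => ⟨hn, hP.down k hk n hn.1⟩)
    · by_cases hj : j ≤ j'
      · exact inf_le_right.trans (le_supOn (p := fun m => m ≤ k ∧ f m ≤ j')
          ⟨le_rfl, (hTf k hk).trans_le hj⟩)
      · rw [yT k hk]
        exact (k2 k hk j' hj).trans (hlift fun n hn => ⟨⟨hn.1.le, hn.2⟩, hTd k hk n hn.1⟩)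
  · intro k hk hkd
    rcases Finset.mem_union.1 hk with hk | hk
    · obtain ⟨h1, h2⟩ := hP.fill k hk hkd
      refine ⟨fun k' hk' => Finset.mem_union_left _ (h1 k' hk'), h2.trans (hlift fun n hn => ?_)⟩
      obtain ⟨t, hnt, ht, -⟩ := hf.lift n _ hn
      exact ⟨hn, hP.down t (h1 t ht) n hnt⟩
    · rw [hTf k hk] at hkd ⊢
      obtain ⟨h1, h2⟩ := hfill k hk hkd
      refine ⟨fun k' hk' => Finset.mem_union.2 (h1 k' hk'), h2.trans (Finset.sup_le fun t ht => ?_)⟩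
      rw [← yT t ht]
      exact le_supOn (p := fun m => f m ≤ j) (hTf t ht).le

/-- A minimal j with an incomplete fibre is treated: first its missing points of rank smaller than
that of j, one at a time from below by `exists_pure_inf_eq`, and then all its points of full rank at
once by `exists_split`. -/
theorem IsPartialSystem.exists_larger (h : SubscaledAxioms d C) (hc : Catenarity C)
    (hs : Splitting M) (hδK : StrictMono δK) (hδJ : StrictMono δJ) (hx : IsSystem C δJ x E)
    (hf : IsPMap δK δJ f) (hP : IsPartialSystem C δK δJ f x P y) (k0 : K) (hk0 : k0 ∉ P) :
    ∃ P' y', P ⊂ P' ∧ IsPartialSystem C δK δJ f x P' y' := by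
  classical
  obtain ⟨j, ⟨k1, hk1P, hk1j⟩, hjmin⟩ :=
    wellFounded_lt.has_min {j : J | ∃ k, k ∉ P ∧ f k = j} ⟨f k0, k0, hk0, rfl⟩
  have hlt : ∀ m, f m < j → m ∈ P := fun m hm => by
    by_contra hmP; exact hjmin (f m) ⟨m, hmP, rfl⟩ hm
  -- A placed point of full rank would, by `fill`, mean that the fibre over j is complete. Hence the
  -- used part b has dimension less than δJ j, which is what makes Splitting applicable in x j.
  have htop : ∀ m ∈ P, f m = j → δK m < δJ j := fun m hm hmj => by
    refine lt_of_le_of_ne (hmj ▸ hf.dim_le m) fun e => hk1P ?_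
    exact (hP.fill m hm (by rw [hmj, e])).1 k1 (by rw [hk1j, hmj])
  set b := (supOn x fun l => l < j) ⊔ supOn y fun m => m ∈ P ∧ f m = j with hb
  have hblow : Low C (δJ j) b := by
    refine h.low_sup (h.low_supOn fun l hl => ?_) (h.low_supOn fun m hm => ?_)
    · exact h.low_mono (hδJ hl) (h.pure_low (hx.pure l))
    · exact h.low_mono (htop m hm.1 hm.2) (h.pure_low (hP.pure m hm.1))
  have hbx : b ≤ x j := by
    refine sup_le (supOn_le_iff.2 fun l hl => hx.mono l j hl.le) (supOn_le_iff.2 fun m hm => ?_)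
    exact hm.2 ▸ hP.le m hm.1
  have hlowlt : ∀ t, (∀ m < t, m ∈ P) → Low C (δK t) (supOn y fun m => m < t) := fun t ht =>
    h.low_supOn fun m hm => h.low_mono (hδK hm) (h.pure_low (hP.pure m (ht m hm)))
  have hltb : ∀ t, f t = j → (∀ m < t, m ∈ P) → (supOn y fun m => m < t) ≤ b := by
    intro t htj ht
    refine supOn_le_iff.2 fun m hm => ?_
    have hmj : f m ≤ j := htj ▸ hf.mono hm.le
    rcases hmj.lt_or_eq with hl | he
    · exact ((hP.le m (ht m hm)).trans (le_supOn hl)).trans le_sup_left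
    · exact (le_supOn (p := fun m => m ∈ P ∧ f m = j) ⟨ht m hm, he⟩).trans le_sup_right
  by_cases hcase : ∃ k, k ∉ P ∧ f k = j ∧ δK k < δJ j
  · obtain ⟨k, ⟨hkP, hkj, hkd⟩, hkmin⟩ :=
      wellFounded_lt.has_min {k : K | k ∉ P ∧ f k = j ∧ δK k < δJ j} hcase
    have hkdown : ∀ m < k, m ∈ P := by
      intro m hm
      by_contra hmP
      have hmj : f m ≤ j := hkj ▸ hf.mono hm.le
      rcases hmj.lt_or_eq with hl | he
      · exact hmP (hlt m hl)
      · exact hkmin m ⟨hmP, he, (hδK hm).trans hkd⟩ hm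
    obtain ⟨v, hv1, hv2, hv3, hv4, hv5⟩ := exists_pure_inf_eq h hc hs hkd (hx.pure j) (hx.ne_bot j)
      hblow hbx (hlowlt k hkdown) (hltb k hkj hkdown)
    obtain ⟨P', y', h1, h2, h3⟩ := hP.extend hx hf j {k} (fun _ => v)
      (by simpa using hkP) (by simpa using hkj) (by simpa using hkdown)
      (by simpa using ⟨hv1, hv2, hv3, hv4, hv5⟩)
      (by intro s hs t ht hne; simp at hs ht; exact absurd (hs.trans ht.symm) hne)
      (by intro t ht he; simp at ht; subst ht; omega)
    exact ⟨P', y', ⟨h1, fun h' => hkP (h' (h2 (Finset.mem_singleton_self k)))⟩, h3⟩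
  · push Not at hcase
    set T : Finset K := Finset.univ.filter fun k => f k = j ∧ δK k = δJ j with hT
    have memT : ∀ t, t ∈ T ↔ f t = j ∧ δK t = δJ j := fun t => by simp [hT]
    have hTP : ∀ t ∈ T, t ∉ P := fun t ht htP =>
      (htop t htP ((memT t).1 ht).1).ne ((memT t).1 ht).2
    have hk1T : k1 ∈ T :=
      (memT k1).2 ⟨hk1j, le_antisymm (hk1j ▸ hf.dim_le k1) (hcase k1 hk1P hk1j)⟩
    have hTd : ∀ t ∈ T, ∀ m < t, m ∈ P := by
      intro t ht m hm
      obtain ⟨htj, htd⟩ := (memT t).1 ht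
      by_contra hmP
      have hmj : f m ≤ j := htj ▸ hf.mono hm.le
      rcases hmj.lt_or_eq with hl | he
      · exact hmP (hlt m hl)
      · have := hcase m hmP he
        have := hδK hm
        omega
    obtain ⟨A, hA1, hA2, hA3⟩ := exists_split h hs ⟨k1, hk1T⟩ (fun t => supOn y fun m => m < t)
      (x j) (hx.pure j) (hx.ne_bot j)
      (fun t ht => ((memT t).1 ht).2 ▸ hlowlt t (hTd t ht))
      (fun t ht => (hltb t ((memT t).1 ht).1 (hTd t ht)).trans hbx)
    -- Every placed point over some element ≤ j lifts to a point of full rank over j, which is not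
    -- yet placed and so lies strictly above it. Thus the used part of x j is covered by the
    -- prescribed parts B t, and the bound on A s ⊓ A t also bounds A t ⊓ b.
    have hyT : ∀ m, f m ≤ j → m ∈ P → y m ≤ T.sup fun t => supOn y fun m => m < t := by
      intro m hmj hm
      obtain ⟨t, hmt, htj, htd⟩ := hf.lift m j hmj
      have htT : t ∈ T := (memT t).2 ⟨htj, htd⟩
      have hlt : m < t := lt_of_le_of_ne hmt fun e => hTP t htT (e ▸ hm)
      exact (le_supOn (p := fun m => m < t) hlt).trans
        (Finset.le_sup (f := fun t => supOn y fun m => m < t) htT)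
    have hbB : b ≤ T.sup fun t => supOn y fun m => m < t := by
      refine sup_le (supOn_le_iff.2 fun l hl => ?_) (supOn_le_iff.2 fun m hm => ?_)
      · obtain ⟨k, hk⟩ := hf.surj l
        obtain ⟨k', -, hk', hk'd⟩ := hf.lift k l hk.le
        have hk'P : k' ∈ P := hlt k' (hk'.trans_lt hl)
        have := (hP.fill k' hk'P (by rw [hk', hk'd])).2
        rw [hk'] at this
        refine this.trans (supOn_le_iff.2 fun m hm => hyT m (hm.trans hl.le) (hlt m (hm.trans_lt hl)))
      · exact hyT m hm.2.le hm.1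
    obtain ⟨P', y', h1, h2, h3⟩ := hP.extend hx hf j T A hTP (fun t ht => ((memT t).1 ht).1) hTd
      (by
        intro t ht
        obtain ⟨hp, h0, hB⟩ := hA1 t ht
        refine ⟨((memT t).1 ht).2 ▸ hp, h0, hB, hA2 ▸ Finset.le_sup ht, ?_⟩
        refine (inf_le_inf_left _ hbB).trans ?_
        rw [Finset.sup_inf_distrib_left]
        refine Finset.sup_le fun s hs => ?_
        by_cases hst : s = t
        · subst hst; exact inf_le_right
        · exact ((inf_le_inf_left _ (hA1 s hs).2.2).trans (hA3 t ht s hs (Ne.symm hst))).trans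
            inf_le_left)
      hA3
      (by
        intro t ht _
        refine ⟨fun k hk => ?_, hA2.ge⟩
        by_cases hkP : k ∈ P
        · exact Or.inl hkP
        · exact Or.inr ((memT k).2 ⟨hk, le_antisymm (hk ▸ hf.dim_le k) (hcase k hkP hk)⟩))
    exact ⟨P', y', ⟨h1, fun h' => hk1P (h' (h2 hk1T))⟩, h3⟩

/-- In a super scaled lattice every extension of a finite ranked poset is realized. -/
theorem exists_system_extension (h : SubscaledAxioms d C) (hc : Catenarity C)
    (hs : Splitting M) (hδK : StrictMono δK) (hδJ : StrictMono δJ) (hx : IsSystem C δJ x E)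
    (hf : IsPMap δK δJ f) :
    ∃ y : K → M, IsSystem C δK y E ∧ ∀ j, x j = supOn y fun k => f k ≤ j := by
  classical
  have key : ∀ n : ℕ, ∀ P : Finset K, ∀ y, (Finset.univ \ P).card ≤ n →
      IsPartialSystem C δK δJ f x P y → ∃ y', IsPartialSystem C δK δJ f x Finset.univ y' := by
    intro n
    induction n with
    | zero =>
      intro P y hn hP
      have : P = Finset.univ := by
        rw [Nat.le_zero, Finset.card_eq_zero, Finset.sdiff_eq_empty_iff_subset] at hn
        exact Finset.univ_subset_iff.1 hn
      exact ⟨y, this ▸ hP⟩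
    | succ n ih =>
      intro P y hn hP
      by_cases hPu : P = Finset.univ
      · exact ⟨y, hPu ▸ hP⟩
      · obtain ⟨k0, hk0⟩ : ∃ k0, k0 ∉ P := by
          by_contra hcon
          push Not at hcon
          exact hPu (Finset.eq_univ_iff_forall.2 hcon)
        obtain ⟨P', y', hPP, hP'⟩ := hP.exists_larger h hc hs hδK hδJ hx hf k0 hk0
        refine ih P' y' ?_ hP'
        have : (Finset.univ \ P').card < (Finset.univ \ P).card :=
          Finset.card_lt_card (Finset.ssubset_iff_subset_ne.2
            ⟨Finset.sdiff_subset_sdiff le_rfl hPP.1, fun e => hPP.ne ?_⟩)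
        · omega
        · have := congrArg (fun S => Finset.univ \ S) e
          simpa using this.symm
  obtain ⟨y, hy⟩ := key _ ∅ (fun _ => ⊥) le_rfl (by constructor <;> simp)
  -- Surjectivity and lifting put a point of full rank in every fibre, so `fill` is available for
  -- every j.
  have hxy : ∀ j, x j = supOn y fun k => f k ≤ j := by
    intro j
    obtain ⟨k, hk⟩ := hf.surj j
    obtain ⟨k', -, hk', hk'd⟩ := hf.lift k j hk.le
    apply le_antisymm
    · have := (hy.fill k' (Finset.mem_univ _) (by rw [hk', hk'd])).2
      rwa [hk'] at this
    · exact supOn_le_iff.2 fun m hm => (hy.le m (Finset.mem_univ _)).trans (hx.mono _ _ hm)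
  refine ⟨y, ⟨fun k => hy.pure k (Finset.mem_univ _), fun k => hy.ne_bot k (Finset.mem_univ _),
    fun m k hmk => hy.mono k (Finset.mem_univ _) m hmk,
    fun k k' => hy.inf_le k (Finset.mem_univ _) k' (Finset.mem_univ _), ?_⟩, hxy⟩
  rw [← hx.sup_eq]
  apply le_antisymm
  · exact supOn_le_iff.2 fun k _ => (hy.le k (Finset.mem_univ _)).trans (le_supOn (p := fun _ => True) trivial)
  · refine supOn_le_iff.2 fun j _ => ?_
    rw [hxy j]
    exact supOn_le_supOn fun k _ => ⟨trivial, le_rfl⟩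

end Extension

end Subscaled

namespace Subscaled

/-! ### Local finiteness with an explicit bound -/

section LocalFiniteness

variable {M : Type u} [CoheytingAlgebra M] {C : ℕ → M → M} {d : ℕ}

/-- Bound for the size of the ranked poset generated by `n` elements of dimension less than `k`. -/
def sizeBound : ℕ → ℕ → ℕ
  | 0, _ => 0
  | k + 1, n => 2 ^ n + sizeBound k (2 ^ (n + 1))

/-- The cells cut out by the g i cover a. Going down from the full index set, what is left of a
after removing the cell of S is distributed over the g t with t outside S, that is, over larger sets
S. -/
theorem le_of_forall_atom_le {ι : Type} [Fintype ι] [DecidableEq ι] (g : ι → M) {a u : M}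
    (h : ∀ S : Finset ι, (S.inf g ⊓ a) \ Sᶜ.sup g ≤ u) : a ≤ u := by
  have key : ∀ n, ∀ S : Finset ι, Sᶜ.card ≤ n → S.inf g ⊓ a ≤ u := by
    intro n
    induction n with
    | zero =>
      intro S hS
      have h1 := h S
      rw [Finset.card_eq_zero.1 (Nat.le_zero.1 hS)] at h1
      simpa using h1
    | succ n ih =>
      intro S hS
      have h1 : S.inf g ⊓ a ≤ Sᶜ.sup g ⊔ u := sdiff_le_iff.1 (h S)
      have h2 : S.inf g ⊓ a ≤ ((Sᶜ.sup g) ⊓ (S.inf g ⊓ a)) ⊔ u := by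
        rw [sup_inf_right]
        exact le_inf h1 le_sup_left
      refine h2.trans (sup_le ?_ le_rfl)
      rw [Finset.sup_inf_distrib_right]
      refine Finset.sup_le fun t ht => ?_
      have h3 : g t ⊓ (S.inf g ⊓ a) = (insert t S).inf g ⊓ a := by
        rw [Finset.inf_insert, inf_assoc]
      rw [h3]
      apply ih
      have : (insert t S)ᶜ.card < Sᶜ.card := Finset.card_lt_card (by
        rw [Finset.compl_ssubset_compl]
        exact Finset.ssubset_insert (Finset.mem_compl.1 ht))
      omega
  simpa using key _ ∅ le_rfl

/-- Here axiom 6 enters: if subtracting b leaves a unchanged, then a ⊓ b ≪ a, so the intersection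
has smaller dimension. This is the converse of `pure_sdiff_eq_self`. -/
theorem SubscaledAxioms.low_inf_of_sdiff_eq (h : SubscaledAxioms d C) {k : ℕ} {a b : M}
    (ha : Pure C k a) (hab : a \ b = a) : Low C k (a ⊓ b) := by
  by_cases h0 : a = ⊥
  · rw [h0, bot_inf_eq]; exact h.low_bot k
  · refine (h.isGraded.scdim_lt_scdim_iff h0).1 (h.scdim_lt a _ h0 (wayBelow_of_le_sdiff ?_)) k
      (h.pure_low ha)
    rw [sdiff_inf_self_left, hab]
    exact inf_le_left

/-- Writing c as C^k(c) joined with a part of dimension less than k, the difference c - b covers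
C^k(c) up to a lower-dimensional term, which can be dropped because C^k(c) is pure. -/
theorem SubscaledAxioms.comp_sdiff_eq_self (h : SubscaledAxioms d C) {k : ℕ} {c b : M}
    (hc : Low C (k + 1) c) (hcb : c \ b = c) : C k c \ b = C k c := by
  set r := (Finset.range k).sup fun i => C i c with hr
  have hrl : Low C k r := by
    rw [h.low_iff]
    intro j hj
    rw [hr, h.comp_low, if_neg (by omega)]
  have e : c = C k c ⊔ r := by
    conv_lhs => rw [← show _ = c from hc]
    rw [Finset.range_add_one, Finset.sup_insert]
  have h1 : C k c ≤ (r \ b) ⊔ (C k c \ b) := by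
    rw [sup_comm, ← sup_sdiff, ← e, hcb]
    exact h.comp_le k c
  refine le_antisymm sdiff_le ?_
  have h2 := sdiff_le_iff.2 h1
  rwa [h.pure_sdiff_low (h.pure_comp k c) (h.low_of_le sdiff_le hrl)] at h2

/-- Induction on the dimension bound for E. The g i cut E into cells G S, each the join of a
(k)-pure part p S and a remainder r S in the inductive step. The remainders and the pairwise meets
of the p S lie under some E' of dimension less than k; a system for E' together with the nonzero p S
is a system for E. -/
theorem exists_presystem (h : SubscaledAxioms d C) (k : ℕ) :
    ∀ (ι : Type) [Fintype ι] (g : ι → M) (E : M), Low C k E → (∀ i, g i ≤ E) →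
    ∃ (J : Type) (_ : Fintype J) (δ : J → ℕ) (x : J → M),
      (∀ j, Pure C (δ j) (x j)) ∧ (∀ j, x j ≠ ⊥) ∧ Function.Injective x ∧
      (∀ i j, x i < x j → δ i < δ j) ∧
      (∀ i j, x i ⊓ x j ≤ supOn x fun l => x l ≤ x i ∧ x l ≤ x j) ∧
      (supOn x fun _ => True) = E ∧ (∀ i, g i ≤ supOn x fun j => x j ≤ g i) ∧
      Fintype.card J ≤ sizeBound k (Fintype.card ι) := by
  classical
  induction k with
  | zero =>
    intro ι _ g E hE hg
    rw [IsGraded.low_zero_iff] at hE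
    subst hE
    refine ⟨Empty, inferInstance, fun _ => 0, fun _ => ⊥, fun j => j.elim, fun j => j.elim,
      fun j => j.elim, fun j => j.elim, fun j => j.elim, ?_, fun i => ?_, by simp [sizeBound]⟩
    · exact le_bot_iff.1 (supOn_le_iff.2 fun j => j.elim)
    · exact (hg i).trans bot_le
  | succ k ih =>
    intro ι _ g E hE hg
    set G : Finset ι → M := fun S => (S.inf g ⊓ E) \ Sᶜ.sup g with hG
    have hGE : ∀ S, G S ≤ E := fun S => sdiff_le.trans inf_le_right
    have hGg : ∀ S, ∀ i ∈ S, G S ≤ g i := fun S i hi =>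
      sdiff_le.trans (inf_le_left.trans (Finset.inf_le hi))
    have hGl : ∀ S, Low C (k + 1) (G S) := fun S => h.low_of_le (hGE S) hE
    set p : Finset ι → M := fun S => C k (G S) with hp
    set r : Finset ι → M := fun S => (Finset.range k).sup fun i => C i (G S) with hr
    have hpp : ∀ S, Pure C k (p S) := fun S => h.pure_comp k _
    have hpG : ∀ S, p S ≤ G S := fun S => h.comp_le k _
    have hrl : ∀ S, Low C k (r S) := fun S => by
      rw [h.low_iff]
      intro j hj
      rw [hr]; dsimp only
      rw [h.comp_low, if_neg (by omega)]
    have hrG : ∀ S, r S ≤ G S := fun S => Finset.sup_le fun i _ => h.comp_le i _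
    have hGpr : ∀ S, G S = p S ⊔ r S := fun S => by
      conv_lhs => rw [← show _ = G S from hGl S]
      rw [Finset.range_add_one, Finset.sup_insert]
    -- The cell of T is unaffected by subtracting g i, while the cell of S lies under g i; so the
    -- pure part of T meets g i, hence the pure part of S, in smaller dimension.
    have hsep : ∀ S T i, i ∈ S → i ∉ T → Low C k (p S ⊓ p T) := by
      intro S T i hiS hiT
      have hT : G T \ g i = G T := by
        rw [hG]; dsimp only
        rw [sdiff_sdiff, sup_eq_left.2 (Finset.le_sup (f := g) (Finset.mem_compl.2 hiT))]
      have := h.low_inf_of_sdiff_eq (hpp T) (h.comp_sdiff_eq_self (hGl T) hT)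
      rw [inf_comm]
      exact h.low_of_le (inf_le_inf_left _ ((hpG S).trans (hGg S i hiS))) this
    have hpl : ∀ S T, S ≠ T → Low C k (p S ⊓ p T) := by
      intro S T hST
      by_cases hsub : S ⊆ T
      · obtain ⟨i, hiT, hiS⟩ := Finset.exists_of_ssubset (lt_of_le_of_ne hsub hST)
        rw [inf_comm]
        exact hsep T S i hiT hiS
      · obtain ⟨i, hiS, hiT⟩ := Finset.not_subset.1 hsub
        exact hsep S T i hiS hiT
    set E' : M := (Finset.univ.sup r) ⊔
      (Finset.univ.filter fun q : Finset ι × Finset ι => q.1 ≠ q.2).sup fun q => p q.1 ⊓ p q.2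
      with hE'
    have hE'l : Low C k E' := by
      refine h.low_sup (h.low_finset_sup _ _ fun S _ => hrl S) (h.low_finset_sup _ _ fun q hq => ?_)
      exact hpl q.1 q.2 (Finset.mem_filter.1 hq).2
    have hrE' : ∀ S, r S ≤ E' := fun S => (Finset.le_sup (Finset.mem_univ S)).trans le_sup_left
    have hpE' : ∀ S T, S ≠ T → p S ⊓ p T ≤ E' := fun S T hST =>
      (Finset.le_sup (f := fun q : Finset ι × Finset ι => p q.1 ⊓ p q.2)
        (b := (S, T)) (Finset.mem_filter.2 ⟨Finset.mem_univ _, hST⟩)).trans le_sup_right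
    have hE'E : E' ≤ E := sup_le (Finset.sup_le fun S _ => (hrG S).trans (hGE S))
      (Finset.sup_le fun q _ => inf_le_left.trans ((hpG _).trans (hGE _)))
    -- Both the remainders and the traces of the p S on E' must be joins of members of the smaller
    -- system, so that meets involving a p S are too. There are 2 · 2^n of them, which explains the
    -- recursion in `sizeBound`.
    obtain ⟨J, _, δ, x, x1, x2, x3, x4, x5, x6, x7, x8⟩ :=
      ih (Finset ι ⊕ Finset ι) (Sum.elim r fun S => p S ⊓ E') E' hE'l (by
        rintro (S | S)
        · exact hrE' S
        · exact inf_le_right)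
    have hxE' : ∀ j, x j ≤ E' := fun j =>
      (le_supOn (p := fun _ => True) trivial).trans x6.le
    have hδk : ∀ j, δ j < k := fun j => by
      by_contra hj
      have := h.low_iff.1 (h.low_of_le (hxE' j) hE'l) (δ j) (not_lt.1 hj)
      exact x2 j ((x1 j).symm.trans this)
    have hr7 : ∀ S, r S ≤ supOn x fun j => x j ≤ r S := fun S => x7 (Sum.inl S)
    have hp7 : ∀ S, p S ⊓ E' ≤ supOn x fun j => x j ≤ p S := fun S =>
      (x7 (Sum.inr S)).trans (supOn_le_supOn fun j hj => ⟨hj.trans inf_le_left, le_rfl⟩)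
    set y : {S : Finset ι // p S ≠ ⊥} ⊕ J → M := Sum.elim (fun S => p S.1) x with hy
    have hpx : ∀ (S : {S : Finset ι // p S ≠ ⊥}) (j : J), ¬ p S.1 ≤ x j := fun S j hle =>
      S.2 (h.eq_bot_of_pure_of_low (hpp S.1) (h.low_of_le (hle.trans (hxE' j)) hE'l))
    have hpq : ∀ S T : {S : Finset ι // p S ≠ ⊥}, p S.1 ≤ p T.1 → S = T := by
      intro S T hle
      by_contra hne
      have := hpl S.1 T.1 (fun e => hne (Subtype.ext e))
      rw [inf_eq_left.2 hle] at this
      exact S.2 (h.eq_bot_of_pure_of_low (hpp S.1) this)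
    have hlift : ∀ {P : J → Prop} {Q : {S : Finset ι // p S ≠ ⊥} ⊕ J → Prop},
        (∀ j, P j → Q (Sum.inr j)) → supOn x P ≤ supOn y Q := fun hPQ =>
      supOn_le_iff.2 fun j hj => le_supOn (x := y) (j := Sum.inr j) (hPQ j hj)
    refine ⟨_, inferInstance, Sum.elim (fun _ => k) δ, y, ?_, ?_, ?_, ?_, ?_, ?_, ?_, ?_⟩
    · rintro (S | j)
      · exact hpp S.1
      · exact x1 j
    · rintro (S | j)
      · exact S.2
      · exact x2 j
    · rintro (S | i) (T | j) hij
      · exact congrArg Sum.inl (hpq S T hij.le)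
      · exact absurd hij.le (hpx S j)
      · exact absurd hij.ge (hpx T i)
      · exact congrArg Sum.inr (x3 hij)
    · rintro (S | i) (T | j) hij
      · exact absurd (congrArg (fun S : {S : Finset ι // p S ≠ ⊥} => p S.1) (hpq S T hij.le)) hij.ne
      · exact absurd hij.le (hpx S j)
      · exact hδk i
      · exact x4 i j hij
    · have aux : ∀ (S : {S : Finset ι // p S ≠ ⊥}) (j : J),
          p S.1 ⊓ x j ≤ supOn x fun l => x l ≤ p S.1 ∧ x l ≤ x j := by
        intro S j
        have h1 : p S.1 ⊓ x j ≤ (supOn x fun j => x j ≤ p S.1) ⊓ x j :=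
          le_inf ((inf_le_inf_left _ (hxE' j)).trans (hp7 S.1)) inf_le_right
        refine h1.trans (supOn_inf_le fun l hl => (x5 l j).trans ?_)
        exact supOn_le_supOn fun m hm => ⟨⟨hm.1.trans hl, hm.2⟩, le_rfl⟩
      rintro (S | i) (T | j)
      · by_cases hST : S = T
        · subst hST
          exact inf_le_left.trans (le_supOn (x := y) (j := Sum.inl S) ⟨le_rfl, le_rfl⟩)
        · have hST' : S.1 ≠ T.1 := fun e => hST (Subtype.ext e)
          have h1 : p S.1 ⊓ p T.1 ≤ (supOn x fun j => x j ≤ p S.1) ⊓ supOn x fun j => x j ≤ p T.1 :=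
            le_inf ((le_inf inf_le_left (hpE' _ _ hST')).trans (hp7 S.1))
              ((le_inf inf_le_right (hpE' _ _ hST')).trans (hp7 T.1))
          refine h1.trans (supOn_inf_le fun l hl => inf_supOn_le fun m hm => (x5 l m).trans ?_)
          exact hlift fun n hn => ⟨hn.1.trans hl, hn.2.trans hm⟩
      · exact (aux S j).trans (hlift fun n hn => hn)
      · change x i ⊓ p T.1 ≤ _
        rw [inf_comm]
        exact (aux T i).trans (hlift fun n hn => ⟨hn.2, hn.1⟩)
      · exact (x5 i j).trans (hlift fun n hn => hn)
    · apply le_antisymm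
      · refine supOn_le_iff.2 ?_
        rintro (S | j) -
        · exact (hpG _).trans (hGE _)
        · exact (hxE' j).trans hE'E
      · refine le_of_forall_atom_le g fun S => ?_
        change G S ≤ _
        rw [hGpr S]
        refine sup_le ?_ ?_
        · by_cases h0 : p S = ⊥
          · rw [h0]; exact bot_le
          · exact le_supOn (x := y) (j := Sum.inl ⟨S, h0⟩) trivial
        · exact (hr7 S).trans (hlift fun _ _ => trivial)
    · intro i
      refine le_of_forall_atom_le g fun S => ?_
      by_cases hi : i ∈ S
      · have h1 : (S.inf g ⊓ g i) \ Sᶜ.sup g ≤ G S :=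
          sdiff_le_sdiff_right (inf_le_inf_left _ (hg i))
        refine h1.trans ?_
        rw [hGpr S]
        refine sup_le ?_ ?_
        · by_cases h0 : p S = ⊥
          · rw [h0]; exact bot_le
          · exact le_supOn (x := y) (j := Sum.inl ⟨S, h0⟩) ((hpG S).trans (hGg S i hi))
        · refine (hr7 S).trans (hlift fun j hj => ?_)
          exact hj.trans ((hrG S).trans (hGg S i hi))
      · refine le_trans ?_ bot_le
        rw [sdiff_le_iff, sup_bot_eq]
        exact inf_le_right.trans (Finset.le_sup (Finset.mem_compl.2 hi))
    · rw [Fintype.card_sum]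
      simp only [sizeBound]
      refine Nat.add_le_add ?_ (x8.trans_eq ?_)
      · exact (Fintype.card_subtype_le _).trans_eq (by simp)
      · congr 1
        simp [pow_succ]; omega

/-- Finitely many elements lie in the lattice generated by a system of bounded size. -/
theorem exists_system (h : SubscaledAxioms d C) (ι : Type) [Fintype ι] (g : ι → M) :
    ∃ (J : Type) (_ : Fintype J) (_ : PartialOrder J) (δ : J → ℕ) (x : J → M), StrictMono δ ∧
      IsSystem C δ x ⊤ ∧ (∀ i, g i = supOn x fun j => x j ≤ g i) ∧
      Fintype.card J ≤ sizeBound (d + 1) (Fintype.card ι) := by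
  obtain ⟨J, _, δ, x, x1, x2, x3, x4, x5, x6, x7, x8⟩ :=
    exists_presystem h (d + 1) ι g ⊤ (h.low_top ⊤) fun _ => le_top
  refine ⟨J, inferInstance, PartialOrder.lift x x3, δ, x, x4, ?_,
    fun i => le_antisymm (x7 i) (supOn_le_iff.2 fun j hj => hj), x8⟩
  let _ := PartialOrder.lift x x3
  exact ⟨x1, x2, fun _ _ hij => hij, x5, x6⟩

end LocalFiniteness

end Subscaled

namespace Subscaled

/-! ### Embeddings in terms of the lattice operations -/

section Embeddings

variable {M N : Type*} [LSC.Structure M] [LSC.Structure N]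

/-- The `L_SC`-structure of a co-Heyting algebra with unary operations. -/
@[reducible] def structureOf {L : Type*} [CoheytingAlgebra L] (C : ℕ → L → L) : LSC.Structure L where
  funMap
    | SCFunc.zero, _ => ⊥
    | SCFunc.one, _ => ⊤
    | SCFunc.join, v => v 0 ⊔ v 1
    | SCFunc.meet, v => v 0 ⊓ v 1
    | SCFunc.sub, v => v 0 \ v 1
    | SCFunc.comp i, v => C i (v 0)
  RelMap r := Empty.elim r

theorem map_zeroOp {F : Type*} [FunLike F M N] [LSC.HomClass F M N] (f : F) :
    f (zeroOp M) = zeroOp N :=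
  (HomClass.map_fun f (SCFunc.zero : LSC.Functions 0) ![]).trans
    (congrArg (Structure.funMap (L := LSC) (M := N) (SCFunc.zero : LSC.Functions 0)) (Subsingleton.elim _ _))

theorem map_oneOp {F : Type*} [FunLike F M N] [LSC.HomClass F M N] (f : F) :
    f (oneOp M) = oneOp N :=
  (HomClass.map_fun f (SCFunc.one : LSC.Functions 0) ![]).trans
    (congrArg (Structure.funMap (L := LSC) (M := N) (SCFunc.one : LSC.Functions 0)) (Subsingleton.elim _ _))

theorem map_joinOp {F : Type*} [FunLike F M N] [LSC.HomClass F M N] (f : F) (a b : M) :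
    f (joinOp a b) = joinOp (f a) (f b) :=
  (HomClass.map_fun f (SCFunc.join : LSC.Functions 2) ![a, b]).trans
    (congrArg (Structure.funMap (L := LSC) (M := N) (SCFunc.join : LSC.Functions 2)) (funext fun i => by fin_cases i <;> rfl))

theorem map_meetOp {F : Type*} [FunLike F M N] [LSC.HomClass F M N] (f : F) (a b : M) :
    f (meetOp a b) = meetOp (f a) (f b) :=
  (HomClass.map_fun f (SCFunc.meet : LSC.Functions 2) ![a, b]).trans
    (congrArg (Structure.funMap (L := LSC) (M := N) (SCFunc.meet : LSC.Functions 2)) (funext fun i => by fin_cases i <;> rfl))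

theorem map_subOp {F : Type*} [FunLike F M N] [LSC.HomClass F M N] (f : F) (a b : M) :
    f (subOp a b) = subOp (f a) (f b) :=
  (HomClass.map_fun f (SCFunc.sub : LSC.Functions 2) ![a, b]).trans
    (congrArg (Structure.funMap (L := LSC) (M := N) (SCFunc.sub : LSC.Functions 2)) (funext fun i => by fin_cases i <;> rfl))

theorem map_compOp {F : Type*} [FunLike F M N] [LSC.HomClass F M N] (f : F) (i : ℕ) (a : M) :
    f (compOp i a) = compOp i (f a) :=
  (HomClass.map_fun f (SCFunc.comp i : LSC.Functions 1) ![a]).trans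
    (congrArg (Structure.funMap (L := LSC) (M := N) (SCFunc.comp i : LSC.Functions 1)) (funext fun i => by fin_cases i; rfl))

/-- An injective map that respects the operations is an embedding. -/
def embeddingOf (f : M → N) (hf : Function.Injective f) (h0 : f (zeroOp M) = zeroOp N)
    (h1 : f (oneOp M) = oneOp N) (hj : ∀ a b, f (joinOp a b) = joinOp (f a) (f b))
    (hm : ∀ a b, f (meetOp a b) = meetOp (f a) (f b))
    (hs : ∀ a b, f (subOp a b) = subOp (f a) (f b))
    (hc : ∀ i a, f (compOp i a) = compOp i (f a)) : M ↪[LSC] N where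
  toFun := f
  inj' := hf
  map_fun' := by
    intro n φ v
    cases φ with
    | zero =>
      have e1 : v = ![] := Subsingleton.elim _ _
      have e2 : f ∘ v = ![] := Subsingleton.elim _ _
      rw [e2, e1]; exact h0
    | one =>
      have e1 : v = ![] := Subsingleton.elim _ _
      have e2 : f ∘ v = ![] := Subsingleton.elim _ _
      rw [e2, e1]; exact h1
    | join =>
      have e1 : v = ![v 0, v 1] := by ext i; fin_cases i <;> rfl
      have e2 : f ∘ v = ![f (v 0), f (v 1)] := by ext i; fin_cases i <;> rfl
      rw [e2]; conv_lhs => rw [e1]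
      exact hj _ _
    | meet =>
      have e1 : v = ![v 0, v 1] := by ext i; fin_cases i <;> rfl
      have e2 : f ∘ v = ![f (v 0), f (v 1)] := by ext i; fin_cases i <;> rfl
      rw [e2]; conv_lhs => rw [e1]
      exact hm _ _
    | sub =>
      have e1 : v = ![v 0, v 1] := by ext i; fin_cases i <;> rfl
      have e2 : f ∘ v = ![f (v 0), f (v 1)] := by ext i; fin_cases i <;> rfl
      rw [e2]; conv_lhs => rw [e1]
      exact hs _ _
    | comp i =>
      have e1 : v = ![v 0] := by ext i; fin_cases i; rfl
      have e2 : f ∘ v = ![f (v 0)] := by ext i; fin_cases i; rfl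
      rw [e2]; conv_lhs => rw [e1]
      exact hc _ _
  map_rel' := fun r => Empty.elim r

end Embeddings

section Compatible

variable {M N : Type*} [LSC.Structure M] [LSC.Structure N] [CoheytingAlgebra M]
  [CoheytingAlgebra N]

theorem compatible_structureOf {L : Type*} [CoheytingAlgebra L] (C : ℕ → L → L) :
    letI := structureOf C
    Compatible L := by
  refine ⟨rfl, rfl, fun a b => ⟨rfl, rfl, rfl⟩⟩

theorem map_bot' (hM : Compatible M) (hN : Compatible N) (f : M ↪[LSC] N) : f ⊥ = ⊥ := by
  rw [← hM.1, ← hN.1, map_zeroOp]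

theorem map_top' (hM : Compatible M) (hN : Compatible N) (f : M ↪[LSC] N) : f ⊤ = ⊤ := by
  rw [← hM.2.1, ← hN.2.1, map_oneOp]

theorem map_sup' (hM : Compatible M) (hN : Compatible N) (f : M ↪[LSC] N) (a b : M) :
    f (a ⊔ b) = f a ⊔ f b := by
  rw [← (hM.2.2 _ _).1, ← (hN.2.2 _ _).1, map_joinOp]

theorem map_inf' (hM : Compatible M) (hN : Compatible N) (f : M ↪[LSC] N) (a b : M) :
    f (a ⊓ b) = f a ⊓ f b := by
  rw [← (hM.2.2 _ _).2.1, ← (hN.2.2 _ _).2.1, map_meetOp]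

theorem map_sdiff' (hM : Compatible M) (hN : Compatible N) (f : M ↪[LSC] N) (a b : M) :
    f (a \ b) = f a \ f b := by
  rw [← (hM.2.2 _ _).2.2, ← (hN.2.2 _ _).2.2, map_subOp]

theorem map_le_map (hM : Compatible M) (hN : Compatible N) (f : M ↪[LSC] N) {a b : M} :
    f a ≤ f b ↔ a ≤ b := by
  rw [← sup_eq_right, ← map_sup' hM hN, f.injective.eq_iff, sup_eq_right]

theorem map_finset_sup' (hM : Compatible M) (hN : Compatible N) (f : M ↪[LSC] N) {ι : Type*}
    (s : Finset ι) (g : ι → M) : f (s.sup g) = s.sup fun i => f (g i) := by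
  classical
  induction s using Finset.induction_on with
  | empty => simp [map_bot' hM hN]
  | insert i s _ ih => rw [Finset.sup_insert, Finset.sup_insert, map_sup' hM hN, ih]

theorem map_supOn (hM : Compatible M) (hN : Compatible N) (f : M ↪[LSC] N) {J : Type} [Fintype J]
    (x : J → M) (p : J → Prop) : f (supOn x p) = supOn (fun j => f (x j)) p :=
  map_finset_sup' hM hN f _ _

/-- The embedding given by a map of co-Heyting algebras that respects the components. -/
def embeddingOfLattice (hM : Compatible M) (hN : Compatible N) (f : M → N)
    (hf : Function.Injective f) (h0 : f ⊥ = ⊥)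
    (h1 : f ⊤ = ⊤) (hj : ∀ a b, f (a ⊔ b) = f a ⊔ f b)
    (hm : ∀ a b, f (a ⊓ b) = f a ⊓ f b)
    (hs : ∀ a b, f (a \ b) = f a \ f b)
    (hc : ∀ i a, f (compOp i a) = compOp i (f a)) : M ↪[LSC] N :=
  embeddingOf f hf (by rw [hM.1, hN.1, h0]) (by rw [hM.2.1, hN.2.1, h1])
    (fun a b => by rw [(hM.2.2 _ _).1, (hN.2.2 _ _).1, hj])
    (fun a b => by rw [(hM.2.2 _ _).2.1, (hN.2.2 _ _).2.1, hm])
    (fun a b => by rw [(hM.2.2 _ _).2.2, (hN.2.2 _ _).2.2, hs]) hc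

end Compatible

/-! ### Algebras of lower sets of ranked posets -/

section Down

variable {J : Type} [PartialOrder J]

/-- The lower sets of a ranked poset. -/
def Down (_ : J → ℕ) : Type := LowerSet J

variable {δ : J → ℕ} {d : ℕ}

instance : CoheytingAlgebra (Down δ) := inferInstanceAs (CoheytingAlgebra (LowerSet J))

instance : SetLike (Down δ) J := inferInstanceAs (SetLike (LowerSet J) J)

instance [Finite J] : Finite (Down δ) :=
  Finite.of_injective (fun A : Down δ => (A : Set J)) SetLike.coe_injective

namespace Down

theorem ext {A B : Down δ} (h : ∀ k, k ∈ A ↔ k ∈ B) : A = B := SetLike.ext h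

theorem mem_of_le {A : Down δ} {k l : J} (h : k ≤ l) (hl : l ∈ A) : k ∈ A := LowerSet.lower A h hl

theorem mem_sup {A B : Down δ} {k : J} : k ∈ A ⊔ B ↔ k ∈ A ∨ k ∈ B := Iff.rfl

theorem mem_inf {A B : Down δ} {k : J} : k ∈ A ⊓ B ↔ k ∈ A ∧ k ∈ B := Iff.rfl

theorem notMem_bot {k : J} : k ∉ (⊥ : Down δ) := fun h => h

theorem mem_top {k : J} : k ∈ (⊤ : Down δ) := trivial

theorem ne_bot_iff {A : Down δ} : A ≠ ⊥ ↔ ∃ k, k ∈ A := by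
  constructor
  · intro h
    by_contra hc
    push Not at hc
    exact h (ext fun k => ⟨fun hk => absurd hk (hc k), fun hk => absurd hk notMem_bot⟩)
  · rintro ⟨k, hk⟩ rfl
    exact notMem_bot hk

/-- The lower set of the elements below some element satisfying `p`. -/
def mk (δ : J → ℕ) (p : J → Prop) : Down δ :=
  (⟨{k | ∃ l, k ≤ l ∧ p l}, fun _ _ hab ⟨l, h1, h2⟩ => ⟨l, hab.trans h1, h2⟩⟩ : LowerSet J)

theorem mem_mk {p : J → Prop} {k : J} : k ∈ mk δ p ↔ ∃ l, k ≤ l ∧ p l := Iff.rfl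

theorem mem_sdiff {A B : Down δ} {k : J} : k ∈ A \ B ↔ ∃ l, k ≤ l ∧ l ∈ A ∧ l ∉ B := by
  have : A \ B = mk δ fun l => l ∈ A ∧ l ∉ B := by
    apply le_antisymm
    · rw [sdiff_le_iff]
      intro l hl
      by_cases hB : l ∈ B
      · exact mem_sup.2 (Or.inl hB)
      · exact mem_sup.2 (Or.inr (mem_mk.2 ⟨l, le_rfl, hl, hB⟩))
    · rintro k ⟨l, hkl, hlA, hlB⟩
      rcases mem_sup.1 ((le_sup_sdiff : A ≤ B ⊔ A \ B) hlA) with h | h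
      · exact absurd h hlB
      · exact mem_of_le hkl h
  rw [this, mem_mk]

theorem mem_finset_sup {ι : Type*} {s : Finset ι} {f : ι → Down δ} {k : J} :
    k ∈ s.sup f ↔ ∃ i ∈ s, k ∈ f i := by
  classical
  induction s using Finset.induction_on with
  | empty => simpa using notMem_bot
  | insert i s _ ih => rw [Finset.sup_insert, mem_sup, ih]; simp

/-- The part of `A` below its maximal elements of rank `i`. -/
def comp (i : ℕ) (A : Down δ) : Down δ :=
  mk δ fun l => l ∈ A ∧ δ l = i ∧ ∀ m ∈ A, l ≤ m → m = l

theorem mem_comp {i : ℕ} {A : Down δ} {k : J} :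
    k ∈ comp i A ↔ ∃ l, k ≤ l ∧ l ∈ A ∧ δ l = i ∧ ∀ m ∈ A, l ≤ m → m = l := Iff.rfl

instance : LSC.Structure (Down δ) := structureOf comp

theorem compatible : Compatible (Down δ) := compatible_structureOf comp

theorem compOp_eq : (compOp : ℕ → Down δ → Down δ) = comp := rfl

theorem comp_le {i : ℕ} {A : Down δ} : comp i A ≤ A := fun _ ⟨_, h1, h2, _⟩ => mem_of_le h1 h2


theorem exists_max [Finite J] {A : Down δ} {k : J} (hk : k ∈ A) :
    ∃ l, k ≤ l ∧ l ∈ A ∧ ∀ m ∈ A, l ≤ m → m = l := by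
  obtain ⟨l, ⟨h1, h2⟩, h3⟩ := wellFounded_gt.has_min {l | k ≤ l ∧ l ∈ A} ⟨k, le_rfl, hk⟩
  refine ⟨l, h1, h2, fun m hm hlm => ?_⟩
  by_contra hne
  exact h3 m ⟨h1.trans hlm, hm⟩ (lt_of_le_of_ne hlm (Ne.symm hne))

theorem low_iff [Finite J] (hδ : StrictMono δ) {n : ℕ} {A : Down δ} :
    Low comp n A ↔ ∀ k ∈ A, δ k < n := by
  constructor
  · intro h k hk
    rw [← show _ = A from h, mem_finset_sup] at hk
    obtain ⟨i, hi, l, hkl, -, rfl, -⟩ := hk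
    exact (hδ.monotone hkl).trans_lt (Finset.mem_range.1 hi)
  · intro h
    refine le_antisymm (Finset.sup_le fun i _ => comp_le) fun k hk => ?_
    obtain ⟨l, h1, h2, h3⟩ := exists_max hk
    exact mem_finset_sup.2 ⟨δ l, Finset.mem_range.2 (h l h2), l, h1, h2, rfl, h3⟩

theorem mem_comp_of_low [Finite J] (hδ : StrictMono δ) {n : ℕ} {A : Down δ} (hA : Low comp (n + 1) A) {k : J} :
    k ∈ comp n A ↔ ∃ l, k ≤ l ∧ l ∈ A ∧ δ l = n := by
  rw [low_iff hδ] at hA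
  refine ⟨fun ⟨l, h1, h2, h3, _⟩ => ⟨l, h1, h2, h3⟩, fun ⟨l, h1, h2, h3⟩ =>
    ⟨l, h1, h2, h3, fun m hm hlm => ?_⟩⟩
  by_contra hne
  have h4 := hδ (lt_of_le_of_ne hlm (Ne.symm hne))
  have h5 := hA m hm
  omega

theorem pure_iff (hδ : StrictMono δ) {n : ℕ} {A : Down δ} :
    Pure comp n A ↔ ∀ k ∈ A, ∃ l, k ≤ l ∧ l ∈ A ∧ δ l = n := by
  constructor
  · intro h k hk
    rw [← show _ = A from h] at hk
    obtain ⟨l, h1, h2, h3, -⟩ := hk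
    exact ⟨l, h1, h2, h3⟩
  · intro h
    refine le_antisymm comp_le fun k hk => ?_
    obtain ⟨l, h1, h2, h3⟩ := h k hk
    refine ⟨l, h1, h2, h3, fun m hm hlm => ?_⟩
    by_contra hne
    obtain ⟨m', h4, -, h6⟩ := h m hm
    have := hδ ((lt_of_le_of_ne hlm (Ne.symm hne)).trans_le h4)
    omega

theorem subscaledAxioms [Finite J] (hδ : StrictMono δ) (hd : ∀ j, δ j ≤ d) :
    SubscaledAxioms d (comp : ℕ → Down δ → Down δ) := by
  rw [subscaledAxioms_iff]
  constructor
  · intro A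
    exact (low_iff hδ).2 fun k _ => Nat.lt_succ_of_le (hd k)
  · intro i hi A
    refine le_bot_iff.1 ?_
    rintro k ⟨l, -, -, h3, -⟩
    have := hd l
    omega
  · intro I _ k _ A
    have hle : (I.sup fun i => comp i A) ≤ A := Finset.sup_le fun i _ => comp_le
    -- The maximal elements of a join of components of A are maximal elements of A with rank in I.
    have aux : ∀ l ∈ (I.sup fun i => comp i A),
        (∀ m ∈ (I.sup fun i => comp i A), l ≤ m → m = l) →
          l ∈ A ∧ δ l ∈ I ∧ ∀ m ∈ A, l ≤ m → m = l := by
      intro l hl hmax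
      obtain ⟨i, hi, l', h1, h2, h3, h4⟩ := mem_finset_sup.1 hl
      have : l' = l := hmax l' (mem_finset_sup.2 ⟨i, hi, l', le_rfl, h2, h3, h4⟩) h1
      subst this
      exact ⟨h2, h3.symm ▸ hi, h4⟩
    split_ifs with hk
    · apply le_antisymm
      · rintro x ⟨l, h1, h2, h3, h4⟩
        obtain ⟨h5, -, h7⟩ := aux l h2 h4
        exact ⟨l, h1, h5, h3, h7⟩
      · rintro x ⟨l, h1, h2, h3, h4⟩
        exact ⟨l, h1, mem_finset_sup.2 ⟨k, hk, l, le_rfl, h2, h3, h4⟩, h3,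
          fun m hm hlm => h4 m (hle hm) hlm⟩
    · refine le_bot_iff.1 ?_
      rintro x ⟨l, h1, h2, h3, h4⟩
      obtain ⟨-, h6, -⟩ := aux l h2 h4
      exact hk (h3 ▸ h6)
  · intro k _ A B hA hB
    have hAB : Low comp (k + 1) (A ⊔ B) := by
      rw [low_iff hδ] at *
      rintro x (hx | hx)
      · exact hA x hx
      · exact hB x hx
    refine ext fun x => ?_
    rw [mem_sup, mem_comp_of_low hδ hAB, mem_comp_of_low hδ hA, mem_comp_of_low hδ hB]
    constructor
    · rintro ⟨l, h1, h2 | h2, h3⟩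
      · exact Or.inl ⟨l, h1, h2, h3⟩
      · exact Or.inr ⟨l, h1, h2, h3⟩
    · rintro (⟨l, h1, h2, h3⟩ | ⟨l, h1, h2, h3⟩)
      · exact ⟨l, h1, Or.inl h2, h3⟩
      · exact ⟨l, h1, Or.inr h2, h3⟩
  · intro i j hij _ A
    rw [low_iff hδ]
    rintro x ⟨⟨l, h1, h2, h3, h4⟩, ⟨l', h1', h2', h3', -⟩⟩
    by_contra hx
    have hxl : x = l := by
      by_contra hne
      have := hδ (lt_of_le_of_ne h1 hne)
      omega
    subst hxl
    have := h4 l' h2' h1'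
    subst this
    omega
  · intro k _ A B hB
    apply le_antisymm
    · exact sdiff_le_sdiff_left comp_le
    · intro x hx
      obtain ⟨y, hxy, ⟨l, h1, h2, h3, h4⟩, hyB⟩ := mem_sdiff.1 hx
      refine mem_sdiff.2 ⟨l, hxy.trans h1, ⟨l, le_rfl, h2, h3, h4⟩, fun hlB => hyB ?_⟩
      exact (mem_comp_of_low hδ hB).2 ⟨l, h1, hlB, h3⟩
  · intro k _ A B _ hBA hA
    rw [low_iff hδ] at *
    -- A point of B lies under a point of A outside B, hence strictly under it, and the rank
    -- increases.
    intro x hx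
    obtain ⟨y, hxy, hyA, hyB⟩ := mem_sdiff.1 (hBA hx)
    have hne : x ≠ y := fun e => hyB (e ▸ hx)
    have h1 := hδ (lt_of_le_of_ne hxy hne)
    have h2 := hA y hyA
    omega

theorem isSubscaled [Finite J] (hδ : StrictMono δ) (hd : ∀ j, δ j ≤ d) : IsSubscaled d (Down δ) :=
  ⟨inferInstance, compatible, subscaledAxioms hδ hd⟩

/-- The lower set of elements below `j`. -/
def principal (δ : J → ℕ) (j : J) : Down δ := LowerSet.Iic j

theorem mem_principal {i j : J} : i ∈ principal δ j ↔ i ≤ j := Iff.rfl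

end Down

end Down

theorem supOn_sdiff {M : Type u} [CoheytingAlgebra M] {J : Type} [Fintype J] {x : J → M} {p : J → Prop} {b : M} :
    supOn x p \ b = supOn (fun j => x j \ b) p :=
  SubscaledAxioms.finset_sup_sdiff _ _ _

/-! ### Systems with join 1 as embeddings of lower-set algebras -/

section SystemEmbedding

variable {M : Type u} [LSC.Structure M] [CoheytingAlgebra M] {J : Type} [Fintype J]
  [PartialOrder J] {d : ℕ} {δ : J → ℕ} {x : J → M}

/-- The element x i meets every x j with j in A inside the join of the x l with l < i, whose
dimension is less than δ i. This independence makes the map on lower sets injective and compatible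
with differences. -/
theorem IsSystem.sdiff_supOn (h : SubscaledAxioms d (compOp (M := M))) (hδ : StrictMono δ)
    (hx : IsSystem compOp δ x ⊤) (A : Down δ) {i : J} (hi : i ∉ A) :
    x i \ supOn x (· ∈ A) = x i := by
  refine h.pure_sdiff_eq_self (hx.pure i) ?_
  refine h.low_of_le (b := x i ⊓ supOn x (· ∈ A)) (a := supOn x fun l => l < i) ?_
    (h.low_supOn fun l hl => h.low_mono (hδ hl) (h.pure_low (hx.pure l)))
  refine inf_supOn_le fun j hj => (hx.inf_le i j).trans (supOn_le_supOn fun l hl => ⟨?_, le_rfl⟩)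
  exact lt_of_le_of_ne hl.1 fun e => hi (e ▸ Down.mem_of_le hl.2 hj)

theorem IsSystem.supOn_le_supOn_iff (h : SubscaledAxioms d (compOp (M := M))) (hδ : StrictMono δ)
    (hx : IsSystem compOp δ x ⊤) {A B : Down δ} :
    supOn x (· ∈ A) ≤ supOn x (· ∈ B) ↔ A ≤ B := by
  refine ⟨fun hle i hi => ?_, fun hle => supOn_le_supOn fun i hi => ⟨hle hi, le_rfl⟩⟩
  by_contra hiB
  have h1 := hx.sdiff_supOn h hδ B hiB
  rw [sdiff_eq_bot_iff.2 ((le_supOn hi).trans hle)] at h1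
  exact hx.ne_bot i h1.symm

/-- A system with join `⊤` embeds the algebra of lower sets of its index poset. -/
noncomputable def IsSystem.embedding (hM : Compatible M)
    (h : SubscaledAxioms d (compOp (M := M))) (hδ : StrictMono δ)
    (hx : IsSystem compOp δ x ⊤) : Down δ ↪[LSC] M :=
  embeddingOfLattice Down.compatible hM (fun A => supOn x (· ∈ A))
    (fun A B e => le_antisymm ((hx.supOn_le_supOn_iff h hδ).1 e.le)
      ((hx.supOn_le_supOn_iff h hδ).1 e.ge))
    (le_bot_iff.1 (supOn_le_iff.2 fun j hj => absurd hj Down.notMem_bot))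
    (by rw [← hx.sup_eq]; rfl)
    (fun A B => le_antisymm
      (supOn_le_iff.2 fun j hj => hj.elim (fun hj => (le_supOn hj).trans le_sup_left)
        fun hj => (le_supOn hj).trans le_sup_right)
      (sup_le (supOn_le_supOn fun j hj => ⟨Or.inl hj, le_rfl⟩)
        (supOn_le_supOn fun j hj => ⟨Or.inr hj, le_rfl⟩)))
    (fun A B => le_antisymm
      (le_inf (supOn_le_supOn fun j hj => ⟨hj.1, le_rfl⟩)
        (supOn_le_supOn fun j hj => ⟨hj.2, le_rfl⟩))
      (supOn_inf_le fun i hi => inf_supOn_le fun j hj => (hx.inf_le i j).trans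
        (supOn_le_supOn fun l hl => ⟨⟨Down.mem_of_le hl.1 hi, Down.mem_of_le hl.2 hj⟩, le_rfl⟩)))
    (fun A B => by
      rw [supOn_sdiff]
      apply le_antisymm
      · refine supOn_le_iff.2 fun j hj => ?_
        obtain ⟨l, h1, h2, h3⟩ := Down.mem_sdiff.1 hj
        refine (hx.mono j l h1).trans ?_
        rw [← hx.sdiff_supOn h hδ B h3]
        exact le_supOn (x := fun j => x j \ supOn x (· ∈ B)) h2
      · refine supOn_le_iff.2 fun j hj => ?_
        by_cases hjB : j ∈ B
        · rw [sdiff_eq_bot_iff.2 (le_supOn hjB)]; exact bot_le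
        · exact sdiff_le.trans (le_supOn (Down.mem_sdiff.2 ⟨j, le_rfl, hj, hjB⟩)))
    (fun i A => by
      -- The join over the maximal elements of A of rank i is i-pure, and two such joins of
      -- different ranks meet in dimension below both. By the uniqueness in `comp_sup_pure` they are
      -- the components of the image of A.
      set m : ℕ → M := fun i => supOn x fun j => j ∈ A ∧ δ j = i ∧ ∀ l ∈ A, j ≤ l → l = j with hm
      have hmp : ∀ i, compOp i (m i) = m i := fun i =>
        h.pure_supOn fun j hj => hj.2.1 ▸ hx.pure j
      have hmi : ∀ i j, i < j → Low compOp i (m i ⊓ m j) := by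
        intro i j hij
        refine h.low_of_le (a := supOn x fun l => δ l < i) ?_
          (h.low_supOn fun l hl => h.low_mono hl (h.pure_low (hx.pure l)))
        refine supOn_inf_le fun a ha => inf_supOn_le fun b hb => (hx.inf_le a b).trans ?_
        refine supOn_le_supOn fun l hl => ⟨?_, le_rfl⟩
        have hla : l ≠ a := fun e => by
          have := ha.2.2 b hb.1 (e ▸ hl.2)
          have h1 := ha.2.1
          have h2 := hb.2.1
          rw [this] at h2
          omega
        exact ha.2.1 ▸ hδ (lt_of_le_of_ne hl.1 hla)
      have hsum : (Finset.range (d + 1)).sup m = supOn x (· ∈ A) := by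
        apply le_antisymm
        · exact Finset.sup_le fun i _ => supOn_le_supOn fun j hj => ⟨hj.1, le_rfl⟩
        · refine supOn_le_iff.2 fun j hj => ?_
          obtain ⟨l, h1, h2, h3⟩ := Down.exists_max hj
          have h4 : x l ≤ m (δ l) := le_supOn
            (p := fun j => j ∈ A ∧ δ j = δ l ∧ ∀ l ∈ A, j ≤ l → l = j) ⟨h2, rfl, h3⟩
          have h5 : δ l ≤ d := h.pure_dim_le (hx.pure l) (hx.ne_bot l)
          exact (hx.mono j l h1).trans (h4.trans
            (Finset.le_sup (f := m) (Finset.mem_range.2 (Nat.lt_succ_of_le h5))))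
      have key := h.comp_sup_pure m hmp hmi (d + 1) i
      rw [hsum] at key
      rw [key]
      have e : supOn x (· ∈ (compOp i A : Down δ)) = m i := by
        apply le_antisymm
        · refine supOn_le_iff.2 fun j hj => ?_
          obtain ⟨l, h1, h2⟩ := hj
          exact (hx.mono j l h1).trans (le_supOn h2)
        · exact supOn_le_supOn fun j hj => ⟨⟨j, le_rfl, hj⟩, le_rfl⟩
      rw [e]
      split_ifs with hi
      · rfl
      · rw [← hmp i]
        exact h.comp_eq_bot i (by omega) _)

theorem IsSystem.embedding_apply (hM : Compatible M)
    (h : SubscaledAxioms d (compOp (M := M))) (hδ : StrictMono δ)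
    (hx : IsSystem compOp δ x ⊤) (A : Down δ) :
    hx.embedding hM h hδ A = supOn x (· ∈ A) := rfl

theorem Down.eq_supOn (A : Down δ) : A = supOn (Down.principal δ) (· ∈ A) := by
  apply le_antisymm
  · intro j hj
    exact (le_supOn (x := Down.principal δ) (p := (· ∈ A)) hj) (Down.mem_principal.2 le_rfl)
  · exact supOn_le_iff.2 fun j hj i hi => Down.mem_of_le hi hj

/-- An embedding of the algebra of lower sets of a ranked poset is given by a system. -/
theorem isSystem_of_embedding (hM : Compatible M) (hδ : StrictMono δ) (e : Down δ ↪[LSC] M) :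
    IsSystem compOp δ (fun j => e (Down.principal δ j)) ⊤ := by
  have hc := Down.compatible (δ := δ)
  refine ⟨fun j => ?_, fun j h0 => ?_, fun i j hij => ?_, fun i j => ?_, ?_⟩
  · change compOp _ _ = _
    rw [← map_compOp]
    congr 1
    exact (Down.pure_iff hδ).2 fun k hk => ⟨j, hk, Down.mem_principal.2 le_rfl, rfl⟩
  · rw [← map_bot' hc hM e] at h0
    have : j ∈ (⊥ : Down δ) := e.injective h0 ▸ Down.mem_principal.2 le_rfl
    exact Down.notMem_bot this
  · exact (map_le_map hc hM e).2 fun k hk => le_trans hk hij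
  · rw [← map_inf' hc hM, ← map_supOn hc hM, map_le_map hc hM]
    intro k hk
    exact (le_supOn (x := Down.principal δ) (p := fun l => l ≤ i ∧ l ≤ j) hk)
      (Down.mem_principal.2 le_rfl)
  · rw [← map_supOn hc hM, ← map_top' hc hM e]
    congr 1
    exact (Down.eq_supOn ⊤).symm

end SystemEmbedding

end Subscaled

namespace Subscaled

/-! ### Terms for the operations -/

section Terms

variable {α : Type}

/-- The term `0`. -/
def tZero : LSC.Term α := Term.func (SCFunc.zero : LSC.Functions 0) ![]

/-- The term `1`. -/
def tOne : LSC.Term α := Term.func (SCFunc.one : LSC.Functions 0) ![]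

/-- The join of two terms. -/
def tJoin (s t : LSC.Term α) : LSC.Term α := Term.func (SCFunc.join : LSC.Functions 2) ![s, t]

/-- The meet of two terms. -/
def tMeet (s t : LSC.Term α) : LSC.Term α := Term.func (SCFunc.meet : LSC.Functions 2) ![s, t]

/-- The difference of two terms. -/
def tSub (s t : LSC.Term α) : LSC.Term α := Term.func (SCFunc.sub : LSC.Functions 2) ![s, t]

/-- The `i`-th component of a term. -/
def tComp (i : ℕ) (t : LSC.Term α) : LSC.Term α :=
  Term.func (SCFunc.comp i : LSC.Functions 1) ![t]

/-- The join of the components of a term whose indices belong to a list. -/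
def tSup (l : List ℕ) (t : LSC.Term α) : LSC.Term α :=
  l.foldr (fun i s => tJoin (tComp i t) s) tZero

/-- The join of the components of a term of index less than `k`. -/
noncomputable def tLow (k : ℕ) (t : LSC.Term α) : LSC.Term α := tSup (Finset.range k).toList t

variable {M : Type u} [LSC.Structure M] {v : α → M}

theorem realize_tZero : (tZero : LSC.Term α).realize v = zeroOp M :=
  congrArg (Structure.funMap (L := LSC) (M := M) (SCFunc.zero : LSC.Functions 0))
    (Subsingleton.elim _ _)

theorem realize_tOne : (tOne : LSC.Term α).realize v = oneOp M :=
  congrArg (Structure.funMap (L := LSC) (M := M) (SCFunc.one : LSC.Functions 0))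
    (Subsingleton.elim _ _)

theorem realize_tJoin (s t : LSC.Term α) :
    (tJoin s t).realize v = joinOp (s.realize v) (t.realize v) :=
  congrArg (Structure.funMap (L := LSC) (M := M) (SCFunc.join : LSC.Functions 2))
    (funext fun i => by fin_cases i <;> rfl)

theorem realize_tMeet (s t : LSC.Term α) :
    (tMeet s t).realize v = meetOp (s.realize v) (t.realize v) :=
  congrArg (Structure.funMap (L := LSC) (M := M) (SCFunc.meet : LSC.Functions 2))
    (funext fun i => by fin_cases i <;> rfl)

theorem realize_tSub (s t : LSC.Term α) :
    (tSub s t).realize v = subOp (s.realize v) (t.realize v) :=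
  congrArg (Structure.funMap (L := LSC) (M := M) (SCFunc.sub : LSC.Functions 2))
    (funext fun i => by fin_cases i <;> rfl)

theorem realize_tComp (i : ℕ) (t : LSC.Term α) :
    (tComp i t).realize v = compOp i (t.realize v) :=
  congrArg (Structure.funMap (L := LSC) (M := M) (SCFunc.comp i : LSC.Functions 1))
    (funext fun i => by fin_cases i; rfl)

theorem realize_ite {p : Prop} [Decidable p] (s t : LSC.Term α) :
    (if p then s else t).realize v = if p then s.realize v else t.realize v := by
  split_ifs <;> rfl

section Lattice

variable [CoheytingAlgebra M]

theorem Compatible.realize_tZero (hM : Compatible M) : (tZero : LSC.Term α).realize v = (⊥ : M) :=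
  Subscaled.realize_tZero.trans hM.1

theorem Compatible.realize_tJoin (hM : Compatible M) (s t : LSC.Term α) :
    (tJoin s t).realize v = s.realize v ⊔ t.realize v :=
  (Subscaled.realize_tJoin s t).trans (hM.2.2 _ _).1

theorem Compatible.realize_tMeet (hM : Compatible M) (s t : LSC.Term α) :
    (tMeet s t).realize v = s.realize v ⊓ t.realize v :=
  (Subscaled.realize_tMeet s t).trans (hM.2.2 _ _).2.1

theorem Compatible.realize_tSub (hM : Compatible M) (s t : LSC.Term α) :
    (tSub s t).realize v = s.realize v \ t.realize v :=
  (Subscaled.realize_tSub s t).trans (hM.2.2 _ _).2.2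

theorem Compatible.realize_tSup (hM : Compatible M) (l : List ℕ) (t : LSC.Term α) :
    (tSup l t).realize v = l.toFinset.sup fun i => compOp i (t.realize v) := by
  induction l with
  | nil => exact hM.realize_tZero
  | cons i l ih =>
    rw [List.toFinset_cons, Finset.sup_insert, ← ih]
    exact (hM.realize_tJoin _ _).trans (congrArg (· ⊔ _) (realize_tComp i t))

theorem Compatible.realize_tLow (hM : Compatible M) (k : ℕ) (t : LSC.Term α) :
    (tLow k t).realize v = (Finset.range k).sup fun i => compOp i (t.realize v) := by
  rw [tLow, hM.realize_tSup, Finset.toList_toFinset]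

end Lattice

end Terms

/-! ### First-order axioms for subscaled and super scaled lattices -/

section Axioms

/-- The universal closure of a formula in three variables. -/
def univ3 (φ : LSC.BoundedFormula Empty 3) : LSC.Sentence := φ.alls

theorem realize_univ3 {M : Type u} [LSC.Structure M] {φ : LSC.BoundedFormula Empty 3} :
    M ⊨ univ3 φ ↔ ∀ a b c : M, φ.Realize default ![a, b, c] := by
  refine (BoundedFormula.realize_alls (φ := φ) (v := default)).trans ?_
  constructor
  · intro h a b c; exact h _
  · intro h xs
    have := h (xs 0) (xs 1) (xs 2)
    convert this using 1
    ext i; fin_cases i <;> rfl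

theorem isUniversal_alls {n : ℕ} {φ : LSC.BoundedFormula Empty n} (h : φ.IsUniversal) :
    φ.alls.IsUniversal := by
  induction n with
  | zero => exact h
  | succ n ih => exact ih h.all

theorem isQF_bdEqual {n : ℕ} (s t : LSC.Term (Empty ⊕ Fin n)) :
    (Term.bdEqual s t).IsQF :=
  (BoundedFormula.IsAtomic.equal s t).isQF

/-- The operations form a co-Heyting algebra. -/
def opFormulas : Set (LSC.BoundedFormula Empty 3) :=
  {Term.bdEqual (tJoin (&0) (&1)) (tJoin (&1) (&0)),
    Term.bdEqual (tJoin (tJoin (&0) (&1)) (&2)) (tJoin (&0) (tJoin (&1) (&2))),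
    Term.bdEqual (tMeet (&0) (&1)) (tMeet (&1) (&0)),
    Term.bdEqual (tMeet (tMeet (&0) (&1)) (&2)) (tMeet (&0) (tMeet (&1) (&2))),
    Term.bdEqual (tJoin (&0) (tMeet (&0) (&1))) (&0),
    Term.bdEqual (tMeet (&0) (tJoin (&0) (&1))) (&0),
    Term.bdEqual (tJoin tZero (&0)) (&0),
    Term.bdEqual (tJoin (&0) tOne) tOne,
    Term.bdEqual (tJoin (&0) (tJoin (&1) (tSub (&0) (&1)))) (tJoin (&1) (tSub (&0) (&1))),
    (Term.bdEqual (tJoin (&0) (tJoin (&1) (&2))) (tJoin (&1) (&2))).imp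
      (Term.bdEqual (tJoin (tSub (&0) (&1)) (&2)) (&2))}

/-- The order is recovered from the join, and the difference is characterized by one identity and
one implication between identities, so quantifying over compatible co-Heyting structures is a
first-order, indeed universal, condition. -/
theorem exists_compatible_iff {M : Type u} [LSC.Structure M] :
    (∀ φ ∈ opFormulas, M ⊨ univ3 φ) ↔ ∃ _ : CoheytingAlgebra M, Compatible M := by
  have e : (∀ φ ∈ opFormulas, M ⊨ univ3 φ) ↔
      (∀ a b : M, joinOp a b = joinOp b a) ∧
      (∀ a b c : M, joinOp (joinOp a b) c = joinOp a (joinOp b c)) ∧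
      (∀ a b : M, meetOp a b = meetOp b a) ∧
      (∀ a b c : M, meetOp (meetOp a b) c = meetOp a (meetOp b c)) ∧
      (∀ a b : M, joinOp a (meetOp a b) = a) ∧
      (∀ a b : M, meetOp a (joinOp a b) = a) ∧
      (∀ a : M, joinOp (zeroOp M) a = a) ∧
      (∀ a : M, joinOp a (oneOp M) = oneOp M) ∧
      (∀ a b : M, joinOp a (joinOp b (subOp a b)) = joinOp b (subOp a b)) ∧
      (∀ a b c : M, joinOp a (joinOp b c) = joinOp b c → joinOp (subOp a b) c = c) := by
    -- All axioms are closed over three variables; nonemptiness removes the quantifiers over those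
    -- that do not occur.
    have : Nonempty M := ⟨zeroOp M⟩
    simp only [opFormulas, Set.mem_insert_iff, Set.mem_singleton_iff, forall_eq_or_imp, forall_eq,
      realize_univ3, BoundedFormula.realize_bdEqual, BoundedFormula.realize_imp, realize_tJoin,
      realize_tMeet, realize_tSub, realize_tZero, realize_tOne]
    simp [forall_const]
  rw [e]
  constructor
  · rintro ⟨h1, h2, h3, h4, h5, h6, h7, h8, h9, h10⟩
    let i1 : Max M := ⟨joinOp⟩
    let i2 : Min M := ⟨meetOp⟩
    let i3 : Lattice M := Lattice.mk' h1 h2 h3 h4 h5 h6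
    have hle : ∀ a b : M, a ≤ b ↔ joinOp a b = b := fun a b => Iff.rfl
    let i4 : OrderBot M := { bot := zeroOp M, bot_le := fun a => h7 a }
    let i5 : OrderTop M := { top := oneOp M, le_top := fun a => h8 a }
    let i6 : SDiff M := ⟨subOp⟩
    let i7 : GeneralizedCoheytingAlgebra M :=
      { i3, i4, i6 with
        sdiff_le_iff := fun a b c => by
          constructor
          · intro h
            have h' : joinOp (subOp a b) c = c := h
            refine le_trans (b := joinOp b (subOp a b)) (h9 a b) ?_
            exact sup_le_sup_left (a := subOp a b) (b := c) h b
          · intro h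
            exact h10 a b c h }
    let i8 : CoheytingAlgebra M := { i7, i5 with hnot := fun a => ⊤ \ a, top_sdiff := fun _ => rfl }
    exact ⟨i8, rfl, rfl, fun a b => ⟨rfl, rfl, rfl⟩⟩
  · rintro ⟨_, hM⟩
    have hj : ∀ a b : M, joinOp a b = a ⊔ b := fun a b => (hM.2.2 a b).1
    have hm : ∀ a b : M, meetOp a b = a ⊓ b := fun a b => (hM.2.2 a b).2.1
    have hs : ∀ a b : M, subOp a b = a \ b := fun a b => (hM.2.2 a b).2.2
    simp only [hj, hm, hs, hM.1, hM.2.1, sup_eq_right]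
    exact ⟨sup_comm, sup_assoc, inf_comm, inf_assoc, fun _ _ => sup_inf_self, fun _ _ => inf_sup_self,
      fun _ => bot_le, fun _ => le_top, fun _ _ => le_sup_sdiff, fun _ _ _ => sdiff_le_iff.2⟩

/-- The axioms of subscaled lattices about the components, except `C^i(x) = 0` for `i > d`. -/
noncomputable def lowFormulas (d : ℕ) : Set (LSC.BoundedFormula Empty 3) :=
  {Term.bdEqual (tLow (d + 1) (&0)) (&0)} ∪
  Set.image2 (fun (I : Finset ℕ) k => Term.bdEqual (tComp k (tSup I.toList (&0)))
    (if k ∈ I then tComp k (&0) else tZero)) {I | I ⊆ Finset.range (d + 1)} (Set.Iic d) ∪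
  (fun k => (Term.bdEqual (tLow (k + 1) (&0)) (&0)).imp
    ((Term.bdEqual (tLow (k + 1) (&1)) (&1)).imp
      (Term.bdEqual (tComp k (tJoin (&0) (&1))) (tJoin (tComp k (&0)) (tComp k (&1)))))) ''
    Set.Iic d ∪
  -- For i = j the formula is a trivial identity, which lets the index set be a full product.
  Set.image2 (fun i j => Term.bdEqual (tLow (min i j) (tMeet (tComp (min i j) (&0))
    (tComp (max i j) (&0)))) (if i = j then tLow (min i j) (tMeet (tComp (min i j) (&0))
    (tComp (max i j) (&0))) else tMeet (tComp (min i j) (&0)) (tComp (max i j) (&0))))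
    (Set.Iic d) (Set.Iic d) ∪
  (fun k => (Term.bdEqual (tLow (k + 1) (&1)) (&1)).imp
      (Term.bdEqual (tSub (tComp k (&0)) (&1)) (tSub (tComp k (&0)) (tComp k (&1))))) ''
    Set.Iic d ∪
  (fun k => (Term.bdEqual (&0) tZero).not.imp
    ((Term.bdEqual (tJoin (&1) (tSub (&0) (&1))) (tSub (&0) (&1))).imp
      ((Term.bdEqual (tLow (k + 1) (&0)) (&0)).imp (Term.bdEqual (tLow k (&1)) (&1))))) ''
    Set.Iic d

theorem lowFormulas_finite (d : ℕ) : (lowFormulas d).Finite := by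
  have h1 : (Set.Iic d).Finite := Set.finite_Iic d
  have h2 : {I : Finset ℕ | I ⊆ Finset.range (d + 1)}.Finite := by
    convert (Finset.range (d + 1)).powerset.finite_toSet using 1
    ext I; simp [-Finset.coe_range]
  exact (((((Set.finite_singleton _).union (h2.image2 _ h1)).union (h1.image _)).union
    (h1.image2 _ h1)).union (h1.image _)).union (h1.image _)

theorem models_lowFormulas_iff {M : Type u} [LSC.Structure M] [CoheytingAlgebra M]
    (hM : Compatible M) (d : ℕ) :
    ((∀ φ ∈ lowFormulas d, M ⊨ univ3 φ) ∧ ∀ i, d < i → ∀ a : M, compOp i a = zeroOp M) ↔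
      LowAxioms d (compOp (M := M)) := by
  have : Nonempty M := ⟨⊥⟩
  have e : (∀ φ ∈ lowFormulas d, M ⊨ univ3 φ) ↔
      (∀ a : M, ((Finset.range (d + 1)).sup fun i => compOp i a) = a) ∧
      (∀ I : Finset ℕ, I ⊆ Finset.range (d + 1) → ∀ k ≤ d, ∀ a : M,
        compOp k (I.sup fun i => compOp i a) = if k ∈ I then compOp k a else ⊥) ∧
      (∀ k ≤ d, ∀ a b : M, Low compOp (k + 1) a → Low compOp (k + 1) b →
        compOp k (a ⊔ b) = compOp k a ⊔ compOp k b) ∧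
      (∀ i ≤ d, ∀ j ≤ d, ∀ a : M, ((Finset.range (min i j)).sup fun l =>
        compOp l (compOp (min i j) a ⊓ compOp (max i j) a)) = if i = j then
          ((Finset.range (min i j)).sup fun l =>
          compOp l (compOp (min i j) a ⊓ compOp (max i j) a)) else
            compOp (min i j) a ⊓ compOp (max i j) a) ∧
      (∀ k ≤ d, ∀ a b : M, Low compOp (k + 1) b → compOp k a \ b = compOp k a \ compOp k b) ∧
      (∀ k ≤ d, ∀ a b : M, a ≠ ⊥ → b ≤ a \ b → Low compOp (k + 1) a → Low compOp k b) := by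
    simp only [lowFormulas, Set.mem_union, or_imp, forall_and, Set.mem_singleton_iff, forall_eq,
      Set.forall_mem_image2, Set.forall_mem_image, Set.mem_Iic, Set.mem_ofPred_eq,
      realize_univ3, BoundedFormula.realize_bdEqual, BoundedFormula.realize_imp,
      BoundedFormula.realize_not, realize_ite,
      hM.realize_tJoin, hM.realize_tMeet, hM.realize_tSub, hM.realize_tZero, hM.realize_tLow,
      hM.realize_tSup, realize_tComp, Finset.toList_toFinset,
      Low, sup_eq_right]
    simp [forall_const, and_assoc]
  rw [e]
  constructor
  · rintro ⟨⟨h1, h2, h3, h4, h5, h6⟩, h7⟩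
    refine ⟨h1, fun i hi a => (h7 i hi a).trans hM.1, h2, h3, fun i j hij hj a => ?_, h5, h6⟩
    have := h4 i (hij.le.trans hj) j hj a
    rwa [if_neg hij.ne, min_eq_left hij.le, max_eq_right hij.le] at this
  · intro h
    refine ⟨⟨h.sup_comp, h.comp_sup_comp, h.comp_sup, fun i hi j hj a => ?_, h.comp_sdiff,
      h.low_of_le_sdiff⟩, fun i hi a => (h.comp_eq_bot i hi a).trans hM.1.symm⟩
    split_ifs with hij
    · rfl
    · exact h.low_inf _ _ (min_lt_max.2 hij) (max_le hi hj) a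

/-- Universal axioms of subscaled lattices, except `C^i(x) = 0` for `i > d`. -/
noncomputable def finiteAxioms (d : ℕ) : LSC.Theory := univ3 '' (opFormulas ∪ lowFormulas d)

/-- The identities `C^i(x) = 0` for `i > d`. -/
def vanishAxioms (d : ℕ) : LSC.Theory :=
  (fun i => univ3 (Term.bdEqual (tComp i (&0)) tZero)) '' Set.Ioi d

theorem models_vanishAxioms_iff {M : Type u} [LSC.Structure M] {d : ℕ} :
    M ⊨ vanishAxioms d ↔ ∀ i, d < i → ∀ a : M, compOp i a = zeroOp M := by
  have : Nonempty M := ⟨zeroOp M⟩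
  simp only [Theory.model_iff, vanishAxioms, Set.forall_mem_image, Set.mem_Ioi, realize_univ3,
    BoundedFormula.realize_bdEqual, realize_tComp, realize_tZero]
  simp

theorem isSubscaled_iff {M : Type u} [LSC.Structure M] {d : ℕ} :
    IsSubscaled d M ↔ M ⊨ finiteAxioms d ∧ ∀ i, d < i → ∀ a : M, compOp i a = zeroOp M := by
  simp only [Theory.model_iff, finiteAxioms, Set.forall_mem_image, Set.mem_union, or_imp, forall_and]
  constructor
  · rintro ⟨_, hM, h⟩
    have h2 := (models_lowFormulas_iff hM d).2 (subscaledAxioms_iff.1 h)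
    exact ⟨⟨exists_compatible_iff.2 ⟨_, hM⟩, h2.1⟩, h2.2⟩
  · rintro ⟨⟨h1, h2⟩, h3⟩
    obtain ⟨_, hM⟩ := exists_compatible_iff.1 h1
    exact ⟨_, hM, subscaledAxioms_iff.2 ((models_lowFormulas_iff hM d).1 ⟨h2, h3⟩)⟩

/-- Universal axioms of subscaled lattices. -/
noncomputable def subscaledAxiomsTheory (d : ℕ) : LSC.Theory := finiteAxioms d ∪ vanishAxioms d

theorem models_subscaledAxiomsTheory_iff {M : Type u} [LSC.Structure M] {d : ℕ} :
    M ⊨ subscaledAxiomsTheory d ↔ IsSubscaled d M := by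
  rw [isSubscaled_iff, subscaledAxiomsTheory, Theory.model_union_iff, models_vanishAxioms_iff]

theorem exists_isQF_of_mem {d : ℕ} :
    ∀ φ ∈ subscaledAxiomsTheory d, ∃ ψ, BoundedFormula.IsQF ψ ∧ φ = univ3 ψ := by
  have key : ∀ φ : LSC.BoundedFormula Empty 3, φ.IsQF →
      ∃ ψ, BoundedFormula.IsQF ψ ∧ univ3 φ = univ3 ψ := fun φ h => ⟨φ, h, rfl⟩
  rintro _ (⟨φ, h | h, rfl⟩ | ⟨i, -, rfl⟩)
  · apply key
    simp only [opFormulas, Set.mem_insert_iff, Set.mem_singleton_iff] at h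
    rcases h with rfl | rfl | rfl | rfl | rfl | rfl | rfl | rfl | rfl | rfl <;>
      first
      | exact isQF_bdEqual _ _
      | exact (isQF_bdEqual _ _).imp (isQF_bdEqual _ _)
  · apply key
    simp only [lowFormulas, Set.mem_union, Set.mem_singleton_iff, Set.mem_image2,
      Set.mem_image] at h
    rcases h with ((((rfl | ⟨_, _, _, _, rfl⟩) | ⟨_, _, rfl⟩) | ⟨_, _, _, _, rfl⟩) | ⟨_, _, rfl⟩) |
      ⟨_, _, rfl⟩
    · exact isQF_bdEqual _ _
    · exact isQF_bdEqual _ _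
    · exact (isQF_bdEqual _ _).imp ((isQF_bdEqual _ _).imp (isQF_bdEqual _ _))
    · exact isQF_bdEqual _ _
    · exact (isQF_bdEqual _ _).imp (isQF_bdEqual _ _)
    · exact (isQF_bdEqual _ _).not.imp
        ((isQF_bdEqual _ _).imp ((isQF_bdEqual _ _).imp (isQF_bdEqual _ _)))
  · exact key _ (isQF_bdEqual _ _)

theorem isUniversal_subscaledAxiomsTheory (d : ℕ) :
    ∀ φ ∈ subscaledAxiomsTheory d, φ.IsUniversal := by
  intro φ hφ
  obtain ⟨ψ, h, rfl⟩ := exists_isQF_of_mem φ hφ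
  exact isUniversal_alls h.isUniversal

/-- Subscaled lattices are closed under substructures. -/
theorem IsSubscaled.of_embedding {M N : Type*} [LSC.Structure M] [LSC.Structure N] {d : ℕ}
    (hN : IsSubscaled d N) (f : M ↪[LSC] N) : IsSubscaled d M := by
  rw [← models_subscaledAxiomsTheory_iff] at hN ⊢
  have : (subscaledAxiomsTheory d).IsUniversal := ⟨fun φ hφ => isUniversal_subscaledAxiomsTheory d φ hφ⟩
  exact Theory.IsUniversal.models_of_embedding f

/-- An instance of the Catenarity Property. -/
def catFormula (r q p : ℕ) : LSC.BoundedFormula Empty 2 :=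
    ((Term.bdEqual (tJoin (&0) (&1)) (&1)).imp ((Term.bdEqual (&1) tZero).not.imp
      ((Term.bdEqual (tComp r (&0)) (&0)).imp ((Term.bdEqual (tComp p (&1)) (&1)).imp
        (BoundedFormula.ex ((Term.bdEqual (&2) tZero).not ⊓ (Term.bdEqual (tComp q (&2)) (&2) ⊓
          (Term.bdEqual (tJoin (&0) (&2)) (&2) ⊓ Term.bdEqual (tJoin (&2) (&1)) (&1)))))))))

/-- The Splitting Property. -/
def splitFormula : LSC.BoundedFormula Empty 3 :=
    ((Term.bdEqual (tJoin (tJoin (&0) (&1)) (tSub (&2) (tJoin (&0) (&1))))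
      (tSub (&2) (tJoin (&0) (&1)))).imp ((Term.bdEqual (&2) tZero).not.imp
        (BoundedFormula.ex (BoundedFormula.ex
          ((Term.bdEqual (&3) tZero).not ⊓ ((Term.bdEqual (&4) tZero).not ⊓
            (Term.bdEqual (tJoin (&0) (&3)) (&3) ⊓ (Term.bdEqual (tJoin (&1) (&4)) (&4) ⊓
              (Term.bdEqual (&3) (tSub (&2) (&4)) ⊓ (Term.bdEqual (&4) (tSub (&2) (&3)) ⊓
                Term.bdEqual (tMeet (&3) (&4)) (tMeet (&0) (&1)))))))))))) 

/-- The universal closure of an instance of the Catenarity Property. -/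
def catSentence (r q p : ℕ) : LSC.Sentence := (catFormula r q p).alls

/-- The universal closure of the Splitting Property. -/
def splitSentence : LSC.Sentence := splitFormula.alls

theorem realize_alls_two {M : Type u} [LSC.Structure M] {φ : LSC.BoundedFormula Empty 2} :
    M ⊨ (φ.alls : LSC.Sentence) ↔ ∀ a b : M, φ.Realize default ![a, b] := by
  refine (BoundedFormula.realize_alls (φ := φ) (v := default)).trans ?_
  constructor
  · intro h a b; exact h _
  · intro h xs
    have := h (xs 0) (xs 1)
    convert this using 1
    ext i; fin_cases i <;> rfl

theorem realize_catFormula {M : Type u} [LSC.Structure M] [CoheytingAlgebra M]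
    (hM : Compatible M) (r q p : ℕ) {v : Fin 2 → M} :
    (catFormula r q p).Realize default v ↔
      (v 0 ≤ v 1 → v 1 ≠ ⊥ → Pure compOp r (v 0) → Pure compOp p (v 1) →
        ∃ b, b ≠ ⊥ ∧ Pure compOp q b ∧ v 0 ≤ b ∧ b ≤ v 1) := by
  unfold catFormula
  simp only [BoundedFormula.realize_bdEqual, BoundedFormula.realize_imp,
      BoundedFormula.realize_not, BoundedFormula.realize_ex, BoundedFormula.realize_inf,
      hM.realize_tJoin, hM.realize_tZero, realize_tComp, sup_eq_right]
  exact Iff.rfl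

theorem realize_catSentence {M : Type u} [LSC.Structure M] [CoheytingAlgebra M]
    (hM : Compatible M) (r q p : ℕ) :
    M ⊨ catSentence r q p ↔ ∀ c a : M, c ≤ a → a ≠ ⊥ → Pure compOp r c → Pure compOp p a →
      ∃ b, b ≠ ⊥ ∧ Pure compOp q b ∧ c ≤ b ∧ b ≤ a := by
  unfold catSentence
  simp only [realize_alls_two, realize_catFormula hM]
  exact Iff.rfl

theorem realize_splitFormula {M : Type u} [LSC.Structure M] [CoheytingAlgebra M]
    (hM : Compatible M) {v : Fin 3 → M} : splitFormula.Realize default v ↔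
      (v 0 ⊔ v 1 ≤ v 2 \ (v 0 ⊔ v 1) → v 2 ≠ ⊥ →
        ∃ a₁ a₂ : M, a₁ ≠ ⊥ ∧ a₂ ≠ ⊥ ∧ v 0 ≤ a₁ ∧ v 1 ≤ a₂ ∧
          a₁ = v 2 \ a₂ ∧ a₂ = v 2 \ a₁ ∧ a₁ ⊓ a₂ = v 0 ⊓ v 1) := by
  unfold splitFormula
  simp only [BoundedFormula.realize_bdEqual, BoundedFormula.realize_imp,
      BoundedFormula.realize_not, BoundedFormula.realize_ex, BoundedFormula.realize_inf,
      hM.realize_tJoin, hM.realize_tMeet, hM.realize_tSub, hM.realize_tZero,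
      sup_eq_right]
  exact Iff.rfl

theorem realize_splitSentence {M : Type u} [LSC.Structure M] [CoheytingAlgebra M]
    (hM : Compatible M) : M ⊨ splitSentence ↔ Splitting M := by
  unfold splitSentence
  rw [show ∀ φ : LSC.BoundedFormula Empty 3, φ.alls = univ3 φ from fun _ => rfl, realize_univ3]
  simp only [realize_splitFormula hM]
  constructor
  · intro h b₁ b₂ a hw ha
    exact h b₁ b₂ a ((wayBelow_iff ha).1 hw) ha
  · intro h b₁ b₂ a hw ha
    exact h b₁ b₂ a (wayBelow_of_le_sdiff hw) ha

/-- Finitely many axioms of super scaled lattices. -/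
noncomputable def finiteSuperAxioms (d : ℕ) : LSC.Theory :=
  finiteAxioms d ∪ (insert splitSentence
    ((fun i : ℕ × ℕ × ℕ => catSentence i.1 i.2.1 i.2.2) ''
      {i | i.1 ≤ i.2.1 ∧ i.2.1 ≤ i.2.2 ∧ i.2.2 ≤ d}))

theorem finite_catIndex (d : ℕ) :
    {i : ℕ × ℕ × ℕ | i.1 ≤ i.2.1 ∧ i.2.1 ≤ i.2.2 ∧ i.2.2 ≤ d}.Finite := by
  refine Set.Finite.subset ((Set.finite_Iic d).prod ((Set.finite_Iic d).prod (Set.finite_Iic d))) ?_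
  rintro ⟨i, j, k⟩ ⟨h1, h2, h3⟩
  simp only at h1 h2 h3
  simp only [Set.mem_prod, Set.mem_Iic]
  omega

theorem finiteSuperAxioms_finite (d : ℕ) : (finiteSuperAxioms d).Finite := by
  refine Set.Finite.union (Set.Finite.image _ (Set.Finite.union ?_ (lowFormulas_finite d)))
    (Set.Finite.insert _ (Set.Finite.image _ (finite_catIndex d)))
  unfold opFormulas; exact Set.toFinite _

theorem isSuperScaled_iff {M : Type u} [LSC.Structure M] {d : ℕ} :
    IsSuperScaled d M ↔
      M ⊨ finiteSuperAxioms d ∧ ∀ i, d < i → ∀ a : M, compOp i a = zeroOp M := by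
  have key : ∀ [CoheytingAlgebra M] (_ : Compatible M) (_ : SubscaledAxioms d (compOp (M := M))),
      (M ⊨ (insert splitSentence ((fun i : ℕ × ℕ × ℕ => catSentence i.1 i.2.1 i.2.2) ''
        {i | i.1 ≤ i.2.1 ∧ i.2.1 ≤ i.2.2 ∧ i.2.2 ≤ d}) : LSC.Theory)) ↔
        Catenarity (compOp (M := M)) ∧ Splitting M := by
    intro _ hM h
    simp only [Theory.model_iff, Set.mem_insert_iff, forall_eq_or_imp, Set.forall_mem_image,
      realize_splitSentence hM, realize_catSentence hM, Set.mem_ofPred_eq]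
    rw [and_comm]
    refine and_congr_left fun _ => ⟨fun hc r q p hrq hqp c a hca ha hc' ha' => ?_,
      fun hc i hi c a hca ha hc' ha' => ?_⟩
    · rw [h.isScPure_iff] at hc' ha'
      -- A nonzero p-pure element forces p ≤ d, so finitely many instances of Catenarity suffice.
      obtain ⟨b, h1, h2, h3, h4⟩ := hc (x := (r, q, p)) ⟨hrq, hqp, h.pure_dim_le ha' ha⟩ c a hca ha hc' ha'
      exact ⟨b, h1, h.isScPure_iff.2 h2, h3, h4⟩
    · obtain ⟨b, h1, h2, h3, h4⟩ := hc i.1 i.2.1 i.2.2 hi.1 hi.2.1 c a hca ha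
        (h.isScPure_iff.2 hc') (h.isScPure_iff.2 ha')
      exact ⟨b, h1, h.isScPure_iff.1 h2, h3, h4⟩
  unfold finiteSuperAxioms
  rw [Theory.model_union_iff, and_right_comm, ← isSubscaled_iff]
  constructor
  · rintro ⟨_, hM, h, hcs⟩
    exact ⟨⟨_, hM, h⟩, (key hM h).2 hcs⟩
  · rintro ⟨⟨_, hM, h⟩, hcs⟩
    exact ⟨_, hM, h, (key hM h).1 hcs⟩

/-- Axioms of super scaled lattices. -/
noncomputable def superAxiomsTheory (d : ℕ) : LSC.Theory := finiteSuperAxioms d ∪ vanishAxioms d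

theorem models_superAxiomsTheory_iff {M : Type u} [LSC.Structure M] {d : ℕ} :
    M ⊨ superAxiomsTheory d ↔ IsSuperScaled d M := by
  rw [isSuperScaled_iff, superAxiomsTheory, Theory.model_union_iff, models_vanishAxioms_iff]

theorem IsSuperScaled.isSubscaled {M : Type u} [LSC.Structure M] {d : ℕ} (h : IsSuperScaled d M) :
    IsSubscaled d M := by
  obtain ⟨i, h1, h2, -⟩ := h
  exact ⟨i, h1, h2⟩

end Axioms

end Subscaled

namespace Subscaled

/-! ### Duality between embeddings and maps of ranked posets -/

section PMaps

variable {J K : Type} [PartialOrder J] [PartialOrder K] {δJ : J → ℕ} {δK : K → ℕ} {d : ℕ}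

/-- The preimage of a lower set under a map of ranked posets. -/
def Down.comap {f : K → J} (hf : IsPMap δK δJ f) (A : Down δJ) : Down δK :=
  (⟨{k | f k ∈ A}, fun _ _ hab h => Down.mem_of_le (hf.mono hab) h⟩ : LowerSet K)

theorem Down.mem_comap {f : K → J} (hf : IsPMap δK δJ f) {A : Down δJ} {k : K} :
    k ∈ Down.comap hf A ↔ f k ∈ A := Iff.rfl

/-- The embedding dual to a map of ranked posets. -/
def IsPMap.embedding {f : K → J} (hf : IsPMap δK δJ f) (hδK : StrictMono δK) :
    Down δJ ↪[LSC] Down δK :=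
  embeddingOfLattice Down.compatible Down.compatible (Down.comap hf)
    (fun A B e => Down.ext fun j => by
      obtain ⟨k, rfl⟩ := hf.surj j
      rw [← Down.mem_comap hf, ← Down.mem_comap hf, e])
    rfl rfl (fun _ _ => rfl) (fun _ _ => rfl)
    -- Lifting is what makes the preimage commute with differences; monotonicity gives the other
    -- inclusion.
    (fun A B => Down.ext fun k => by
      rw [Down.mem_comap, Down.mem_sdiff, Down.mem_sdiff]
      constructor
      · rintro ⟨l, h1, h2, h3⟩
        obtain ⟨k', hk, rfl, -⟩ := hf.lift k l h1
        exact ⟨k', hk, h2, h3⟩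
      · rintro ⟨l, h1, h2, h3⟩
        exact ⟨f l, hf.mono h1, h2, h3⟩)
    -- A lift of a maximal m with the rank of m is maximal in the preimage: anything strictly above
    -- it would also lie over m with a greater rank. Conversely, a maximal l in the preimage equals
    -- its own lift, so l and f l have the same rank.
    (fun i A => Down.ext fun k => by
      change f k ∈ Down.comp i A ↔ k ∈ Down.comp i (Down.comap hf A)
      rw [Down.mem_comp, Down.mem_comp]
      constructor
      · rintro ⟨m, h1, h2, h3, h4⟩
        obtain ⟨l, hl1, hl2, hl3⟩ := hf.lift k m h1
        refine ⟨l, hl1, by rw [Down.mem_comap, hl2]; exact h2, hl3.trans h3, fun l' hl' hll => ?_⟩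
        have h5 : f l' = m := h4 _ hl' (hl2 ▸ hf.mono hll)
        by_contra hne
        have h6 := hδK (lt_of_le_of_ne hll (Ne.symm hne))
        have h7 := hf.dim_le l'
        rw [h5] at h7
        omega
      · rintro ⟨l, h1, h2, h3, h4⟩
        refine ⟨f l, hf.mono h1, h2, ?_, fun m hm hlm => ?_⟩
        · obtain ⟨l', hl1, hl2, hl3⟩ := hf.lift l (f l) le_rfl
          have := h4 l' (by rw [Down.mem_comap, hl2]; exact h2) hl1
          rw [← hl3, this, h3]
        · obtain ⟨l', hl1, hl2, -⟩ := hf.lift l m hlm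
          have := h4 l' (by rw [Down.mem_comap, hl2]; exact hm) hl1
          rw [← hl2, this])

theorem IsPMap.mem_embedding {f : K → J} (hf : IsPMap δK δJ f) (hδK : StrictMono δK) {A : Down δJ}
    {k : K} : k ∈ hf.embedding hδK A ↔ f k ∈ A := Iff.rfl

/-- Every embedding between algebras of lower sets is dual to a map of ranked posets. -/
theorem exists_pmap [Finite J] [Finite K] (hδJ : StrictMono δJ) (hδK : StrictMono δK)
    (e : Down δJ ↪[LSC] Down δK) :
    ∃ f : K → J, IsPMap δK δJ f ∧ ∀ A k, k ∈ e A ↔ f k ∈ A := by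
  cases nonempty_fintype J
  cases nonempty_fintype K
  have hc := Down.compatible (δ := δJ)
  have hc' := Down.compatible (δ := δK)
  have hsup : ∀ (A : Down δJ) k, k ∈ e A ↔ ∃ j ∈ A, k ∈ e (Down.principal δJ j) := by
    intro A k
    conv_lhs => rw [Down.eq_supOn A, map_supOn hc hc']
    unfold supOn
    rw [Down.mem_finset_sup]
    simp
  -- The value f k is the least j whose principal lower set has an image containing k. A least one
  -- exists because a meet of principal lower sets is a join of principal ones.
  have hf : ∀ k : K, ∃ j : J, k ∈ e (Down.principal δJ j) ∧
      ∀ j', k ∈ e (Down.principal δJ j') → j ≤ j' := by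
    intro k
    obtain ⟨j0, -, h0⟩ := (hsup ⊤ k).1 (by rw [map_top' hc hc']; exact Down.mem_top)
    obtain ⟨j, hj, hmin⟩ := wellFounded_lt.has_min {j | k ∈ e (Down.principal δJ j)} ⟨j0, h0⟩
    refine ⟨j, hj, fun j' hj' => ?_⟩
    have h1 : k ∈ e (Down.principal δJ j ⊓ Down.principal δJ j') := by
      rw [map_inf' hc hc']; exact ⟨hj, hj'⟩
    obtain ⟨l, hl, hkl⟩ := (hsup _ k).1 h1
    have h2 : ¬ l < j := hmin l hkl
    have h3 : l = j := by
      by_contra hne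
      exact h2 (lt_of_le_of_ne hl.1 hne)
    exact h3 ▸ hl.2
  choose f hf1 hf2 using hf
  have hmem : ∀ A k, k ∈ e A ↔ f k ∈ A := by
    intro A k
    rw [hsup]
    constructor
    · rintro ⟨j, hj, hk⟩
      exact Down.mem_of_le (hf2 k j hk) hj
    · intro h
      exact ⟨f k, h, hf1 k⟩
  have hlift : ∀ k j, f k ≤ j → ∃ k', k ≤ k' ∧ f k' = j ∧ δK k' = δJ j := by
    intro k j hkj
    have h1 : k ∈ e (Down.principal δJ j) := (hmem _ k).2 hkj
    -- Subtracting the elements strictly below j does not change the principal lower set of j, which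
    -- is moreover (δJ j)-pure. Carried over by e, the first fact gives a point above k over exactly
    -- j, and purity raises it to rank δJ j.
    set B : Down δJ := Down.mk δJ fun l => l < j with hB
    have h2 : Down.principal δJ j = Down.principal δJ j \ B := by
      refine Down.ext fun l => ⟨fun hl => ?_, fun hl => (sdiff_le : _ \ B ≤ _) hl⟩
      refine Down.mem_sdiff.2 ⟨j, hl, Down.mem_principal.2 le_rfl, ?_⟩
      rintro ⟨m, h3, h4⟩
      exact h4.not_ge h3
    rw [h2, map_sdiff' hc hc'] at h1
    obtain ⟨k1, hk1, hk1j, hk1B⟩ := Down.mem_sdiff.1 h1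
    have h3 : Pure Down.comp (δJ j) (e (Down.principal δJ j)) :=
      (map_compOp e (δJ j) (Down.principal δJ j)).symm.trans (congrArg e
        ((Down.pure_iff hδJ).2 fun k hk => ⟨j, hk, Down.mem_principal.2 le_rfl, rfl⟩))
    obtain ⟨k2, hk2, hk2j, hk2d⟩ := (Down.pure_iff hδK).1 h3 k1 hk1j
    refine ⟨k2, hk1.trans hk2, ?_, hk2d⟩
    have h4 : f k2 ≤ j := (hmem _ _).1 hk2j
    by_contra hne
    refine hk1B (Down.mem_of_le hk2 ((hmem _ _).2 ⟨f k2, le_rfl, lt_of_le_of_ne h4 hne⟩))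
  refine ⟨f, ⟨fun k k' hkk => ?_, fun k => ?_, hlift, fun j => ?_⟩, hmem⟩
  · exact hf2 k _ (Down.mem_of_le hkk (hf1 k'))
  · obtain ⟨k', hk, -, hk'⟩ := hlift k (f k) le_rfl
    rw [← hk']
    exact hδK.monotone hk
  · set B : Down δJ := Down.mk δJ fun l => l < j with hB
    have h1 : ¬ e (Down.principal δJ j) ≤ e B := by
      rw [map_le_map hc hc']
      intro hle
      obtain ⟨m, h3, h4⟩ := hle (Down.mem_principal.2 (le_refl j))
      exact h4.not_ge h3
    by_contra hne
    push Not at hne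
    refine h1 fun k hk => (hmem _ _).2 ?_
    exact ⟨f k, le_rfl, lt_of_le_of_ne ((hmem _ _).1 hk) (hne k)⟩

end PMaps

/-! ### Extension of embeddings into super scaled lattices -/

section Extension

variable {d : ℕ}

/-- The embedding g is turned into a map of posets and e into a system; the system that
`exists_system_extension` builds over the larger poset is the required embedding. -/
theorem exists_embedding_extension {N : Type*} [LSC.Structure N] (hN : IsSuperScaled d N)
    {J K : Type} [Finite J] [Finite K] [PartialOrder J] [PartialOrder K] {δJ : J → ℕ} {δK : K → ℕ}
    (hδJ : StrictMono δJ) (hδK : StrictMono δK) (e : Down δJ ↪[LSC] N)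
    (g : Down δJ ↪[LSC] Down δK) :
    ∃ e' : Down δK ↪[LSC] N, ∀ A, e' (g A) = e A := by
  cases nonempty_fintype J
  cases nonempty_fintype K
  obtain ⟨_, hc, h, hcat, hs⟩ := hN
  obtain ⟨f, hf, hmem⟩ := exists_pmap hδJ hδK g
  obtain ⟨y, hy, hxy⟩ :=
    exists_system_extension h hcat hs hδK hδJ (isSystem_of_embedding hc hδJ e) hf
  refine ⟨hy.embedding hc h hδK, fun A => ?_⟩
  rw [IsSystem.embedding_apply]
  conv_rhs => rw [Down.eq_supOn A, map_supOn Down.compatible hc]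
  apply le_antisymm
  · refine supOn_le_iff.2 fun k hk => ?_
    refine le_trans ?_ (le_supOn (x := fun j => e (Down.principal δJ j)) ((hmem A k).1 hk))
    rw [hxy (f k)]
    exact le_supOn (p := fun l => f l ≤ f k) le_rfl
  · refine supOn_le_iff.2 fun j hj => ?_
    rw [hxy j]
    exact supOn_le_supOn fun k hk => ⟨(hmem A k).2 (Down.mem_of_le hk hj), le_rfl⟩

/-- Finitely many elements of a subscaled lattice lie in the image of some `Down δ`. -/
theorem exists_down_embedding {M : Type*} [LSC.Structure M] (hM : IsSubscaled d M) (ι : Type)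
    [Fintype ι] (g : ι → M) :
    ∃ (J : Type) (_ : Fintype J) (_ : PartialOrder J) (δ : J → ℕ) (e : Down δ ↪[LSC] M),
      StrictMono δ ∧ (∀ j, δ j ≤ d) ∧ Fintype.card J ≤ sizeBound (d + 1) (Fintype.card ι) ∧
        ∀ i, ∃ A, e A = g i := by
  obtain ⟨_, hc, h⟩ := hM
  obtain ⟨J, _, _, δ, x, hδ, hx, hg, hcard⟩ := exists_system h ι g
  refine ⟨J, _, _, δ, hx.embedding hc h hδ, hδ,
    fun j => h.pure_dim_le (hx.pure j) (hx.ne_bot j), hcard, fun i => ?_⟩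
  refine ⟨Down.mk δ fun j => x j ≤ g i, ?_⟩
  rw [IsSystem.embedding_apply]
  apply le_antisymm
  · refine supOn_le_iff.2 ?_
    rintro j ⟨l, hjl, hl⟩
    exact (hx.mono j l hjl).trans hl
  · exact (hg i).le.trans (supOn_le_supOn fun j hj => ⟨⟨j, le_rfl, hj⟩, le_rfl⟩)

/-- The isomorphism given by a surjective embedding. -/
noncomputable def equivOfSurjective {M N : Type*} [LSC.Structure M] [LSC.Structure N]
    (e : M ↪[LSC] N) (he : Function.Surjective e) : M ≃[LSC] N where
  toEquiv := Equiv.ofBijective e ⟨e.injective, he⟩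
  map_fun' f x := e.map_fun f x
  map_rel' r x := e.map_rel r x

theorem surjective_of_closure {M N : Type*} [LSC.Structure M] [LSC.Structure N] (e : M ↪[LSC] N)
    {s : Set N} (hs : Substructure.closure LSC s = ⊤) (h : ∀ a ∈ s, ∃ b, e b = a) :
    Function.Surjective e := by
  have h1 : Substructure.closure LSC s ≤ e.toHom.range :=
    Substructure.closure_le.2 fun a ha => h a ha
  rw [hs] at h1
  intro a
  obtain ⟨b, hb⟩ := h1 (Substructure.mem_top a)
  exact ⟨b, hb⟩

/-- Finitely generated subscaled lattices are algebras of lower sets of finite ranked posets. -/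
theorem exists_down_equiv {M : Type*} [LSC.Structure M] (hM : IsSubscaled d M)
    (hfg : Structure.FG LSC M) :
    ∃ (J : Type) (_ : Finite J) (_ : PartialOrder J) (δ : J → ℕ), StrictMono δ ∧
      (∀ j, δ j ≤ d) ∧ Nonempty (Down δ ≃[LSC] M) := by
  obtain ⟨s, hs⟩ := hfg.out
  obtain ⟨J, hJ, hJ', δ, e, h1, h2, -, h4⟩ := exists_down_embedding hM (Fin s.card)
    fun i => (s.equivFin.symm i : M)
  refine ⟨J, inferInstance, hJ', δ, h1, h2, ⟨equivOfSurjective e ?_⟩⟩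
  refine surjective_of_closure e hs fun a ha => ?_
  obtain ⟨A, hA⟩ := h4 (s.equivFin ⟨a, ha⟩)
  exact ⟨A, by rw [hA]; simp⟩

theorem exists_extension_of_fg {A B N : Type*} [LSC.Structure A] [LSC.Structure B]
    [LSC.Structure N] (hN : IsSuperScaled d N) (hB : IsSubscaled d B) (hAfg : Structure.FG LSC A)
    (hBfg : Structure.FG LSC B) (i : A ↪[LSC] B) (f : A ↪[LSC] N) :
    ∃ g : B ↪[LSC] N, ∀ a, g (i a) = f a := by
  obtain ⟨J, _, _, δJ, hδJ, -, ⟨eA⟩⟩ := exists_down_equiv (hB.of_embedding i) hAfg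
  obtain ⟨K, _, _, δK, hδK, -, ⟨eB⟩⟩ := exists_down_equiv hB hBfg
  obtain ⟨e', he'⟩ := exists_embedding_extension hN hδJ hδK (f.comp eA.toEmbedding)
    (eB.symm.toEmbedding.comp (i.comp eA.toEmbedding))
  refine ⟨e'.comp eB.symm.toEmbedding, fun a => ?_⟩
  have := he' (eA.symm a)
  simpa using this

/-- Finite partial isomorphisms from a subscaled lattice to a super scaled lattice extend. -/
theorem isExtensionPair {M N : Type*} [LSC.Structure M] [LSC.Structure N] (hM : IsSubscaled d M)
    (hN : IsSuperScaled d N) : LSC.IsExtensionPair M N := by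
  rw [isExtensionPair_iff_exists_embedding_closure_singleton_sup]
  intro S hS f m
  have hT : (Substructure.closure LSC {m} ⊔ S).FG := (Substructure.fg_closure_singleton m).sup hS
  obtain ⟨g, hg⟩ := exists_extension_of_fg hN
    (hM.of_embedding (Substructure.closure LSC {m} ⊔ S).subtype)
    ((Substructure.fg_iff_structure_fg S).1 hS) ((Substructure.fg_iff_structure_fg _).1 hT)
    (Substructure.inclusion (le_sup_right : S ≤ Substructure.closure LSC {m} ⊔ S)) f
  exact ⟨g, by ext a; exact (hg a).symm⟩

end Extension

end Subscaled

namespace Subscaled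

/-! ### A finite extension realizing an instance of Splitting -/

section Splitting

variable {J : Type} [PartialOrder J] {δ : J → ℕ}

/-- Two copies of the part of `J` in `A`, glued along `B₁ ∩ B₂`; only one copy of the elements of
`B₁` and of `B₂` is kept. -/
def SplitPoset (A B₁ B₂ : Down δ) : Type :=
  {p : J × Bool // (p.2 = false → p.1 ∈ B₂ → p.1 ∈ B₁) ∧ (p.2 = true → p.1 ∈ A ∧ p.1 ∉ B₁)}

namespace SplitPoset

variable {A B₁ B₂ : Down δ}

instance [Finite J] : Finite (SplitPoset A B₁ B₂) := by
  unfold SplitPoset; infer_instance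

/-- The two copies of A are incomparable except below the common part B₁ ∩ B₂, while points outside
A lie above both copies of anything below them. A point occurs in the false copy unless it is in B₂
but not in B₁, and in the true copy when it is in A but not in B₁. -/
instance : PartialOrder (SplitPoset A B₁ B₂) where
  le p q := p.1.1 ≤ q.1.1 ∧ (q.1.1 ∈ A → (p.1.1 ∈ B₁ ∧ p.1.1 ∈ B₂) ∨ p.1.2 = q.1.2)
  le_refl p := ⟨le_rfl, fun _ => Or.inr rfl⟩
  le_trans p q r h1 h2 := by
    refine ⟨h1.1.trans h2.1, fun hr => ?_⟩
    rcases h2.2 hr with h | h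
    · exact Or.inl ⟨Down.mem_of_le h1.1 h.1, Down.mem_of_le h1.1 h.2⟩
    · rcases h1.2 (Down.mem_of_le h2.1 hr) with h' | h'
      · exact Or.inl h'
      · exact Or.inr (h'.trans h)
  le_antisymm p q h1 h2 := by
    obtain ⟨⟨x, a⟩, hx⟩ := p
    obtain ⟨⟨y, b⟩, hy⟩ := q
    have e : x = y := le_antisymm h1.1 h2.1
    subst e
    have h3 := h1.2
    have : a = b := by
      dsimp only at *
      cases a <;> cases b <;> simp_all
    subst this
    rfl

/-- The rank of the underlying element. -/
def rank (p : SplitPoset A B₁ B₂) : ℕ := δ p.1.1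

theorem strictMono_rank (hδ : StrictMono δ) : StrictMono (rank (A := A) (B₁ := B₁) (B₂ := B₂)) := by
  intro p q hpq
  refine hδ (lt_of_le_of_ne hpq.le.1 fun e => hpq.not_ge ⟨e.ge, fun hp => ?_⟩)
  rcases hpq.le.2 (e ▸ hp) with h | h
  · exact Or.inl (e ▸ h)
  · exact Or.inr h.symm

/-- A point is lifted within its own copy, except that from the common part or to a target outside A
any available copy will do. -/
theorem isPMap (h₂ : B₂ ≤ A) :
    IsPMap (rank (A := A) (B₁ := B₁) (B₂ := B₂)) δ fun p => p.1.1 := by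
  classical
  have hsurj : ∀ j, ∃ b, ((b = false → j ∈ B₂ → j ∈ B₁) ∧ (b = true → j ∈ A ∧ j ∉ B₁)) := by
    intro j
    by_cases h : j ∈ B₂ → j ∈ B₁
    · exact ⟨false, by simpa using h⟩
    · push Not at h
      exact ⟨true, by simpa using ⟨h₂ h.1, h.2⟩⟩
  refine ⟨fun p q h => h.1, fun p => le_rfl, ?_, fun j => ?_⟩
  · rintro ⟨⟨x, a⟩, hx⟩ y (hxy : x ≤ y)
    by_cases hy : y ∈ A
    · by_cases hB : x ∈ B₁ ∧ x ∈ B₂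
      · obtain ⟨b, hb⟩ := hsurj y
        exact ⟨⟨(y, b), hb⟩, ⟨hxy, fun _ => Or.inl hB⟩, rfl, rfl⟩
      · refine ⟨⟨(y, a), ?_, ?_⟩, ⟨hxy, fun _ => Or.inr rfl⟩, rfl, rfl⟩
        · intro ha h2
          exact absurd ⟨hx.1 ha (Down.mem_of_le hxy h2), Down.mem_of_le hxy h2⟩ hB
        · intro ha
          exact ⟨hy, fun h1 => (hx.2 ha).2 (Down.mem_of_le hxy h1)⟩
    · refine ⟨⟨(y, false), ?_⟩, ⟨hxy, fun h => absurd h hy⟩, rfl, rfl⟩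
      exact ⟨fun _ h => absurd (h₂ h) hy, by simp⟩
  · obtain ⟨b, hb⟩ := hsurj j
    exact ⟨⟨(j, b), hb⟩, rfl⟩

/-- One of the two halves of `A`. -/
def half (A B₁ B₂ : Down δ) (b : Bool) : Down (rank (A := A) (B₁ := B₁) (B₂ := B₂)) :=
  (⟨{p | p.1.1 ∈ A ∧ (p.1.2 = b ∨ (p.1.1 ∈ B₁ ∧ p.1.1 ∈ B₂))}, by
    rintro p q hqp ⟨h1, h2⟩
    refine ⟨Down.mem_of_le hqp.1 h1, ?_⟩
    rcases h2 with h2 | h2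
    · rcases hqp.2 h1 with h | h
      · exact Or.inr h
      · exact Or.inl (h.trans h2)
    · exact Or.inr ⟨Down.mem_of_le hqp.1 h2.1, Down.mem_of_le hqp.1 h2.2⟩⟩ : LowerSet _)

variable (h₂ : B₂ ≤ A) (hB : B₁ ⊔ B₂ ≤ A \ (B₁ ⊔ B₂))

-- Because B₁ ⊔ B₂ ≪ A, every point of A lies under one outside both B₁ and B₂, and such a point is
-- present in both copies.
include hB in
theorem exists_above {x : J} (hx : x ∈ A) : ∃ y, x ≤ y ∧ y ∈ A ∧ y ∉ B₁ ∧ y ∉ B₂ := by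
  by_cases h : x ∈ B₁ ⊔ B₂
  · obtain ⟨y, h1, h2, h3⟩ := Down.mem_sdiff.1 (hB h)
    exact ⟨y, h1, h2, fun h => h3 (Or.inl h), fun h => h3 (Or.inr h)⟩
  · exact ⟨x, le_rfl, hx, fun h' => h (Or.inl h'), fun h' => h (Or.inr h')⟩

include hB in
theorem half_ne_bot (hA : A ≠ ⊥) (b : Bool) : half A B₁ B₂ b ≠ ⊥ := by
  obtain ⟨x, hx⟩ := Down.ne_bot_iff.1 hA
  obtain ⟨y, -, hy, h1, h2⟩ := exists_above hB hx
  exact Down.ne_bot_iff.2 ⟨⟨(y, b), fun _ h => absurd h h2, fun _ => ⟨hy, h1⟩⟩, hy, Or.inl rfl⟩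

-- Each point of a half lies under a point of the same copy outside B₁ and B₂, which does not belong
-- to the other half.
include hB in
theorem half_eq (b : Bool) :
    half A B₁ B₂ b = Down.comap (isPMap h₂) A \ half A B₁ B₂ (!b) := by
  refine Down.ext fun p => ?_
  rw [Down.mem_sdiff]
  constructor
  · rintro ⟨hA, h⟩
    obtain ⟨y, hxy, hy, h1, h2⟩ := exists_above hB hA
    refine ⟨⟨(y, b), fun _ h => absurd h h2, fun _ => ⟨hy, h1⟩⟩, ⟨hxy, fun _ => h.symm⟩, hy, ?_⟩
    rintro ⟨-, h | h⟩
    · cases b <;> simp at h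
    · exact h1 h.1
  · rintro ⟨q, hpq, hq, hqn⟩
    refine Down.mem_of_le hpq ⟨hq, Or.inl ?_⟩
    by_contra h
    exact hqn ⟨hq, Or.inl (by revert h; cases q.1.2 <;> cases b <;> simp)⟩

end SplitPoset

end Splitting

/-! ### A finite extension realizing an instance of Catenarity -/

section Catenarity

variable {J : Type} [PartialOrder J] {δ : J → ℕ}

/-- `J` together with a new element of rank `q` below each element of rank `p` of `A`; the elements
of `J` below the new ones are those of `C`. -/
structure CatPoset (A C : Down δ) (p q : ℕ) : Type where
  /-- The elements of the poset. -/
  val : J ⊕ {a : J // a ∈ A ∧ δ a = p}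

namespace CatPoset

variable {A C : Down δ} {p q : ℕ}

instance [Finite J] : Finite (CatPoset A C p q) :=
  Finite.of_injective (fun x : CatPoset A C p q => x.val) fun ⟨_⟩ ⟨_⟩ h => by cases h; rfl

/-- The element of `J` that gives rise to an element of the extension. -/
def base : CatPoset A C p q → J
  | ⟨.inl x⟩ => x
  | ⟨.inr a⟩ => a.1

/-- The rank in the extension. -/
def rank : CatPoset A C p q → ℕ
  | ⟨.inl x⟩ => δ x
  | ⟨.inr _⟩ => q

/-- The order of the extension. -/
def le : CatPoset A C p q → CatPoset A C p q → Prop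
  | ⟨.inl x⟩, ⟨.inl y⟩ => x ≤ y
  | ⟨.inr a⟩, ⟨.inl y⟩ => a.1 ≤ y
  | ⟨.inl x⟩, ⟨.inr a⟩ => x ∈ C ∧ x ≤ a.1
  | ⟨.inr a⟩, ⟨.inr b⟩ => a = b

/-- The partial order of the extension. -/
@[reducible] def partialOrder (h : ∀ x ∈ C, δ x ≠ p) : PartialOrder (CatPoset A C p q) where
  le := le
  le_refl x := by rcases x with ⟨x | a⟩ <;> simp [le]
  le_trans x y z := by
    rcases x with ⟨x | a⟩ <;> rcases y with ⟨y | b⟩ <;> rcases z with ⟨z | c⟩ <;> simp only [le]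
    · exact le_trans
    · exact fun h1 h2 => ⟨Down.mem_of_le h1 h2.1, h1.trans h2.2⟩
    · exact fun h1 h2 => h1.2.trans h2
    · rintro h1 rfl; exact h1
    · exact le_trans
    · exact fun h1 h2 => absurd a.2.2 (h _ (Down.mem_of_le h1 h2.1))
    · rintro rfl h1; exact h1
    · exact Eq.trans
  le_antisymm x y := by
    rcases x with ⟨x | a⟩ <;> rcases y with ⟨y | b⟩ <;> simp only [le]
    · intro h1 h2; rw [le_antisymm h1 h2]
    · exact fun h1 h2 => absurd b.2.2 (h _ (Down.mem_of_le h2 h1.1))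
    · exact fun h2 h1 => absurd a.2.2 (h _ (Down.mem_of_le h2 h1.1))
    · rintro rfl _; rfl

end CatPoset

/-- The lower set generated by the new points is the witness. It contains C because purity of A puts
each point of C under a point of A of rank p, hence under the new point attached to it. Old points
serve as lifts, so the projection is a map of ranked posets. -/
theorem exists_cat_extension [Finite J] {d : ℕ} (hδ : StrictMono δ) (hd : ∀ j, δ j ≤ d)
    {A C : Down δ} {p q : ℕ} (hqp : q < p) (hC : ∀ x ∈ C, δ x < q) (hCA : C ≤ A) (hA : A ≠ ⊥)
    (hp : Pure Down.comp p A) :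
    ∃ (K : Type) (_ : Finite K) (_ : PartialOrder K) (δ' : K → ℕ) (g : Down δ ↪[LSC] Down δ'),
      StrictMono δ' ∧ (∀ k, δ' k ≤ d) ∧ ∃ B, B ≠ ⊥ ∧ Pure Down.comp q B ∧ g C ≤ B ∧ B ≤ g A := by
  have hCp : ∀ x ∈ C, δ x ≠ p := fun x hx => by have := hC x hx; omega
  let _ := CatPoset.partialOrder (A := A) (q := q) hCp
  have hs : StrictMono (CatPoset.rank (A := A) (C := C) (p := p) (q := q)) := by
    intro x y hxy
    have h1 : CatPoset.le x y := hxy.le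
    have h2 : x ≠ y := hxy.ne
    rcases x with ⟨x | a⟩ <;> rcases y with ⟨y | b⟩ <;> simp only [CatPoset.le, CatPoset.rank] at *
    · exact hδ (lt_of_le_of_ne h1 fun e => h2 (e ▸ rfl))
    · exact hC x h1.1
    · have := hδ.monotone h1
      rw [a.2.2] at this
      omega
    · exact absurd (h1 ▸ rfl) h2
  have hf : IsPMap (CatPoset.rank (A := A) (C := C) (p := p) (q := q)) δ CatPoset.base := by
    refine ⟨fun x y hxy => ?_, fun x => ?_, fun x j hj => ⟨⟨.inl j⟩, ?_, rfl, rfl⟩, fun j =>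
      ⟨⟨.inl j⟩, rfl⟩⟩
    · change CatPoset.le x y at hxy
      rcases x with ⟨x | a⟩ <;> rcases y with ⟨y | b⟩ <;> simp only [CatPoset.le, CatPoset.base] at *
      · exact hxy
      · exact hxy.2
      · exact hxy
      · exact hxy ▸ le_rfl
    · rcases x with ⟨x | a⟩
      · exact le_rfl
      · simp only [CatPoset.rank, CatPoset.base, a.2.2]; exact hqp.le
    · rcases x with ⟨x | a⟩ <;> exact hj
  obtain ⟨x0, hx0⟩ := Down.ne_bot_iff.1 hA
  obtain ⟨a0, -, ha0, ha0p⟩ := (Down.pure_iff hδ).1 hp x0 hx0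
  set B : Down (CatPoset.rank (A := A) (C := C) (p := p) (q := q)) :=
    Down.mk _ fun x => ∃ a, x = ⟨.inr a⟩ with hB
  refine ⟨CatPoset A C p q, inferInstance, inferInstance, CatPoset.rank, hf.embedding hs, hs, ?_,
    B, ?_, ?_, ?_, ?_⟩
  · rintro ⟨x | a⟩
    · exact hd x
    · have := hd a.1
      rw [a.2.2] at this
      simp only [CatPoset.rank]; omega
  · exact Down.ne_bot_iff.2 ⟨⟨.inr ⟨a0, ha0, ha0p⟩⟩, _, le_rfl, _, rfl⟩
  · rw [Down.pure_iff hs]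
    rintro k ⟨l, hkl, a, rfl⟩
    exact ⟨_, hkl, ⟨_, le_rfl, a, rfl⟩, rfl⟩
  · rintro ⟨x | a⟩ (hx : _ ∈ C)
    · obtain ⟨a, h1, h2, h3⟩ := (Down.pure_iff hδ).1 hp x (hCA hx)
      exact ⟨⟨.inr ⟨a, h2, h3⟩⟩, ⟨hx, h1⟩, _, rfl⟩
    · exact absurd a.2.2 (hCp _ hx)
  · rintro x ⟨l, hl, a, rfl⟩
    exact (Down.mem_of_le (hf.mono hl) a.2.1 : x.base ∈ A)

end Catenarity

end Subscaled

/-! ### Countable super scaled lattices as limits of finite algebras -/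

namespace Subscaled

/-- A finite ranked poset of rank at most `d`. -/
structure RankedPoset (d : ℕ) : Type 1 where
  /-- The elements. -/
  carrier : Type
  finite : Finite carrier
  partialOrder : PartialOrder carrier
  /-- The rank function. -/
  rank : carrier → ℕ
  strictMono : StrictMono rank
  rank_le : ∀ j, rank j ≤ d

namespace RankedPoset

variable {d : ℕ}

instance (P : RankedPoset d) : Finite P.carrier := P.finite

instance (P : RankedPoset d) : PartialOrder P.carrier := P.partialOrder

/-- The algebra of lower sets. -/
abbrev Alg (P : RankedPoset d) : Type := Down P.rank

theorem isSubscaled (P : RankedPoset d) : IsSubscaled d P.Alg :=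
  Down.isSubscaled P.strictMono P.rank_le

theorem countable_alg (P : RankedPoset d) : Countable P.Alg := Finite.to_countable

end RankedPoset

/-- Formulas that are preserved by embeddings. -/
def Upward {n : ℕ} (φ : LSC.BoundedFormula Empty n) : Prop :=
  ∀ (M N : Type) [LSC.Structure M] [LSC.Structure N] (e : M ↪[LSC] N) (v : Fin n → M),
    φ.Realize default v → φ.Realize default (e ∘ v)

theorem IsExistential.upward {n : ℕ} {φ : LSC.BoundedFormula Empty n} (h : φ.IsExistential) :
    Upward φ := by
  intro M N _ _ e v hv
  have := h.realize_embedding e hv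
  rwa [Subsingleton.elim (e ∘ (default : Empty → M)) default] at this

/-- Embeddings reflect quantifier-free premises. The axioms of Splitting and Catenarity have such
premises and existential conclusions, so an instance made true at one stage remains true later. -/
theorem IsQF.upward_imp {n : ℕ} {φ ψ : LSC.BoundedFormula Empty n} (h : φ.IsQF) (hψ : Upward ψ) :
    Upward (φ.imp ψ) := by
  intro M N _ _ e v hv hφ
  refine hψ M N e v (hv ?_)
  rw [← h.realize_embedding e]
  rwa [Subsingleton.elim (e ∘ (default : Empty → M)) default]

theorem upward_catFormula (r q p : ℕ) : Upward (catFormula r q p) := by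
  unfold catFormula
  refine IsQF.upward_imp (isQF_bdEqual _ _) (IsQF.upward_imp (isQF_bdEqual _ _).not
    (IsQF.upward_imp (isQF_bdEqual _ _) (IsQF.upward_imp (isQF_bdEqual _ _)
      (IsExistential.upward (BoundedFormula.IsExistential.ex
        (BoundedFormula.IsQF.isExistential ?_))))))
  exact (isQF_bdEqual _ _).not.inf ((isQF_bdEqual _ _).inf ((isQF_bdEqual _ _).inf
    (isQF_bdEqual _ _)))

theorem upward_splitFormula : Upward splitFormula := by
  unfold splitFormula
  refine IsQF.upward_imp (isQF_bdEqual _ _) (IsQF.upward_imp (isQF_bdEqual _ _).not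
    (IsExistential.upward (BoundedFormula.IsExistential.ex (BoundedFormula.IsExistential.ex
      (BoundedFormula.IsQF.isExistential ?_)))))
  exact (isQF_bdEqual _ _).not.inf ((isQF_bdEqual _ _).not.inf ((isQF_bdEqual _ _).inf
    ((isQF_bdEqual _ _).inf ((isQF_bdEqual _ _).inf ((isQF_bdEqual _ _).inf
      (isQF_bdEqual _ _))))))

section Chain

variable {d : ℕ} {F : Set (Σ n, LSC.BoundedFormula Empty n)}

theorem exists_realize_list (hup : ∀ φ ∈ F, Upward φ.2)
    (hstep : ∀ φ ∈ F, ∀ (P : RankedPoset d) (v : Fin φ.1 → P.Alg),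
      ∃ (Q : RankedPoset d) (g : P.Alg ↪[LSC] Q.Alg), φ.2.Realize default (g ∘ v))
    (P : RankedPoset d) (l : List (Σ φ : F, (Fin φ.1.1 → P.Alg))) :
    ∃ (Q : RankedPoset d) (g : P.Alg ↪[LSC] Q.Alg), ∀ t ∈ l,
      t.1.1.2.Realize default (g ∘ t.2) := by
  induction l with
  | nil => exact ⟨P, Embedding.refl LSC _, by simp⟩
  | cons t l ih =>
    obtain ⟨Q, g, hg⟩ := ih
    obtain ⟨Q', g', hg'⟩ := hstep t.1.1 t.1.2 Q (g ∘ t.2)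
    refine ⟨Q', g'.comp g, fun s hs => ?_⟩
    rcases List.mem_cons.1 hs with rfl | hs
    · exact hg'
    · exact hup s.1.1 s.1.2 _ _ g' _ (hg s hs)

/-- Formulas preserved by embeddings whose instances can be realized in extensions by algebras of
lower sets hold in some countable extension. -/
theorem exists_model_of_realize (hF : F.Finite) (hup : ∀ φ ∈ F, Upward φ.2)
    (hstep : ∀ φ ∈ F, ∀ (P : RankedPoset d) (v : Fin φ.1 → P.Alg),
      ∃ (Q : RankedPoset d) (g : P.Alg ↪[LSC] Q.Alg), φ.2.Realize default (g ∘ v))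
    (P : RankedPoset d) :
    ∃ (M : Type) (_ : LSC.Structure M), Countable M ∧ IsSubscaled d M ∧
      Nonempty (P.Alg ↪[LSC] M) ∧ ∀ φ ∈ F, M ⊨ (φ.2.alls : LSC.Sentence) := by
  -- A finite algebra has only finitely many instances of the formulas in F, so a single finite
  -- extension realizes all of them.
  have hnext : ∀ P : RankedPoset d, ∃ (Q : RankedPoset d) (g : P.Alg ↪[LSC] Q.Alg),
      ∀ (φ) (hφ : φ ∈ F) (v : Fin φ.1 → P.Alg), φ.2.Realize default (g ∘ v) := by
    intro P
    have : Finite F := hF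
    cases nonempty_fintype (Σ φ : F, (Fin φ.1.1 → P.Alg))
    obtain ⟨Q, g, hg⟩ := exists_realize_list hup hstep P Finset.univ.toList
    exact ⟨Q, g, fun φ hφ v => hg ⟨⟨φ, hφ⟩, v⟩ (by simp)⟩
  choose next g hg using hnext
  let ch : ℕ → RankedPoset d := fun n => Nat.rec (motive := fun _ => RankedPoset d) P (fun _ Q => next Q) n
  let f : ∀ n, (ch n).Alg ↪[LSC] (ch (n + 1)).Alg := fun n => g (ch n)
  let M := Language.DirectLimit (fun n => (ch n).Alg) fun i j h => DirectedSystem.natLERec f i j h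
  let o : ∀ n, (ch n).Alg ↪[LSC] M := Language.DirectLimit.of LSC ℕ (fun n => (ch n).Alg)
    (fun i j h => DirectedSystem.natLERec f i j h)
  have hof : ∀ n x, o (n + 1) (f n x) = o n x := by
    intro n x
    refine Eq.trans ?_ (Language.DirectLimit.of_f (hij := Nat.le_succ n))
    congr 1
    simp [Nat.leRecOn_succ', DirectedSystem.coe_natLERec]
  have ho : ∀ {n : ℕ} (v : Fin n → M), ∃ i y, v = o i ∘ y := fun v =>
    Language.DirectLimit.exists_quotient_mk'_sigma_mk'_eq _ _ v
  refine ⟨M, inferInstance, ?_, ?_, ⟨o 0⟩, ?_⟩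
  · have hc : ∀ n, Countable (ch n).Alg := fun n => RankedPoset.countable_alg (ch n)
    have hc' : Countable (Σ n, (ch n).Alg) := instCountableSigma
    refine @Function.Surjective.countable _ _ hc' (fun x => o x.1 x.2) fun z => ?_
    obtain ⟨i, x, h⟩ := Language.DirectLimit.exists_of z
    exact ⟨⟨i, x⟩, h⟩
  · rw [← models_subscaledAxiomsTheory_iff, Theory.model_iff]
    intro φ hφ
    obtain ⟨ψ, hψ, rfl⟩ := exists_isQF_of_mem φ hφ
    refine BoundedFormula.realize_alls.2 fun v => ?_
    obtain ⟨i, y, rfl⟩ := ho v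
    have h1 := (models_subscaledAxiomsTheory_iff.2 (ch i).isSubscaled).realize_of_mem _ hφ
    have h2 := (hψ.realize_embedding (o i)).2 (BoundedFormula.realize_alls.1 h1 y)
    rwa [Subsingleton.elim (o i ∘ (default : Empty → (ch i).Alg)) default] at h2
  · intro φ hφ
    -- A tuple of the limit appears at some stage i, its instance is realized at stage i + 1, and
    -- this persists in the limit.
    refine BoundedFormula.realize_alls.2 fun v => ?_
    obtain ⟨i, y, rfl⟩ := ho v
    have h1 := hup φ hφ _ _ (o (i + 1)) _ (hg (ch i) φ hφ y)
    rwa [show o (i + 1) ∘ g (ch i) ∘ y = o i ∘ y from funext fun a => hof i (y a)] at h1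

end Chain

section Existence

variable {d : ℕ}

theorem exists_realize_splitFormula (P : RankedPoset d) (v : Fin 3 → P.Alg) :
    ∃ (Q : RankedPoset d) (g : P.Alg ↪[LSC] Q.Alg), splitFormula.Realize default (g ∘ v) := by
  by_cases hv : v 0 ⊔ v 1 ≤ v 2 \ (v 0 ⊔ v 1) ∧ v 2 ≠ ⊥
  · obtain ⟨hB, hA⟩ := hv
    have h1 : v 0 ≤ v 2 := (le_sup_left.trans hB).trans sdiff_le
    have h2 : v 1 ≤ v 2 := (le_sup_right.trans hB).trans sdiff_le
    have hs := SplitPoset.strictMono_rank (A := v 2) (B₁ := v 0) (B₂ := v 1) P.strictMono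
    refine ⟨⟨SplitPoset (v 2) (v 0) (v 1), inferInstance, inferInstance, SplitPoset.rank, hs,
      fun p => P.rank_le _⟩, (SplitPoset.isPMap h2).embedding hs, ?_⟩
    rw [realize_splitFormula Down.compatible]
    intro _ _
    refine ⟨SplitPoset.half _ _ _ false, SplitPoset.half _ _ _ true, SplitPoset.half_ne_bot hB hA _,
      SplitPoset.half_ne_bot hB hA _, ?_, ?_, SplitPoset.half_eq h2 hB false,
      SplitPoset.half_eq h2 hB true, ?_⟩
    · intro p (hp : p.1.1 ∈ v 0)
      refine ⟨h1 hp, Or.inl ?_⟩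
      by_contra h
      exact (p.2.2 (by simpa using h)).2 hp
    · intro p (hp : p.1.1 ∈ v 1)
      refine ⟨h2 hp, ?_⟩
      by_cases h : p.1.2 = false
      · exact Or.inr ⟨p.2.1 h hp, hp⟩
      · exact Or.inl (by simpa using h)
    · refine Down.ext fun p => ⟨?_, ?_⟩
      · rintro ⟨⟨-, h | h⟩, ⟨-, h' | h'⟩⟩
        · rw [h] at h'; cases h'
        · exact h'
        · exact h
        · exact h
      · rintro ⟨h, h'⟩
        exact ⟨⟨h1 h, Or.inr ⟨h, h'⟩⟩, ⟨h1 h, Or.inr ⟨h, h'⟩⟩⟩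
  · refine ⟨P, Embedding.refl LSC _, ?_⟩
    rw [realize_splitFormula Down.compatible]
    intro h1 h2
    exact absurd ⟨h1, h2⟩ hv

/-- If q = p the larger element is a witness. If the smaller one has a point of rank at least q, its
purity forces r = q and it is a witness itself. Otherwise new points are inserted. -/
theorem exists_realize_catFormula {r q p : ℕ} (hrq : r ≤ q) (hqp : q ≤ p) (P : RankedPoset d)
    (v : Fin 2 → P.Alg) :
    ∃ (Q : RankedPoset d) (g : P.Alg ↪[LSC] Q.Alg),
      (catFormula r q p).Realize default (g ∘ v) := by
  have same : (∃ b, b ≠ ⊥ ∧ Pure compOp q b ∧ v 0 ≤ b ∧ b ≤ v 1) →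
      ∃ (Q : RankedPoset d) (g : P.Alg ↪[LSC] Q.Alg),
        (catFormula r q p).Realize default (g ∘ v) := by
    intro h
    refine ⟨P, Embedding.refl LSC _, ?_⟩
    rw [realize_catFormula Down.compatible]
    exact fun _ _ _ _ => h
  by_cases hv : v 0 ≤ v 1 ∧ v 1 ≠ ⊥ ∧ Pure compOp r (v 0) ∧ Pure compOp p (v 1)
  · obtain ⟨h1, h2, h3, h4⟩ := hv
    rcases hqp.eq_or_lt with rfl | hqp
    · exact same ⟨v 1, h2, h4, h1, le_rfl⟩
    by_cases hC : ∀ x ∈ v 0, P.rank x < q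
    · obtain ⟨K, hK, _, δ', g, hs, hd, B, hB⟩ :=
        exists_cat_extension P.strictMono P.rank_le hqp hC h1 h2 h4
      refine ⟨⟨K, hK, inferInstance, δ', hs, hd⟩, g, ?_⟩
      rw [realize_catFormula Down.compatible]
      exact fun _ _ _ _ => ⟨B, hB⟩
    · push Not at hC
      obtain ⟨x, hx, hqx⟩ := hC
      obtain ⟨l, hl, -, hlr⟩ := (Down.pure_iff P.strictMono).1 h3 x hx
      have := P.strictMono.monotone hl
      have hrq' : r = q := by omega
      subst hrq'
      exact same ⟨v 0, Down.ne_bot_iff.2 ⟨x, hx⟩, h3, le_rfl, h1⟩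
  · refine ⟨P, Embedding.refl LSC _, ?_⟩
    rw [realize_catFormula Down.compatible]
    intro h1 h2 h3 h4
    exact absurd ⟨h1, h2, h3, h4⟩ hv

/-- Every finite ranked poset gives rise to a countable super scaled lattice. -/
theorem exists_superScaled (P : RankedPoset d) :
    ∃ (M : Type) (_ : LSC.Structure M), Countable M ∧ IsSuperScaled d M ∧
      Nonempty (P.Alg ↪[LSC] M) := by
  let F : Set (Σ n, LSC.BoundedFormula Empty n) :=
    insert ⟨3, splitFormula⟩ ((fun i : ℕ × ℕ × ℕ => ⟨2, catFormula i.1 i.2.1 i.2.2⟩) ''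
      {i | i.1 ≤ i.2.1 ∧ i.2.1 ≤ i.2.2 ∧ i.2.2 ≤ d})
  have hF : F.Finite := by
    refine Set.Finite.insert _ (Set.Finite.image _ (finite_catIndex d))
  obtain ⟨M, hM, hM1, hM2, hM3, hM4⟩ := exists_model_of_realize (d := d) hF (by
      rintro _ (rfl | ⟨i, -, rfl⟩)
      · exact upward_splitFormula
      · exact upward_catFormula _ _ _) (by
      rintro _ (rfl | ⟨i, hi, rfl⟩) P v
      · exact exists_realize_splitFormula P v
      · exact exists_realize_catFormula hi.1 hi.2.1 P v) P
  refine ⟨M, hM, hM1, ?_, hM3⟩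
  rw [← models_superAxiomsTheory_iff, Theory.model_iff]
  have h0 := models_subscaledAxiomsTheory_iff.2 hM2
  rintro φ ((hφ | rfl | ⟨i, hi, rfl⟩) | hφ)
  · exact h0.realize_of_mem _ (Or.inl hφ)
  · exact hM4 ⟨3, splitFormula⟩ (Or.inl rfl)
  · exact hM4 ⟨2, catFormula i.1 i.2.1 i.2.2⟩ (Or.inr ⟨i, hi, rfl⟩)
  · exact h0.realize_of_mem _ (Or.inr hφ)

end Existence

end Subscaled

namespace Subscaled

variable {d : ℕ}

/-! ### Back-and-forth between super scaled lattices -/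

section BackAndForth

theorem exists_ranked_embedding {M : Type*} [LSC.Structure M] (hM : IsSubscaled d M) (ι : Type)
    [Fintype ι] (g : ι → M) :
    ∃ (P : RankedPoset d) (e : P.Alg ↪[LSC] M),
      Nat.card P.carrier ≤ sizeBound (d + 1) (Fintype.card ι) ∧ ∃ v : ι → P.Alg, ⇑e ∘ v = g := by
  obtain ⟨J, hJ, hJ', δ, e, h1, h2, h3, h4⟩ := exists_down_embedding hM ι g
  choose v hv using h4
  exact ⟨⟨J, inferInstance, hJ', δ, h1, h2⟩, e, by simpa [Nat.card_eq_fintype_card] using h3, v,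
    funext hv⟩

theorem exists_ranked_equiv {M : Type*} [LSC.Structure M] (hM : IsSubscaled d M)
    (hfg : Structure.FG LSC M) : ∃ P : RankedPoset d, Nonempty (P.Alg ≃[LSC] M) := by
  obtain ⟨J, hJ, hJ', δ, h1, h2, h3⟩ := exists_down_equiv hM hfg
  exact ⟨⟨J, hJ, hJ', δ, h1, h2⟩, h3⟩

/-- An embedding factors through every embedding whose range is large enough. -/
theorem exists_factor {A B M : Type*} [LSC.Structure A] [LSC.Structure B] [LSC.Structure M]
    (i : A ↪[LSC] M) (e : B ↪[LSC] M) (h : ∀ a, ∃ b, e b = i a) :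
    ∃ k : A ↪[LSC] B, ∀ a, e (k a) = i a := by
  choose k hk using h
  refine ⟨⟨⟨k, fun a b hab => i.injective (by rw [← hk, hab, hk])⟩, fun f x => ?_,
    fun r => Empty.elim r⟩, hk⟩
  apply e.injective
  change e (k _) = _
  rw [hk, i.map_fun, e.map_fun]
  congr 1
  exact (funext fun j => hk (x j)).symm

/-- A finite subalgebra and a further element lie in a finite subalgebra of bounded size. -/
theorem exists_ranked_extension {M : Type*} [LSC.Structure M] (hM : IsSubscaled d M)
    (P : RankedPoset d) (i : P.Alg ↪[LSC] M) (m : M) :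
    ∃ (Q : RankedPoset d) (e : Q.Alg ↪[LSC] M) (k : P.Alg ↪[LSC] Q.Alg),
      Nat.card Q.carrier ≤ sizeBound (d + 1) (Nat.card P.carrier + 1) ∧
        (∀ A, e (k A) = i A) ∧ ∃ B, e B = m := by
  cases nonempty_fintype P.carrier
  obtain ⟨Q, e, hcard, v, hv⟩ := exists_ranked_embedding hM (Option P.carrier)
    fun o => o.elim m fun j => i (Down.principal P.rank j)
  -- The generators are the images of the principal lower sets, one per point of P, and m; all other
  -- elements of the algebra are joins of principal ones.
  obtain ⟨k, hk⟩ := exists_factor i e fun A => by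
    obtain ⟨_, hc, -⟩ := hM
    refine ⟨supOn (fun j => v (some j)) (· ∈ A), ?_⟩
    rw [map_supOn Down.compatible hc]
    conv_rhs => rw [Down.eq_supOn A, map_supOn Down.compatible hc]
    congr 1
    exact funext fun j => congrFun hv (some j)
  exact ⟨Q, e, k, by simpa [Nat.card_eq_fintype_card] using hcard, hk, v none, congrFun hv none⟩

theorem exists_alg_extension {N : Type*} [LSC.Structure N] (hN : IsSuperScaled d N)
    {P Q : RankedPoset d} (e : P.Alg ↪[LSC] N) (g : P.Alg ↪[LSC] Q.Alg) :
    ∃ e' : Q.Alg ↪[LSC] N, ∀ A, e' (g A) = e A :=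
  exists_embedding_extension hN P.strictMono Q.strictMono e g

/-- Embeddings of a finite algebra into super scaled lattices satisfy the same formulas. -/
theorem realize_iff {M N : Type*} [LSC.Structure M] [LSC.Structure N] (hM : IsSuperScaled d M)
    (hN : IsSuperScaled d N) {α : Type*} {n : ℕ} (φ : LSC.BoundedFormula α n) (P : RankedPoset d)
    (i : P.Alg ↪[LSC] M) (j : P.Alg ↪[LSC] N) (v : α → P.Alg) (xs : Fin n → P.Alg) :
    φ.Realize (i ∘ v) (i ∘ xs) ↔ φ.Realize (j ∘ v) (j ∘ xs) := by
  induction φ generalizing P with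
  | falsum => exact Iff.rfl
  | equal s t =>
    exact ((BoundedFormula.IsAtomic.equal s t).isQF.realize_embedding i).trans
      ((BoundedFormula.IsAtomic.equal s t).isQF.realize_embedding j).symm
  | rel r _ => exact Empty.elim r
  | imp φ ψ ih1 ih2 => exact imp_congr (ih1 P i j v xs) (ih2 P i j v xs)
  | all φ ih =>
    constructor
    · intro h m
      -- The new element and the old algebra lie in a finite algebra inside N. It embeds into M over
      -- the old algebra, where the induction hypothesis applies to it.
      obtain ⟨Q, e, k, -, hk, B, rfl⟩ := exists_ranked_extension hN.isSubscaled P j m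
      obtain ⟨e', he'⟩ := exists_alg_extension hM i k
      have h1 := (ih Q e' e (k ∘ v) (Fin.snoc (k ∘ xs) B)).1 (by
        rw [Fin.comp_snoc]
        convert h (e' B) using 2
        · exact funext fun a => he' (v a)
        · exact funext fun a => he' (xs a))
      rw [Fin.comp_snoc] at h1
      convert h1 using 2
      · exact funext fun a => (hk (v a)).symm
      · exact funext fun a => (hk (xs a)).symm
    · intro h m
      obtain ⟨Q, e, k, -, hk, B, rfl⟩ := exists_ranked_extension hM.isSubscaled P i m
      obtain ⟨e', he'⟩ := exists_alg_extension hN j k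
      have h1 := (ih Q e e' (k ∘ v) (Fin.snoc (k ∘ xs) B)).2 (by
        rw [Fin.comp_snoc]
        convert h (e' B) using 2
        · exact funext fun a => he' (v a)
        · exact funext fun a => he' (xs a))
      rw [Fin.comp_snoc] at h1
      convert h1 using 2
      · exact funext fun a => (hk (v a)).symm
      · exact funext fun a => (hk (xs a)).symm

theorem formula_realize_iff {M N : Type*} [LSC.Structure M] [LSC.Structure N]
    (hM : IsSuperScaled d M) (hN : IsSuperScaled d N) {α : Type*} (φ : LSC.Formula α)
    (P : RankedPoset d) (i : P.Alg ↪[LSC] M) (j : P.Alg ↪[LSC] N) (v : α → P.Alg) :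
    φ.Realize (i ∘ v) ↔ φ.Realize (j ∘ v) := by
  have := realize_iff hM hN φ P i j v default
  rwa [Subsingleton.elim (i ∘ default) default, Subsingleton.elim (j ∘ default) default] at this

theorem elementarilyEquivalent_of_embedding {M N : Type u} [LSC.Structure M] [LSC.Structure N]
    (hM : IsSuperScaled d M) (hN : IsSuperScaled d N) (P : RankedPoset d) (i : P.Alg ↪[LSC] M)
    (j : P.Alg ↪[LSC] N) : M ≅[LSC] N := by
  rw [elementarilyEquivalent_iff]
  intro φ
  have := formula_realize_iff hM hN φ P i j default
  rwa [Subsingleton.elim (i ∘ default) default, Subsingleton.elim (j ∘ default) default] at this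

/-- Embeddings between super scaled lattices are elementary. -/
def elementaryEmbedding {M N : Type*} [LSC.Structure M] [LSC.Structure N] (hM : IsSuperScaled d M)
    (hN : IsSuperScaled d N) (f : M ↪[LSC] N) : M ↪ₑ[LSC] N where
  toFun := f
  map_formula' n φ x := by
    obtain ⟨P, e, -, v, rfl⟩ := exists_ranked_embedding hM.isSubscaled (Fin n) x
    exact (formula_realize_iff hM hN φ P e (f.comp e) v).symm

end BackAndForth

/-! ### Quantifier-free types determine types -/

section QuantifierFreeTypes

/-- An embedding of a structure generated by a tuple, given by a realization of the quantifier-free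
type of the tuple. -/
theorem exists_embedding_of_isQF {A N α : Type*} [LSC.Structure A] [LSC.Structure N] (v : α → A)
    (hv : Substructure.closure LSC (Set.range v) = ⊤) (b : α → N)
    (h : ∀ ψ : LSC.Formula α, ψ.IsQF → ψ.Realize v → ψ.Realize b) :
    ∃ f : A ↪[LSC] N, ∀ i, f (v i) = b i := by
  have hterm : ∀ a : A, ∃ t : LSC.Term α, t.realize v = a := by
    intro a
    obtain ⟨t, ht⟩ := Substructure.mem_closure_iff_exists_term.1
      (hv ▸ Substructure.mem_top a : a ∈ Substructure.closure LSC (Set.range v))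
    choose g hg using fun x : Set.range v => x.2
    refine ⟨t.relabel g, ?_⟩
    rw [Term.realize_relabel, ← ht]
    congr 1
    exact funext hg
  choose t ht using hterm
  have heq : ∀ s s' : LSC.Term α, s.realize v = s'.realize v → s.realize b = s'.realize b := by
    intro s s' hs
    have := h (s.equal s') (BoundedFormula.IsAtomic.equal _ _).isQF (by simpa using hs)
    simpa using this
  refine ⟨⟨⟨fun a => (t a).realize b, fun a a' haa => ?_⟩, fun f x => ?_, fun r => Empty.elim r⟩,
    fun i => ?_⟩
  · by_contra hne
    have := h (∼((t a).equal (t a'))) (BoundedFormula.IsAtomic.equal _ _).isQF.not (by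
      simpa [ht] using hne)
    simp at this
    exact this haa
  · exact heq (t _) (Term.func f fun i => t (x i)) (by simp [ht])
  · exact heq (t (v i)) (Term.var i) (by simp [ht])

theorem closure_range_eq_top {M α : Type*} [LSC.Structure M] (a : α → M) :
    Substructure.closure LSC (Set.range fun i =>
      (⟨a i, Substructure.subset_closure ⟨i, rfl⟩⟩ : Substructure.closure LSC (Set.range a))) = ⊤ := by
  refine eq_top_iff.2 fun x _ => ?_
  have h1 : x.1 ∈ (Substructure.closure LSC (Set.range fun i =>
      (⟨a i, Substructure.subset_closure ⟨i, rfl⟩⟩ : Substructure.closure LSC (Set.range a)))).map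
        (Substructure.closure LSC (Set.range a)).subtype.toHom := by
    rw [Substructure.map_closure, ← Set.range_comp]
    exact x.2
  obtain ⟨y, hy, hyx⟩ := h1
  rwa [← Subtype.ext hyx]

/-- In super scaled lattices a tuple has the same type as any other one with the same
quantifier-free type. -/
theorem realize_of_isQF {M N : Type*} {α : Type} [Finite α] [LSC.Structure M] [LSC.Structure N]
    (hM : IsSuperScaled d M) (hN : IsSuperScaled d N) (a : α → M) (b : α → N)
    (h : ∀ ψ : LSC.Formula α, ψ.IsQF → ψ.Realize a → ψ.Realize b) (φ : LSC.Formula α) :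
    φ.Realize a ↔ φ.Realize b := by
  set S := Substructure.closure LSC (Set.range a) with hS
  let a' : α → S := fun i => ⟨a i, Substructure.subset_closure ⟨i, rfl⟩⟩
  have ha' : Substructure.closure LSC (Set.range a') = ⊤ := closure_range_eq_top a
  obtain ⟨f, hf⟩ := exists_embedding_of_isQF a' ha' b fun ψ hψ hr => h ψ hψ (by
    have := (hψ.realize_embedding S.subtype (v := a') (xs := default)).2 hr
    rwa [Subsingleton.elim (S.subtype ∘ default) default] at this)
  obtain ⟨P, ⟨e⟩⟩ := exists_ranked_equiv (hM.isSubscaled.of_embedding S.subtype)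
    ((Substructure.fg_iff_structure_fg S).1 (Substructure.fg_closure (Set.finite_range a)))
  have := formula_realize_iff hM hN φ P (S.subtype.comp e.toEmbedding) (f.comp e.toEmbedding)
    (e.symm ∘ a')
  convert this using 2
  · exact funext fun i => by simp [a']
  · exact funext fun i => by simp [hf]

end QuantifierFreeTypes

/-! ### Finitely many ranked posets of bounded size -/

section Lists

/-- Isomorphic ranked posets have isomorphic algebras of lower sets. -/
theorem nonempty_equiv_of_orderIso {P Q : RankedPoset d} (f : Q.carrier ≃o P.carrier)
    (hf : ∀ k, P.rank (f k) = Q.rank k) : Nonempty (P.Alg ≃[LSC] Q.Alg) := by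
  have h : IsPMap Q.rank P.rank f := by
    refine ⟨f.monotone, fun k => (hf k).ge, fun k j hkj => ⟨f.symm j, ?_, by simp, ?_⟩, f.surjective⟩
    · rwa [← f.le_iff_le, f.apply_symm_apply]
    · rw [← hf, f.apply_symm_apply]
  refine ⟨equivOfSurjective (h.embedding Q.strictMono) fun B => ?_⟩
  refine ⟨Down.mk P.rank fun j => f.symm j ∈ B, Down.ext fun k => ?_⟩
  rw [h.mem_embedding]
  constructor
  · rintro ⟨l, h1, h2⟩
    exact Down.mem_of_le (f.le_symm_apply.2 h1) h2
  · intro hk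
    exact ⟨f k, le_rfl, by simpa using hk⟩

/-- There are finitely many ranked posets of bounded size, up to isomorphism. -/
theorem exists_finite_list (d b : ℕ) : ∃ (n : ℕ) (F : Fin n → RankedPoset d),
    ∀ P : RankedPoset d, Nat.card P.carrier ≤ b → ∃ i, Nonempty (P.Alg ≃[LSC] (F i).Alg) := by
  let X := Σ m : Fin (b + 1), {x : (Fin m → Fin m → Prop) × (Fin m → Fin (d + 1)) //
    ((∀ i, x.1 i i) ∧ (∀ i j k, x.1 i j → x.1 j k → x.1 i k) ∧ (∀ i j, x.1 i j → x.1 j i → i = j)) ∧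
      ∀ i j, x.1 i j → i ≠ j → x.2 i < x.2 j}
  let R : X → RankedPoset d := fun x =>
    let po : PartialOrder (Fin x.1) :=
      { le := x.2.1.1, lt := fun i j => x.2.1.1 i j ∧ ¬ x.2.1.1 j i, lt_iff_le_not_ge := fun _ _ => Iff.rfl, le_refl := x.2.2.1.1, le_trans := x.2.2.1.2.1, le_antisymm := x.2.2.1.2.2 }
    { carrier := Fin x.1
      finite := inferInstance
      partialOrder := po
      rank := fun i => x.2.1.2 i
      strictMono := fun i j hij => x.2.2.2 i j hij.le hij.ne
      rank_le := fun i => Nat.lt_succ_iff.1 (x.2.1.2 i).2 }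
  have : Finite X := inferInstance
  obtain ⟨n, ⟨e⟩⟩ := Finite.exists_equiv_fin X
  refine ⟨n, R ∘ e.symm, fun P hP => ?_⟩
  let f := Finite.equivFin P.carrier
  let x : X := ⟨⟨Nat.card P.carrier, Nat.lt_succ_of_le hP⟩,
    ⟨(fun i j => f.symm i ≤ f.symm j, fun i => ⟨P.rank (f.symm i),
      Nat.lt_succ_of_le (P.rank_le _)⟩), ⟨fun i => le_rfl, fun i j k => le_trans, fun i j h1 h2 =>
        f.symm.injective (le_antisymm h1 h2)⟩, fun i j h1 h2 =>
          P.strictMono (lt_of_le_of_ne h1 fun h => h2 (f.symm.injective h))⟩⟩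
  refine ⟨e x, ?_⟩
  rw [Function.comp_apply, e.symm_apply_apply]
  exact nonempty_equiv_of_orderIso (Q := R x) ⟨f.symm, Iff.rfl⟩ fun k => rfl

end Lists

end Subscaled

namespace Subscaled

variable {d : ℕ}

/-! ### Theories and their models in every universe -/

section Theories

/-- Axioms of a class of structures axiomatize its theory, in every universe. -/
theorem models_theoryOf_iff {K : (M : Type) → [LSC.Structure M] → Prop} {A : LSC.Theory}
    (hA : ∀ (M : Type) [LSC.Structure M], M ⊨ A ↔ K M) {M : Type u} [LSC.Structure M] :
    M ⊨ theoryOf K ↔ M ⊨ A := by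
  constructor
  · intro h
    refine ⟨fun φ hφ => h.realize_of_mem φ fun N _ hN => ?_⟩
    exact ((hA N).2 hN).realize_of_mem φ hφ
  · intro h
    -- The theory is defined by structures in the lowest universe; a small elementary substructure
    -- of M transfers the question there.
    obtain ⟨S, hS⟩ := exists_small_elementarySubstructure LSC M
    let _ : LSC.Structure (Shrink.{0} S) := (equivShrink S).inducedStructure
    have e : S ≃[LSC] Shrink.{0} S := (equivShrink S).inducedStructureEquiv
    have h1 : Shrink.{0} S ⊨ A := by
      refine ⟨fun φ hφ => (StrongHomClass.realize_sentence e φ).1 ?_⟩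
      exact (S.realize_sentence φ).2 (h.realize_of_mem φ hφ)
    refine ⟨fun φ hφ => ?_⟩
    rw [← S.realize_sentence φ, StrongHomClass.realize_sentence e φ]
    exact hφ _ ((hA _).1 h1)

theorem models_subscaledTheory_iff {M : Type u} [LSC.Structure M] :
    M ⊨ subscaledTheory d ↔ IsSubscaled d M :=
  (models_theoryOf_iff fun _ _ => models_subscaledAxiomsTheory_iff).trans
    models_subscaledAxiomsTheory_iff

theorem models_superTheory_iff {M : Type u} [LSC.Structure M] :
    M ⊨ superTheory d ↔ IsSuperScaled d M :=
  (models_theoryOf_iff fun _ _ => models_superAxiomsTheory_iff).trans models_superAxiomsTheory_iff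

theorem subscaledTheory_subset : subscaledTheory d ⊆ superTheory d :=
  fun _ hφ M _ hM => hφ M hM.isSubscaled

/-- The quantifier-free sentences that hold in `P`. -/
def qfTheory (P : Type*) [LSC.Structure P] : LSC.Theory := {φ | φ.IsQF ∧ P ⊨ φ}

theorem realize_sentence_iff_of_isQF {P M : Type*} [LSC.Structure P] [LSC.Structure M]
    (f : P ↪[LSC] M) {φ : LSC.Sentence} (hφ : φ.IsQF) : M ⊨ φ ↔ P ⊨ φ := by
  have := hφ.realize_embedding f (v := default) (xs := default)
  rwa [Subsingleton.elim (f ∘ default) default, Subsingleton.elim (f ∘ default) default] at this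

/-- All elements of P are values of closed terms, so quantifier-free sentences already describe the
diagram of P. -/
theorem models_qfTheory_iff {P M : Type*} [LSC.Structure P] [LSC.Structure M]
    (hP : Substructure.closure LSC (∅ : Set P) = ⊤) :
    M ⊨ qfTheory P ↔ Nonempty (P ↪[LSC] M) := by
  constructor
  · intro h
    obtain ⟨f, -⟩ := exists_embedding_of_isQF (A := P) (N := M) (α := Empty) default
      (by rwa [Set.range_eq_empty]) default fun ψ h1 h2 => h.realize_of_mem ψ ⟨h1, h2⟩
    exact ⟨f⟩
  · rintro ⟨f⟩
    exact ⟨fun φ hφ => (realize_sentence_iff_of_isQF f hφ.1).2 hφ.2⟩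

theorem models_superTheoryOver_iff {P : Type} [LSC.Structure P] (hP : IsPrimeSubscaled d P)
    {M : Type u} [LSC.Structure M] :
    M ⊨ superTheoryOver d P ↔ IsSuperScaled d M ∧ Nonempty (P ↪[LSC] M) := by
  have key : ∀ (M : Type u) [LSC.Structure M], M ⊨ superAxiomsTheory d ∪ qfTheory P ↔
      IsSuperScaled d M ∧ Nonempty (P ↪[LSC] M) := fun M _ => by
    rw [Theory.model_union_iff, models_superAxiomsTheory_iff, models_qfTheory_iff hP.2]
  refine (models_theoryOf_iff fun M _ => ?_).trans (key M)
  rw [Theory.model_union_iff, models_superAxiomsTheory_iff, models_qfTheory_iff hP.2]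

theorem models_of_realize {T : LSC.Theory} {φ : LSC.Sentence}
    (h : ∀ (M : Type) [LSC.Structure M], M ⊨ T → M ⊨ φ) : T ⊨ᵇ φ :=
  Theory.models_sentence_iff.2 fun M => h M M.is_model

theorem realize_of_models {T : LSC.Theory} {φ : LSC.Sentence} (h : T ⊨ᵇ φ) {M : Type*}
    [LSC.Structure M] (hM : M ⊨ T) : M ⊨ φ :=
  have : Nonempty M := ⟨zeroOp M⟩
  h.realize_sentence M

end Theories

/-! ### Prime lattices, completions, categoricity and prime models -/

section Prime

/-- The prime substructure of a structure. -/
abbrev Core (M : Type*) [LSC.Structure M] : Type _ := Substructure.closure LSC (∅ : Set M)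

theorem isPrimeSubscaled_core {M : Type*} [LSC.Structure M] (hM : IsSubscaled d M) :
    IsPrimeSubscaled d (Core M) := by
  refine ⟨hM.of_embedding (Substructure.subtype _), ?_⟩
  rw [eq_top_iff]
  rintro ⟨x, hx⟩ -
  rw [Substructure.closure_empty] at hx
  have h2 : (⊥ : LSC.Substructure M) ≤
      (Substructure.closure LSC (∅ : Set (Core M))).map (Substructure.subtype _).toHom := bot_le
  obtain ⟨y, hy, hyx⟩ := h2 hx
  have : y = ⟨x, by rwa [Substructure.closure_empty]⟩ := Subtype.ext hyx
  rwa [← this]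

theorem IsPrimeSubscaled.fg {P : Type*} [LSC.Structure P] (hP : IsPrimeSubscaled d P) :
    Structure.FG LSC P := ⟨⟨∅, by simpa using hP.2⟩⟩

theorem IsPrimeSubscaled.of_equiv {P Q : Type*} [LSC.Structure P] [LSC.Structure Q]
    (hP : IsPrimeSubscaled d P) (e : P ≃[LSC] Q) : IsPrimeSubscaled d Q := by
  refine ⟨hP.1.of_embedding e.symm.toEmbedding, ?_⟩
  rw [eq_top_iff]
  intro q _
  have h1 : Substructure.closure LSC (∅ : Set P) ≤
      (Substructure.closure LSC (∅ : Set Q)).comap e.toHom := by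
    rw [Substructure.closure_empty]; exact bot_le
  rw [hP.2] at h1
  have := h1 (Substructure.mem_top (e.symm q))
  simpa using this

/-- A prime subscaled lattice is an algebra of lower sets of bounded size. -/
theorem IsPrimeSubscaled.exists_ranked {P : Type*} [LSC.Structure P] (hP : IsPrimeSubscaled d P) :
    ∃ R : RankedPoset d, Nat.card R.carrier ≤ sizeBound (d + 1) 0 ∧ Nonempty (R.Alg ≃[LSC] P) := by
  obtain ⟨R, e, h1, -⟩ := exists_ranked_embedding hP.1 Empty Empty.elim
  exact ⟨R, by simpa using h1, ⟨equivOfSurjective e (surjective_of_closure e hP.2 (by simp))⟩⟩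

/-- There are finitely many prime subscaled lattices, up to isomorphism. -/
theorem exists_prime_list (d : ℕ) : ∃ (n : ℕ) (F : Fin n → RankedPoset d),
    (∀ i, IsPrimeSubscaled d (F i).Alg) ∧
      ∀ (P : Type u) [LSC.Structure P], IsPrimeSubscaled d P →
        ∃ i, Nonempty (P ≃[LSC] (F i).Alg) := by
  obtain ⟨n, F, hF⟩ := exists_finite_list d (sizeBound (d + 1) 0)
  obtain ⟨m, ⟨e⟩⟩ := Finite.exists_equiv_fin {i // IsPrimeSubscaled d (F i).Alg}
  refine ⟨m, fun j => F (e.symm j).1, fun j => (e.symm j).2, fun P _ hP => ?_⟩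
  obtain ⟨R, hR, ⟨f⟩⟩ := hP.exists_ranked
  obtain ⟨i, ⟨g⟩⟩ := hF R hR
  have hi : IsPrimeSubscaled d (F i).Alg := hP.of_equiv (g.comp f.symm)
  obtain ⟨j, rfl⟩ : ∃ j, (e.symm j).1 = i := ⟨e ⟨i, hi⟩, by simp⟩
  exact ⟨j, ⟨g.comp f.symm⟩⟩

theorem exists_superScaled_over {P : Type*} [LSC.Structure P] (hP : IsPrimeSubscaled d P) :
    ∃ (M : Type) (_ : LSC.Structure M), Countable M ∧ IsSuperScaled d M ∧
      Nonempty (P ↪[LSC] M) := by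
  obtain ⟨R, -, ⟨e⟩⟩ := hP.exists_ranked
  obtain ⟨M, hM, h1, h2, ⟨f⟩⟩ := exists_superScaled R
  exact ⟨M, hM, h1, h2, ⟨f.comp e.symm.toEmbedding⟩⟩

theorem elementarilyEquivalent_of_prime {P : Type*} [LSC.Structure P] (hP : IsPrimeSubscaled d P)
    {M N : Type u} [LSC.Structure M] [LSC.Structure N] (hM : IsSuperScaled d M)
    (hN : IsSuperScaled d N) (i : P ↪[LSC] M) (j : P ↪[LSC] N) : M ≅[LSC] N := by
  obtain ⟨R, -, ⟨e⟩⟩ := hP.exists_ranked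
  exact elementarilyEquivalent_of_embedding hM hN R (i.comp e.toEmbedding) (j.comp e.toEmbedding)

/-- Consistency is the existence of a countable super scaled lattice over P. Two models share the
finite algebra P, so the back-and-forth makes them elementarily equivalent. -/
theorem isComplete_superTheoryOver {P : Type} [LSC.Structure P] (hP : IsPrimeSubscaled d P) :
    (superTheoryOver d P).IsComplete := by
  rw [Theory.IsComplete.isComplete_iff_models_elementarily_equivalent]
  constructor
  · obtain ⟨M, hM, -, h2, h3⟩ := exists_superScaled_over hP
    have : M ⊨ superTheoryOver d P := (models_superTheoryOver_iff hP).2 ⟨h2, h3⟩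
    have : Nonempty M := ⟨zeroOp M⟩
    exact Theory.Model.isSatisfiable M
  · intro M N
    obtain ⟨hM, ⟨i⟩⟩ := (models_superTheoryOver_iff hP).1 M.is_model
    obtain ⟨hN, ⟨j⟩⟩ := (models_superTheoryOver_iff hP).1 N.is_model
    exact elementarilyEquivalent_of_prime hP hM hN i j

/-- A complete extension of the theory of super scaled lattices is given by a prime lattice. -/
theorem exists_prime_of_isComplete {T : LSC.Theory} (hT : superTheory d ⊆ T) (h : T.IsComplete) :
    ∃ (P : Type) (_ : LSC.Structure P), IsPrimeSubscaled d P ∧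
      ∀ φ : LSC.Sentence, T ⊨ᵇ φ ↔ superTheoryOver d P ⊨ᵇ φ := by
  obtain ⟨N⟩ := h.1
  have hN : IsSuperScaled d N := models_superTheory_iff.1 (N.is_model.mono hT)
  have hP := isPrimeSubscaled_core hN.isSubscaled
  have : N ⊨ superTheoryOver d (Core N) :=
    (models_superTheoryOver_iff hP).2 ⟨hN, ⟨Substructure.subtype _⟩⟩
  refine ⟨Core N, inferInstance, hP, fun φ => ?_⟩
  rw [← h.realize_sentence_iff φ N, (isComplete_superTheoryOver hP).realize_sentence_iff φ N]

/-- The finite partial isomorphism given by two embeddings. -/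
noncomputable def fgEquivOf {P M N : Type*} [LSC.Structure P] [LSC.Structure M] [LSC.Structure N]
    (hP : Structure.FG LSC P) (i : P ↪[LSC] M) (j : P ↪[LSC] N) : LSC.FGEquiv M N :=
  ⟨⟨i.toHom.range, j.toHom.range, j.equivRange.comp i.equivRange.symm⟩,
    hP.range i.toHom⟩

theorem structure_cg_of_countable {M : Type*} [LSC.Structure M] [Countable M] :
    Structure.CG LSC M := ⟨⟨Set.univ, Set.countable_univ, Substructure.closure_univ⟩⟩

/-- The extension property holds in both directions, so the isomorphism between the two copies of P
extends to the whole of two countable structures. -/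
theorem nonempty_equiv_of_countable {P : Type*} [LSC.Structure P] (hP : IsPrimeSubscaled d P)
    {M N : Type*} [LSC.Structure M] [LSC.Structure N] [Countable M] [Countable N]
    (hM : IsSuperScaled d M) (hN : IsSuperScaled d N) (i : P ↪[LSC] M) (j : P ↪[LSC] N) :
    Nonempty (M ≃[LSC] N) := by
  obtain ⟨f, -⟩ := equiv_between_cg structure_cg_of_countable structure_cg_of_countable
    (fgEquivOf hP.fg i j) (isExtensionPair hM.isSubscaled hN) (isExtensionPair hN.isSubscaled hM)
  exact ⟨f⟩

theorem nonempty_elementaryEmbedding_of_countable {P : Type*} [LSC.Structure P]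
    (hP : IsPrimeSubscaled d P) {M N : Type*} [LSC.Structure M] [LSC.Structure N] [Countable M]
    (hM : IsSuperScaled d M) (hN : IsSuperScaled d N) (i : P ↪[LSC] M) (j : P ↪[LSC] N) :
    Nonempty (M ↪ₑ[LSC] N) := by
  obtain ⟨f, -⟩ := embedding_from_cg structure_cg_of_countable
    (fgEquivOf hP.fg i j) (isExtensionPair hM.isSubscaled hN)
  exact ⟨elementaryEmbedding hM hN f⟩

theorem categorical_of_isComplete {T : LSC.Theory} (hT : superTheory d ⊆ T) (h : T.IsComplete) :
    Cardinal.Categorical Cardinal.aleph0.{0} T := by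
  intro M N hM hN
  obtain ⟨P, _, hP, hφ⟩ := exists_prime_of_isComplete hT h
  have key : ∀ K : T.ModelType, IsSuperScaled d K ∧ Nonempty (P ↪[LSC] K) := by
    intro K
    rw [← models_superTheoryOver_iff hP]
    exact ⟨fun φ h' => ((hφ φ).2 (Theory.models_sentence_of_mem h')).realize_sentence K⟩
  obtain ⟨hM', ⟨i⟩⟩ := key M
  obtain ⟨hN', ⟨j⟩⟩ := key N
  have : Countable M := Cardinal.mk_le_aleph0_iff.1 hM.le
  have : Countable N := Cardinal.mk_le_aleph0_iff.1 hN.le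
  exact nonempty_equiv_of_countable hP hM' hN' i j

theorem isPrimeModel_of_countable {P : Type*} [LSC.Structure P] (hP : IsPrimeSubscaled d P)
    {M : Type} [LSC.Structure M] [Countable M] (hM : IsSuperScaled d M) (i : P ↪[LSC] M) :
    IsPrimeModel (superTheory d) M := by
  refine ⟨models_superTheory_iff.2 hM, fun N _ hMN => ?_⟩
  have hN : IsSuperScaled d N := models_superTheory_iff.1
    ⟨fun φ hφ => ((elementarilyEquivalent_iff.1 hMN) φ).1
      ((models_superTheory_iff.2 hM).realize_of_mem φ hφ)⟩
  have h1 : N ⊨ qfTheory P := ⟨fun φ hφ => ((elementarilyEquivalent_iff.1 hMN) φ).1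
      (((models_qfTheory_iff hP.2).2 ⟨i⟩).realize_of_mem φ hφ)⟩
  obtain ⟨j⟩ := (models_qfTheory_iff hP.2).1 h1
  exact nonempty_elementaryEmbedding_of_countable hP hM hN i j

/-- One countable super scaled lattice over each prime lattice gives the list. A prime model embeds
into the member over its own prime substructure, so it is countable and isomorphic to that member.
-/
theorem exists_primeModel_list (d : ℕ) :
    ∃ (n : ℕ) (P : Fin n → Type) (_ : ∀ i, LSC.Structure (P i)),
      (∀ i, IsPrimeModel (superTheory d) (P i)) ∧
      (∀ (Q : Type) [LSC.Structure Q], IsPrimeModel (superTheory d) Q →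
          ∃ i, Nonempty (Q ≃[LSC] P i)) ∧
      ∀ (N : Type u) [LSC.Structure N], IsSuperScaled d N → ∃ i, Nonempty (P i ↪ₑ[LSC] N) := by
  -- Two lists are used because each classifies the prime lattices of one universe; the members of
  -- the first are small and are identified in the second.
  obtain ⟨n, F, hF, hlist⟩ := exists_prime_list.{u} d
  obtain ⟨n', F', hF', hlist'⟩ := exists_prime_list.{0} d
  have hcore : ∀ (N : Type u) [LSC.Structure N], IsSuperScaled d N →
      ∃ i, Nonempty ((F' i).Alg ↪[LSC] N) := by
    intro N _ hN
    obtain ⟨i, ⟨e⟩⟩ := hlist _ (isPrimeSubscaled_core hN.isSubscaled)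
    obtain ⟨i', ⟨e'⟩⟩ := hlist' _ (hF i)
    exact ⟨i', ⟨((Substructure.subtype _).comp e.symm.toEmbedding).comp e'.symm.toEmbedding⟩⟩
  choose M hM hM1 hM2 hM3 using fun i => exists_superScaled_over (hF' i)
  refine ⟨n', M, hM, fun i => ?_, fun Q _ hQ => ?_, fun N _ hN => ?_⟩
  · obtain ⟨f⟩ := hM3 i
    exact isPrimeModel_of_countable (hF' i) (hM2 i) f
  · have hQ' := models_superTheory_iff.1 hQ.1
    obtain ⟨i, ⟨e⟩⟩ := hlist' _ (isPrimeSubscaled_core hQ'.isSubscaled)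
    obtain ⟨f⟩ := hM3 i
    let j := (Substructure.subtype _).comp e.symm.toEmbedding
    obtain ⟨g⟩ := hQ.2 (M i) (elementarilyEquivalent_of_prime (hF' i) hQ' (hM2 i) j f)
    have : Countable Q := g.injective.countable
    exact ⟨i, nonempty_equiv_of_countable (hF' i) hQ' (hM2 i) j f⟩
  · obtain ⟨i, ⟨j⟩⟩ := hcore N hN
    obtain ⟨f⟩ := hM3 i
    exact ⟨i, nonempty_elementaryEmbedding_of_countable (hF' i) (hM2 i) hN f j⟩

end Prime

/-! ### Quantifier elimination -/

section QuantifierElimination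

theorem isQF_iInf {α β : Type} [Finite β] {f : β → LSC.Formula α} (h : ∀ b, (f b).IsQF) :
    (Formula.iInf f).IsQF := by
  have key : ∀ l : List β, ((l.map f).foldr (· ⊓ ·) ⊤ : LSC.BoundedFormula α 0).IsQF := by
    intro l
    induction l with
    | nil => exact BoundedFormula.IsQF.top
    | cons b l ih => exact (h b).inf ih
  exact key _

theorem isQF_iSup {α β : Type} [Finite β] {f : β → LSC.Formula α} (h : ∀ b, (f b).IsQF) :
    (Formula.iSup f).IsQF := by
  have key : ∀ l : List β, ((l.map f).foldr (· ⊔ ·) ⊥ : LSC.BoundedFormula α 0).IsQF := by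
    intro l
    induction l with
    | nil => exact BoundedFormula.IsQF.falsum
    | cons b l ih => exact (h b).sup ih
  exact key _

/-- By local finiteness, finitely many pairs of a finite algebra and an n-tuple in it represent all
n-tuples of models. Two pairs that disagree on φ are separated by a quantifier-free formula, and φ
is equivalent to the disjunction over positive pairs of the conjunction, over negative pairs, of the
separating formulas. -/
theorem eliminatesQuantifiers_superTheory (d : ℕ) : EliminatesQuantifiers (superTheory d) := by
  intro n φ
  obtain ⟨m, F, hF⟩ := exists_finite_list d (sizeBound (d + 1) n)
  choose M hM _ hM2 g using fun i => exists_superScaled (F i)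
  have g := fun i => (g i).some
  let S := Σ i, (Fin n → (F i).Alg)
  let Sat : S → LSC.Formula (Fin n) → Prop := fun s ψ => ψ.Realize (g s.1 ∘ s.2)
  have hsep : ∀ s t, Sat s φ → ¬ Sat t φ → ∃ ψ : LSC.Formula (Fin n),
      ψ.IsQF ∧ Sat s ψ ∧ ¬ Sat t ψ := by
    intro s t hs ht
    by_contra! hc
    exact ht ((realize_of_isQF (hM2 s.1) (hM2 t.1) _ _ hc φ).1 hs)
  let G := {s : S // Sat s φ}
  let B := {t : S // ¬ Sat t φ}
  choose ψ h1 h2 h3 using fun (s : G) (t : B) => hsep s.1 t.1 s.2 t.2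
  refine ⟨Formula.iSup fun s : G => Formula.iInf fun t : B => ψ s t,
    isQF_iSup fun s => isQF_iInf fun t => h1 s t, ?_⟩
  rw [Theory.models_formula_iff]
  intro N a
  have hN : IsSuperScaled d N := models_superTheory_iff.1 N.is_model
  obtain ⟨P, e, hP, v, rfl⟩ := exists_ranked_embedding hN.isSubscaled (Fin n) a
  obtain ⟨i, ⟨f⟩⟩ := hF P (by simpa using hP)
  let s : S := ⟨i, f ∘ v⟩
  have key : ∀ χ : LSC.Formula (Fin n), χ.Realize (e ∘ v) ↔ Sat s χ := by
    intro χ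
    have := formula_realize_iff hN (hM2 i) χ (F i) (e.comp f.symm.toEmbedding) (g i) (f ∘ v)
    convert this using 2
    exact funext fun j => by simp
  rw [Formula.realize_iff, Formula.realize_iSup, key]
  simp only [key, Sat, Formula.realize_iInf]
  constructor
  · exact fun h => ⟨⟨s, h⟩, fun t => h2 _ _⟩
  · rintro ⟨s', hs'⟩
    by_contra hc
    exact h3 s' ⟨s, hc⟩ (hs' _)

end QuantifierElimination

end Subscaled

/-! ### Embedding subscaled lattices in super scaled ones; model-completion -/

namespace Subscaled

variable {d : ℕ}

/-- Every subscaled lattice embeds in a super scaled lattice. -/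
theorem exists_superScaled_extension {M : Type u} [LSC.Structure M] (hM : IsSubscaled d M) :
    ∃ (N : Type u) (_ : LSC.Structure N), IsSuperScaled d N ∧ Nonempty (M ↪[LSC] N) := by
  classical
  have h1 : ∀ s : Finset M, ∃ (P : RankedPoset d) (e : P.Alg ↪[LSC] M), ∀ m ∈ s, ∃ A, e A = m := by
    intro s
    obtain ⟨P, e, -, v, hv⟩ := exists_ranked_embedding hM (Fin s.card)
      fun i => (s.equivFin.symm i : M)
    refine ⟨P, e, fun m hm => ⟨v (s.equivFin ⟨m, hm⟩), (congrFun hv _).trans ?_⟩⟩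
    simp
  choose P e he using h1
  choose N hN _ hN2 g using fun s => exists_superScaled (P s)
  have g := fun s => (g s).some
  -- For almost all finite subsets s, the finite algebra chosen for s contains any given finite set
  -- of elements.
  let U : Ultrafilter (Finset M) := Ultrafilter.of Filter.atTop
  have hU : ∀ t : Finset M, ∀ᶠ s in (U : Filter (Finset M)), t ⊆ s := fun t =>
    (Filter.eventually_ge_atTop t).filter_mono (Ultrafilter.of_le _)
  have : ∀ s, Nonempty (N s) := fun s => ⟨zeroOp (N s)⟩
  -- The coordinate of m at s is its image in N s when the algebra of s contains m. The default
  -- value is irrelevant, being used only on a negligible set of s.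
  let h : M → ∀ s, N s := fun m s =>
    if hm : ∃ A, e s A = m then g s hm.choose else zeroOp (N s)
  have hh : ∀ s A, h (e s A) s = g s A := by
    intro s A
    have hm : ∃ B, e s B = e s A := ⟨A, rfl⟩
    simp only [h, dif_pos hm]
    rw [(e s).injective hm.choose_spec]
  refine ⟨(U : Filter (Finset M)).Product N, inferInstance, ?_,
    ⟨⟨⟨fun m => (h m : (U : Filter (Finset M)).Product N), fun m m' hmm => ?_⟩, fun {n} F x => ?_,
      fun r => Empty.elim r⟩⟩⟩
  · rw [← models_superAxiomsTheory_iff]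
    refine ⟨fun φ hφ => ?_⟩
    rw [Ultraproduct.sentence_realize]
    exact Filter.Eventually.of_forall fun s =>
      (models_superAxiomsTheory_iff.2 (hN2 s)).realize_of_mem φ hφ
  · have h2 : ∀ᶠ s in (U : Filter (Finset M)), h m s = h m' s := Quotient.exact hmm
    obtain ⟨s, hs1, hs2⟩ := (h2.and (hU {m, m'})).exists
    obtain ⟨A, rfl⟩ := he s m (hs2 (by simp))
    obtain ⟨A', rfl⟩ := he s m' (hs2 (by simp))
    rw [hh, hh] at hs1
    rw [(g s).injective hs1]
  · refine Eq.trans ?_ (Ultraproduct.funMap_cast F (fun i => h (x i))).symm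
    refine Quotient.sound ?_
    refine (hU (Finset.univ.image x)).mono fun s hs => ?_
    choose A hA using fun i => he s (x i) (hs (Finset.mem_image_of_mem x (Finset.mem_univ i)))
    have e1 : x = e s ∘ A := funext fun i => (hA i).symm
    change h (Structure.funMap F x) s = Structure.funMap F fun i => h (x i) s
    have e2 : (fun i => h (x i) s) = g s ∘ A := funext fun i => by rw [← hA, hh]; rfl
    rw [e2, e1, ← (e s).map_fun, hh, (g s).map_fun]

theorem realize_func_con {M : Type*} {K : Type*} [LSC[[M]].Structure K] [LSC.Structure K]
    [(LSC.lhomWithConstants M).IsExpansionOn K] {n : ℕ} (F : LSC.Functions n) (x : Fin n → M) :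
    (Term.func ((LSC.lhomWithConstants M).onFunction F) fun i => (LSC.con (x i)).term :
      LSC[[M]].Term Empty).realize (default : Empty → K) =
        Structure.funMap F fun i => (LSC.con (x i) : K) := by
  rw [Term.realize_func, LHom.map_onFunction]
  congr 1
  funext i
  exact Term.realize_constants

/-- A model of the diagram of `M` is an extension of `M`. -/
theorem exists_embedding_of_diagram {M : Type u} [LSC.Structure M] {N : Type*}
    [LSC[[M]].Structure N] [LSC.Structure N] [(LSC.lhomWithConstants M).IsExpansionOn N]
    (h : N ⊨ diagram LSC M) : ∃ f : M ↪[LSC] N, ∀ m, f m = (LSC.con m : N) := by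
  have heq : ∀ s t : LSC[[M]].Term Empty,
      s.realize (default : Empty → M) = t.realize default →
        s.realize (default : Empty → N) = t.realize default := by
    intro s t hst
    have := h.realize_of_mem (s.equal t) ⟨(BoundedFormula.IsAtomic.equal _ _).isQF,
      (Formula.realize_equal (x := default)).2 hst⟩
    exact (Formula.realize_equal (x := default)).1 this
  refine ⟨⟨⟨fun m => (LSC.con m : N), fun m m' hmm => ?_⟩, fun {n} F x => ?_,
    fun r => Empty.elim r⟩, fun m => rfl⟩
  · by_contra hne
    have := h.realize_of_mem (∼((LSC.con m).term.equal (LSC.con m').term))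
      ⟨(BoundedFormula.IsAtomic.equal _ _).isQF.not, fun h' => hne (by
        have h2 := (Formula.realize_equal (x := default)).1 h'
        rwa [Term.realize_constants, Term.realize_constants] at h2)⟩
    refine this ((Formula.realize_equal (x := default)).2 ?_)
    rw [Term.realize_constants, Term.realize_constants]
    exact hmm
  · have := heq (LSC.con (Structure.funMap F x)).term
      (Term.func ((LSC.lhomWithConstants M).onFunction F) fun i => (LSC.con (x i)).term) (by
        rw [realize_func_con, Term.realize_constants]
        rfl)
    rw [realize_func_con, Term.realize_constants] at this
    exact this

/-- Consistency comes from a super scaled extension of M. For completeness, a sentence mentions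
finitely many constants from M; these lie in a finite subalgebra, and the back-and-forth over it
compares any two models. -/
theorem isModelCompletion_superTheory (d : ℕ) :
    IsModelCompletion.{u} (subscaledTheory d) (superTheory d) := by
  refine ⟨fun φ hφ => Theory.models_sentence_of_mem (subscaledTheory_subset hφ),
    fun M _ _ hM => ?_⟩
  rw [models_subscaledTheory_iff] at hM
  rw [Theory.IsComplete.isComplete_iff_models_elementarily_equivalent]
  constructor
  · obtain ⟨N, _, hN, ⟨f⟩⟩ := exists_superScaled_extension hM
    let _ : (constantsOn M).Structure N := constantsOn.structure f
    let f' : M ↪[LSC[[M]]] N :=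
      { toFun := f
        inj' := f.injective
        map_fun' := by
          rintro n (F | c) x
          · exact f.map_fun F x
          · cases n with
            | zero => rfl
            | succ n => exact PEmpty.elim c
        map_rel' := by
          rintro n (r | r) x
          · exact Empty.elim r
          · exact isEmptyElim (α := (constantsOn M).Relations n) r }
    have : N ⊨ (LSC.lhomWithConstants M).onTheory (superTheory d) ∪ diagram LSC M := by
      rw [Theory.model_union_iff]
      refine ⟨(LHom.onTheory_model _ _).2 (models_superTheory_iff.2 hN), ⟨fun φ hφ => ?_⟩⟩
      have := (hφ.1.realize_embedding f' (v := default) (xs := default)).2 hφ.2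
      rwa [Subsingleton.elim (f' ∘ default) default, Subsingleton.elim (f' ∘ default) default]
        at this
    have : Nonempty N := ⟨zeroOp N⟩
    exact Theory.Model.isSatisfiable N
  · intro N₁ N₂
    rw [elementarilyEquivalent_iff]
    intro φ
    let _ := (LSC.lhomWithConstants M).reduct N₁
    let _ := (LSC.lhomWithConstants M).reduct N₂
    obtain ⟨h1, h1'⟩ := Theory.model_union_iff.1 N₁.is_model
    obtain ⟨h2, h2'⟩ := Theory.model_union_iff.1 N₂.is_model
    have hN₁ : IsSuperScaled d N₁ := models_superTheory_iff.1 ((LHom.onTheory_model _ _).1 h1)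
    have hN₂ : IsSuperScaled d N₂ := models_superTheory_iff.1 ((LHom.onTheory_model _ _).1 h2)
    obtain ⟨f₁, hf₁⟩ := exists_embedding_of_diagram h1'
    obtain ⟨f₂, hf₂⟩ := exists_embedding_of_diagram h2'
    rw [← Formula.realize_equivSentence_symm_con N₁, ← Formula.realize_equivSentence_symm_con N₂]
    classical
    set ψ := Formula.equivSentence.symm φ
    let s := ψ.freeVarFinset
    obtain ⟨P, e, -, v, hv⟩ := exists_ranked_embedding hM (Fin s.card)
      fun i => (s.equivFin.symm i : M)
    let w : s → P.Alg := fun m => v (s.equivFin m)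
    have hw : ∀ m : s, e (w m) = m := fun m => (congrFun hv _).trans (by simp)
    have key := formula_realize_iff hN₁ hN₂ (ψ.restrictFreeVar id) P (f₁.comp e) (f₂.comp e) w
    refine Iff.trans ?_ (key.trans ?_)
    · refine (BoundedFormula.realize_restrictFreeVar _ fun m => ?_).symm
      simp [hw, hf₁]
    · refine BoundedFormula.realize_restrictFreeVar _ fun m => ?_
      simp [hw, hf₂]

end Subscaled

namespace Subscaled

/-! ### Primitive recursion along codes of trees -/

section TreeRecursion

variable {α σ : Type}

/-- Recursion on codes `Nat.pair t (Nat.pair a b)` and `Nat.pair t r`. -/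
def treeRec (d : σ) (g : α × ℕ × σ × σ × σ → σ) (x : α) (c : ℕ) : σ :=
  g (x, c, if _ : c.unpair.2 < c then treeRec d g x c.unpair.2 else d,
    if _ : c.unpair.2.unpair.1 < c then treeRec d g x c.unpair.2.unpair.1 else d,
    if _ : c.unpair.2.unpair.2 < c then treeRec d g x c.unpair.2.unpair.2 else d)
termination_by c

theorem lt_pair {t r : ℕ} (ht : 0 < t) : r < Nat.pair t r := by
  have := Nat.add_le_pair t r
  omega

/-- A positive tag makes the code exceed its argument and both halves of it, so the guards of the
recursion hold. Tag 0 is reserved for leaves, whose recursive values are never used. -/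
theorem treeRec_pair (d : σ) (g : α × ℕ × σ × σ × σ → σ) (x : α) {t r : ℕ} (ht : 0 < t) :
    treeRec d g x (Nat.pair t r) = g (x, Nat.pair t r, treeRec d g x r,
      treeRec d g x r.unpair.1, treeRec d g x r.unpair.2) := by
  have h := lt_pair (r := r) ht
  rw [treeRec]
  simp only [Nat.unpair_pair]
  rw [dif_pos h, dif_pos ((Nat.unpair_left_le r).trans_lt h),
    dif_pos ((Nat.unpair_right_le r).trans_lt h)]

theorem getD_map_range (f : ℕ → σ) (d : σ) (n a : ℕ) :
    ((List.range n).map f).getD a d = if a < n then f a else d := by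
  rw [List.getD_eq_getElem?_getD]
  by_cases h : a < n <;> simp [h]

/-- Course-of-values recursion: the history has length equal to the code, and looking up an index
out of range returns the default, exactly as a failed guard does. -/
theorem primrec_treeRec [Primcodable α] [Primcodable σ] (d : σ) {g : α × ℕ × σ × σ × σ → σ}
    (hg : Primrec g) : Primrec₂ (treeRec d g) := by
  have hu : Primrec Nat.unpair := Primrec.unpair
  refine Primrec.nat_strong_rec (treeRec d g) (g := fun x prev => some (g (x, prev.length,
    prev.getD prev.length.unpair.2 d, prev.getD prev.length.unpair.2.unpair.1 d,
    prev.getD prev.length.unpair.2.unpair.2 d))) ?_ ?_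
  · have hl : Primrec fun p : α × List σ => p.2.length := Primrec.list_length.comp Primrec.snd
    have hr : Primrec fun p : α × List σ => p.2.length.unpair.2 := Primrec.snd.comp (hu.comp hl)
    have ha : Primrec fun p : α × List σ => p.2.length.unpair.2.unpair.1 :=
      Primrec.fst.comp (hu.comp hr)
    have hb : Primrec fun p : α × List σ => p.2.length.unpair.2.unpair.2 :=
      Primrec.snd.comp (hu.comp hr)
    have hget := Primrec.list_getD d
    exact Primrec.option_some.comp (hg.comp (Primrec.fst.pair (hl.pair ((hget.comp Primrec.snd hr).pair
      ((hget.comp Primrec.snd ha).pair (hget.comp Primrec.snd hb))))))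
  · intro x n
    rw [treeRec]
    simp only [List.length_map, List.length_range, getD_map_range, dite_eq_ite]

end TreeRecursion

/-! ### Recognizing codes of terms and sentences -/

section Validity

/-- The maximum of two natural numbers, if both are defined. -/
def optMax (a b : Option ℕ) : Option ℕ := a.bind fun m => b.map (max m)

theorem optMax_eq_some {a b : Option ℕ} {m : ℕ} :
    optMax a b = some m ↔ ∃ i j, a = some i ∧ b = some j ∧ max i j = m := by
  cases a <;> cases b <;> simp [optMax]

theorem primrec_optMax : Primrec₂ optMax := by
  refine Primrec.option_bind Primrec.fst ?_
  refine Primrec.option_map (Primrec.snd.comp Primrec.fst) ?_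
  exact Primrec.nat_max.comp (Primrec.snd.comp Primrec.fst) Primrec.snd

/-- One step in the computation of `termArity`. -/
def termArityStep (p : Unit × ℕ × Option ℕ × Option ℕ × Option ℕ) : Option ℕ :=
  if p.2.1.unpair.1 = 0 then some (p.2.1.unpair.2 + 1)
  else if p.2.1.unpair.1 ≤ 2 then (if p.2.1.unpair.2 = 0 then some 0 else none)
  else if p.2.1.unpair.1 ≤ 5 then optMax p.2.2.2.1 p.2.2.2.2
  else if p.2.1.unpair.1 = 6 then p.2.2.2.2 else none

/-- The least number of variables for which a number is the code of a term. -/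
def termArity : ℕ → Option ℕ := treeRec none termArityStep ()

/-- One step in the computation of `arity`. -/
def arityStep (p : Unit × ℕ × Option ℕ × Option ℕ × Option ℕ) : Option ℕ :=
  if p.2.1.unpair.1 = 0 then (if p.2.1.unpair.2 = 0 then some 0 else none)
  else if p.2.1.unpair.1 = 1 then
    optMax (termArity p.2.1.unpair.2.unpair.1) (termArity p.2.1.unpair.2.unpair.2)
  else if p.2.1.unpair.1 = 2 then optMax p.2.2.2.1 p.2.2.2.2
  else if p.2.1.unpair.1 = 3 then p.2.2.1.map Nat.pred else none

/-- The least number of variables for which a number is the code of a formula. -/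
def arity : ℕ → Option ℕ := treeRec none arityStep ()

section Primrec

variable {α : Type} [Primcodable α]

theorem primrec_tag {f : α → ℕ} (hf : Primrec f) : Primrec fun x => (f x).unpair.1 :=
  Primrec.fst.comp (Primrec.unpair.comp hf)

theorem primrec_arg {f : α → ℕ} (hf : Primrec f) : Primrec fun x => (f x).unpair.2 :=
  Primrec.snd.comp (Primrec.unpair.comp hf)

theorem primrecPred_eq {f g : α → ℕ} (hf : Primrec f) (hg : Primrec g) :
    PrimrecPred fun x => f x = g x := Primrec.eq.comp hf hg

theorem primrecPred_le {f g : α → ℕ} (hf : Primrec f) (hg : Primrec g) :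
    PrimrecPred fun x => f x ≤ g x := Primrec.nat_le.comp hf hg

theorem primrec_termArity : Primrec termArity := by
  have hc : Primrec fun p : Unit × ℕ × Option ℕ × Option ℕ × Option ℕ => p.2.1 :=
    Primrec.fst.comp Primrec.snd
  have h4 : Primrec fun p : Unit × ℕ × Option ℕ × Option ℕ × Option ℕ => p.2.2.2.1 :=
    Primrec.fst.comp (Primrec.snd.comp (Primrec.snd.comp Primrec.snd))
  have h5 : Primrec fun p : Unit × ℕ × Option ℕ × Option ℕ × Option ℕ => p.2.2.2.2 :=
    Primrec.snd.comp (Primrec.snd.comp (Primrec.snd.comp Primrec.snd))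
  have ht := primrec_tag hc
  have hr := primrec_arg hc
  have : Primrec termArityStep :=
    Primrec.ite (primrecPred_eq ht (Primrec.const 0))
      (Primrec.option_some.comp (Primrec.succ.comp hr))
      (Primrec.ite (primrecPred_le ht (Primrec.const 2))
        (Primrec.ite (primrecPred_eq hr (Primrec.const 0)) (Primrec.const _) (Primrec.const _))
        (Primrec.ite (primrecPred_le ht (Primrec.const 5)) (primrec_optMax.comp h4 h5)
          (Primrec.ite (primrecPred_eq ht (Primrec.const 6)) h5 (Primrec.const _))))
  exact (primrec_treeRec none this).comp (Primrec.const ()) Primrec.id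

theorem primrec_arity : Primrec arity := by
  have hc : Primrec fun p : Unit × ℕ × Option ℕ × Option ℕ × Option ℕ => p.2.1 :=
    Primrec.fst.comp Primrec.snd
  have h3 : Primrec fun p : Unit × ℕ × Option ℕ × Option ℕ × Option ℕ => p.2.2.1 :=
    Primrec.fst.comp (Primrec.snd.comp Primrec.snd)
  have h4 : Primrec fun p : Unit × ℕ × Option ℕ × Option ℕ × Option ℕ => p.2.2.2.1 :=
    Primrec.fst.comp (Primrec.snd.comp (Primrec.snd.comp Primrec.snd))
  have h5 : Primrec fun p : Unit × ℕ × Option ℕ × Option ℕ × Option ℕ => p.2.2.2.2 :=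
    Primrec.snd.comp (Primrec.snd.comp (Primrec.snd.comp Primrec.snd))
  have ht := primrec_tag hc
  have hr := primrec_arg hc
  have : Primrec arityStep :=
    Primrec.ite (primrecPred_eq ht (Primrec.const 0))
      (Primrec.ite (primrecPred_eq hr (Primrec.const 0)) (Primrec.const _) (Primrec.const _))
      (Primrec.ite (primrecPred_eq ht (Primrec.const 1))
        (primrec_optMax.comp (primrec_termArity.comp (primrec_tag hr))
          (primrec_termArity.comp (primrec_arg hr)))
        (Primrec.ite (primrecPred_eq ht (Primrec.const 2)) (primrec_optMax.comp h4 h5)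
          (Primrec.ite (primrecPred_eq ht (Primrec.const 3))
            (Primrec.option_map h3 (Primrec.pred.comp Primrec.snd)) (Primrec.const _))))
  exact (primrec_treeRec none this).comp (Primrec.const ()) Primrec.id

end Primrec

theorem termArity_zero (r : ℕ) : termArity (Nat.pair 0 r) = some (r + 1) := by
  unfold termArity
  rw [treeRec]
  simp [termArityStep]

theorem termArity_pair {t r : ℕ} (ht : 0 < t) : termArity (Nat.pair t r) =
    if t ≤ 2 then (if r = 0 then some 0 else none)
    else if t ≤ 5 then optMax (termArity r.unpair.1) (termArity r.unpair.2)
    else if t = 6 then termArity r.unpair.2 else none := by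
  unfold termArity
  rw [treeRec_pair _ _ _ ht]
  simp [termArityStep, ht.ne']

theorem arity_zero (r : ℕ) : arity (Nat.pair 0 r) = if r = 0 then some 0 else none := by
  unfold arity
  rw [treeRec]
  simp [arityStep]

theorem arity_pair {t r : ℕ} (ht : 0 < t) : arity (Nat.pair t r) =
    if t = 1 then optMax (termArity r.unpair.1) (termArity r.unpair.2)
    else if t = 2 then optMax (arity r.unpair.1) (arity r.unpair.2)
    else if t = 3 then (arity r).map Nat.pred else none := by
  unfold arity
  rw [treeRec_pair _ _ _ ht]
  simp [arityStep, ht.ne']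

theorem exists_termArity {n : ℕ} (t : LSC.Term (Empty ⊕ Fin n)) :
    ∃ m, termArity (termCode t) = some m ∧ m ≤ n := by
  induction t with
  | var i =>
    rcases i with i | i
    · exact i.elim
    · exact ⟨i + 1, termArity_zero i, i.2⟩
  | func f ts ih =>
    cases f with
    | zero => exact ⟨0, by simp [termCode, funcCode, termArity_pair], Nat.zero_le n⟩
    | one => exact ⟨0, by simp [termCode, funcCode, termArity_pair], Nat.zero_le n⟩
    | join | meet | sub =>
      obtain ⟨i, hi, hi'⟩ := ih 0
      obtain ⟨j, hj, hj'⟩ := ih 1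
      exact ⟨max i j, by simp [termCode, funcCode, termArity_pair, hi, hj, optMax], by omega⟩
    | comp k =>
      obtain ⟨i, hi, hi'⟩ := ih 0
      exact ⟨i, by simp [termCode, funcCode, termArity_pair, hi], hi'⟩

theorem exists_term_of_arity {n : ℕ} (c : ℕ) : ∀ m, termArity c = some m → m ≤ n →
    ∃ t : LSC.Term (Empty ⊕ Fin n), termCode t = c := by
  induction c using Nat.strong_induction_on with
  | _ c ih =>
    intro m hm hmn
    obtain ⟨t, r, rfl⟩ : ∃ t r, Nat.pair t r = c := ⟨_, _, Nat.pair_unpair c⟩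
    rcases Nat.eq_zero_or_pos t with rfl | ht
    · rw [termArity_zero] at hm
      have h1 : r < n := by cases hm; omega
      exact ⟨Term.var (.inr ⟨r, h1⟩), rfl⟩
    · have hr := lt_pair (r := r) ht
      have ha := (Nat.unpair_left_le r).trans_lt hr
      have hb := (Nat.unpair_right_le r).trans_lt hr
      rw [termArity_pair ht] at hm
      split_ifs at hm with h1 h2 h3 h4
      · subst h2
        obtain rfl | rfl : t = 1 ∨ t = 2 := by omega
        · exact ⟨tZero, rfl⟩
        · exact ⟨tOne, rfl⟩
      · obtain ⟨i, j, hi, hj, rfl⟩ := optMax_eq_some.1 hm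
        obtain ⟨s, hs⟩ := ih _ ha i hi (by omega)
        obtain ⟨s', hs'⟩ := ih _ hb j hj (by omega)
        obtain rfl | rfl | rfl : t = 3 ∨ t = 4 ∨ t = 5 := by omega
        · refine ⟨tJoin s s', ?_⟩
          change Nat.pair 3 (Nat.pair (termCode s) (termCode s')) = _
          rw [hs, hs', Nat.pair_unpair]
        · refine ⟨tMeet s s', ?_⟩
          change Nat.pair 4 (Nat.pair (termCode s) (termCode s')) = _
          rw [hs, hs', Nat.pair_unpair]
        · refine ⟨tSub s s', ?_⟩
          change Nat.pair 5 (Nat.pair (termCode s) (termCode s')) = _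
          rw [hs, hs', Nat.pair_unpair]
      · subst h4
        obtain ⟨s, hs⟩ := ih _ hb m hm hmn
        refine ⟨tComp r.unpair.1 s, ?_⟩
        change Nat.pair 6 (Nat.pair r.unpair.1 (termCode s)) = _
        rw [hs, Nat.pair_unpair]

theorem exists_arity {n : ℕ} (φ : LSC.BoundedFormula Empty n) :
    ∃ m, arity (formulaCode φ) = some m ∧ m ≤ n := by
  induction φ with
  | falsum => exact ⟨0, by simp [formulaCode, arity_zero], Nat.zero_le _⟩
  | equal s t =>
    obtain ⟨i, hi, hi'⟩ := exists_termArity s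
    obtain ⟨j, hj, hj'⟩ := exists_termArity t
    exact ⟨max i j, by simp [formulaCode, arity_pair, hi, hj, optMax], by omega⟩
  | rel R _ => exact Empty.elim R
  | imp φ ψ ih1 ih2 =>
    obtain ⟨i, hi, hi'⟩ := ih1
    obtain ⟨j, hj, hj'⟩ := ih2
    exact ⟨max i j, by simp [formulaCode, arity_pair, hi, hj, optMax], by omega⟩
  | all φ ih =>
    obtain ⟨i, hi, hi'⟩ := ih
    exact ⟨i - 1, by simp [formulaCode, arity_pair, hi], by omega⟩

theorem exists_formula_of_arity (c : ℕ) : ∀ m n, arity c = some m → m ≤ n →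
    ∃ φ : LSC.BoundedFormula Empty n, formulaCode φ = c := by
  induction c using Nat.strong_induction_on with
  | _ c ih =>
    intro m n hm hmn
    obtain ⟨t, r, rfl⟩ : ∃ t r, Nat.pair t r = c := ⟨_, _, Nat.pair_unpair c⟩
    rcases Nat.eq_zero_or_pos t with rfl | ht
    · rw [arity_zero] at hm
      split_ifs at hm with h
      subst h
      exact ⟨.falsum, rfl⟩
    · have hr := lt_pair (r := r) ht
      have ha := (Nat.unpair_left_le r).trans_lt hr
      have hb := (Nat.unpair_right_le r).trans_lt hr
      rw [arity_pair ht] at hm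
      split_ifs at hm with h1 h2 h3
      · subst h1
        obtain ⟨i, j, hi, hj, rfl⟩ := optMax_eq_some.1 hm
        obtain ⟨s, hs⟩ := exists_term_of_arity (n := n) _ i hi (by omega)
        obtain ⟨s', hs'⟩ := exists_term_of_arity (n := n) _ j hj (by omega)
        refine ⟨.equal s s', ?_⟩
        rw [formulaCode, hs, hs', Nat.pair_unpair]
      · subst h2
        obtain ⟨i, j, hi, hj, rfl⟩ := optMax_eq_some.1 hm
        obtain ⟨φ, hφ⟩ := ih _ ha i n hi (by omega)
        obtain ⟨ψ, hψ⟩ := ih _ hb j n hj (by omega)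
        refine ⟨φ.imp ψ, ?_⟩
        rw [formulaCode, hφ, hψ, Nat.pair_unpair]
      · subst h3
        -- A quantifier binds one variable: the body needs at most n + 1 variables exactly when the
        -- predecessor of its arity is at most n.
        obtain ⟨i, hi, rfl⟩ := Option.map_eq_some_iff.1 hm
        obtain ⟨φ, hφ⟩ := ih _ hr i (n + 1) hi (by rw [Nat.pred_eq_sub_one] at hmn; omega)
        exact ⟨φ.all, by rw [formulaCode, hφ]⟩

theorem exists_sentence_iff (c : ℕ) :
    (∃ φ : LSC.Sentence, formulaCode φ = c) ↔ arity c = some 0 := by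
  constructor
  · rintro ⟨φ, rfl⟩
    obtain ⟨m, hm, hm'⟩ := exists_arity φ
    rw [hm, Nat.le_zero.1 hm']
  · intro h
    exact exists_formula_of_arity c 0 0 h le_rfl

end Validity

end Subscaled

namespace Subscaled

/-! ### Primitive recursive operations on lists -/

section PrimrecTools

variable {α β γ : Type} [Primcodable α] [Primcodable β] [Primcodable γ]

theorem primrecPred_forall {l : α → List β} {p : α → β → Prop} (hl : Primrec l)
    (hp : PrimrecPred fun q : α × β => p q.1 q.2) : PrimrecPred fun a => ∀ b ∈ l a, p a b := by
  have h : PrimrecRel fun (b : β) (a : α) => p a b :=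
    hp.comp (Primrec.snd.pair Primrec.fst)
  exact (PrimrecRel.forall_mem_list h).comp hl Primrec.id

theorem primrecPred_exists {l : α → List β} {p : α → β → Prop} (hl : Primrec l)
    (hp : PrimrecPred fun q : α × β => p q.1 q.2) : PrimrecPred fun a => ∃ b ∈ l a, p a b := by
  have h : PrimrecRel fun (b : β) (a : α) => p a b :=
    hp.comp (Primrec.snd.pair Primrec.fst)
  exact (PrimrecRel.exists_mem_list h).comp hl Primrec.id

theorem primrecPred_imp {p q : α → Prop} (hp : PrimrecPred p) (hq : PrimrecPred q) :
    PrimrecPred fun a => p a → q a :=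
  (hp.not.or hq).of_eq fun a => by tauto

theorem primrecPred_mem [DecidableEq β] {f : α → β} {l : α → List β} (hf : Primrec f)
    (hl : Primrec l) : PrimrecPred fun a => f a ∈ l a :=
  (primrecPred_exists (p := fun a b => b = f a) hl
    (Primrec.eq.comp Primrec.snd (hf.comp Primrec.fst))).of_eq fun a => by simp

theorem primrec_filter {l : α → List β} {p : α → β → Prop} [∀ a, DecidablePred (p a)]
    (hl : Primrec l) (hp : PrimrecPred fun q : α × β => p q.1 q.2) :
    Primrec fun a => (l a).filter fun b => decide (p a b) := by
  have h : PrimrecRel fun (b : β) (a : α) => p a b :=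
    hp.comp (Primrec.snd.pair Primrec.fst)
  let _ : DecidableRel fun (b : β) (a : α) => p a b := fun b a => inferInstance
  exact (PrimrecRel.listFilter h).comp hl Primrec.id

theorem primrec_sublists' : Primrec (List.sublists' : List α → List (List α)) := by
  have h : Primrec fun l : List α => l.foldr
      (fun a (s : List (List α)) => s ++ s.map (List.cons a)) [([] : List α)] := by
    refine Primrec.list_foldr
      (h := fun (_ : List α) (p : α × List (List α)) => p.2 ++ p.2.map (List.cons p.1)) Primrec.id
      (Primrec.const _) ?_
    have h2 : Primrec fun q : List α × (α × List (List α)) => q.2.2 :=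
      Primrec.snd.comp Primrec.snd
    exact Primrec.list_append.comp h2 (Primrec.list_map h2 (Primrec.list_cons.comp
      (Primrec.fst.comp (Primrec.snd.comp Primrec.fst)) Primrec.snd))
  refine h.of_eq fun l => ?_
  induction l with
  | nil => rfl
  | cons a l ih => rw [List.foldr_cons, ih, List.sublists'_cons]

theorem primrec_two_pow : Primrec fun n : ℕ => 2 ^ n := by
  have : Primrec fun n : ℕ => Nat.rec (motive := fun _ => ℕ) 1 (fun _ r => r * 2) n :=
    Primrec.nat_rec₁ 1 (Primrec.nat_mul.comp Primrec.snd (Primrec.const 2))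
  refine this.of_eq fun n => ?_
  induction n with
  | zero => rfl
  | succ n ih => rw [pow_succ, ← ih]

theorem primrec_sizeBound (k : ℕ) : Primrec (sizeBound k) := by
  induction k with
  | zero => exact (Primrec.const 0).of_eq fun _ => rfl
  | succ k ih =>
    exact (Primrec.nat_add.comp primrec_two_pow
      (ih.comp (primrec_two_pow.comp Primrec.succ))).of_eq fun _ => rfl

theorem sizeBound_mono (k : ℕ) : Monotone (sizeBound k) := by
  induction k with
  | zero => exact fun _ _ _ => le_rfl
  | succ k ih =>
    intro m n h
    exact Nat.add_le_add (Nat.pow_le_pow_right two_pos h)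
      (ih (Nat.pow_le_pow_right two_pos (Nat.succ_le_succ h)))

end PrimrecTools

/-! ### Coded ranked posets and the computation of truth -/

section States

/-- A finite ranked poset with a tuple of subsets: the elements, the order, and the tuple. An
element `Nat.pair k j` has rank `j % (d + 1)` and lies over the element `k` of another state. -/
abbrev State : Type := List ℕ × List (ℕ × ℕ) × List (List ℕ)

/-- The order of a state. -/
def Rel (x : State) (k l : ℕ) : Prop := (k, l) ∈ x.2.1

/-- The rank of an element of a state. -/
def rk (d e : ℕ) : ℕ := e.unpair.2 % (d + 1)

/-- The element below an element of a state. -/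
def pr (e : ℕ) : ℕ := e.unpair.1

/-- The state is a ranked poset. -/
def IsRanked (d : ℕ) (x : State) : Prop :=
  (∀ i ∈ x.1, Rel x i i) ∧
    (∀ i ∈ x.1, ∀ j ∈ x.1, ∀ k ∈ x.1, Rel x i j → Rel x j k → Rel x i k) ∧
      ∀ i ∈ x.1, ∀ j ∈ x.1, Rel x i j → i ≠ j → rk d i < rk d j

/-- The projection from `y` to `x` is a map of ranked posets. -/
def IsExt (d : ℕ) (x y : State) : Prop :=
  (∀ k ∈ y.1, pr k ∈ x.1 ∧ rk d k ≤ rk d (pr k)) ∧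
    (∀ k ∈ y.1, ∀ l ∈ y.1, Rel y k l → Rel x (pr k) (pr l)) ∧
      (∀ k ∈ y.1, ∀ j ∈ x.1, Rel x (pr k) j → ∃ l ∈ y.1, Rel y k l ∧ pr l = j ∧ rk d l = rk d j) ∧
        ∀ j ∈ x.1, ∃ k ∈ y.1, pr k = j

/-- Membership in the value of a term, from the values of its arguments. -/
def TermMem (d : ℕ) (p : State × ℕ × List ℕ × List ℕ × List ℕ) (k : ℕ) : Prop :=
  (p.2.1.unpair.1 = 0 ∧ ∃ l ∈ p.1.2.2.getD p.2.1.unpair.2 [], l ∈ p.1.1 ∧ Rel p.1 k l) ∨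
  p.2.1.unpair.1 = 2 ∨
  (p.2.1.unpair.1 = 3 ∧ (k ∈ p.2.2.2.1 ∨ k ∈ p.2.2.2.2)) ∨
  (p.2.1.unpair.1 = 4 ∧ k ∈ p.2.2.2.1 ∧ k ∈ p.2.2.2.2) ∨
  (p.2.1.unpair.1 = 5 ∧ ∃ l ∈ p.1.1, Rel p.1 k l ∧ l ∈ p.2.2.2.1 ∧ ¬ l ∈ p.2.2.2.2) ∨
  (p.2.1.unpair.1 = 6 ∧ ∃ l ∈ p.1.1, Rel p.1 k l ∧ l ∈ p.2.2.2.2 ∧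
    rk d l = p.2.1.unpair.2.unpair.1 ∧ ∀ m ∈ p.1.1, m ∈ p.2.2.2.2 → Rel p.1 l m → m = l)

open Classical in
/-- The value of the term with a given code. -/
noncomputable def termValue (d : ℕ) : State → ℕ → List ℕ :=
  treeRec [] fun p => p.1.1.filter fun k => TermMem d p k

/-- The elements available for extensions of a state. -/
def pool (d : ℕ) (x : State) : List ℕ :=
  -- An extension by one element has at most `sizeBound (d + 1) (x.1.length + 1)` points, and
  -- `exists_code` reserves d + 1 numbers per point, one for each rank.
  x.1.flatMap fun k => (List.range (sizeBound (d + 1) (x.1.length + 1) * (d + 1))).map (Nat.pair k)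

open Classical in
/-- The tuple of a state pulled back to an extension. -/
noncomputable def pullback (x : State) (E : List ℕ) : List (List ℕ) :=
  x.2.2.map fun A => E.filter fun k => ∃ l ∈ A, l ∈ x.1 ∧ Rel x (pr k) l

open Classical in
/-- The extensions of a state by a further subset. -/
noncomputable def extensions (d : ℕ) (x : State) : List State :=
  ((pool d x).sublists'.flatMap fun E =>
    (E.flatMap fun k => E.map (Prod.mk k)).sublists'.flatMap fun R =>
      E.sublists'.map fun A => (E, R, pullback x E ++ [A])).filter
    fun y => IsRanked d y ∧ IsExt d x y

/-- The truth value of the formula with a given code. -/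
noncomputable def truth (d : ℕ) (p : ℕ × State) : Bool :=
  if p.1.unpair.1 = 1 then
    decide (termValue d p.2 p.1.unpair.2.unpair.1 = termValue d p.2 p.1.unpair.2.unpair.2)
  else if _ : p.1.unpair.1 = 2 then
    !(truth d (p.1.unpair.2.unpair.1, p.2)) || truth d (p.1.unpair.2.unpair.2, p.2)
  else if _ : p.1.unpair.1 = 3 then (extensions d p.2).all fun y => truth d (p.1.unpair.2, y)
  else false
termination_by p.1
decreasing_by
  all_goals
    have h1 := Nat.unpair_add_le p.1
    have h2 := Nat.unpair_left_le p.1.unpair.2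
    have h3 := Nat.unpair_right_le p.1.unpair.2
    omega

section Primrec

variable {α : Type} [Primcodable α]

theorem primrec_rk {d : ℕ} {f : α → ℕ} (hf : Primrec f) : Primrec fun a => rk d (f a) :=
  Primrec.nat_mod.comp (primrec_arg hf) (Primrec.const (d + 1))

theorem primrec_pr {f : α → ℕ} (hf : Primrec f) : Primrec fun a => pr (f a) := primrec_tag hf

theorem primrecPred_Rel {x : α → State} {k l : α → ℕ} (hx : Primrec x) (hk : Primrec k)
    (hl : Primrec l) : PrimrecPred fun a => Rel (x a) (k a) (l a) :=
  primrecPred_mem (hk.pair hl) (Primrec.fst.comp (Primrec.snd.comp hx))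

theorem primrec_elements {x : α → State} (hx : Primrec x) : Primrec fun a => (x a).1 :=
  Primrec.fst.comp hx

theorem primrecPred_isRanked {d : ℕ} {x : α → State} (hx : Primrec x) :
    PrimrecPred fun a => IsRanked d (x a) := by
  have e := primrec_elements hx
  have f1 : Primrec (Prod.fst : α × ℕ → α) := Primrec.fst
  have s1 : Primrec (Prod.snd : α × ℕ → ℕ) := Primrec.snd
  have f2 : Primrec fun q : (α × ℕ) × ℕ => q.1.1 := Primrec.fst.comp Primrec.fst
  have s2 : Primrec fun q : (α × ℕ) × ℕ => q.1.2 := Primrec.snd.comp Primrec.fst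
  have t2 : Primrec fun q : (α × ℕ) × ℕ => q.2 := Primrec.snd
  have f3 : Primrec fun q : ((α × ℕ) × ℕ) × ℕ => q.1.1.1 := f2.comp Primrec.fst
  have s3 : Primrec fun q : ((α × ℕ) × ℕ) × ℕ => q.1.1.2 := s2.comp Primrec.fst
  have t3 : Primrec fun q : ((α × ℕ) × ℕ) × ℕ => q.1.2 := t2.comp Primrec.fst
  have u3 : Primrec fun q : ((α × ℕ) × ℕ) × ℕ => q.2 := Primrec.snd
  refine PrimrecPred.and ?_ (PrimrecPred.and ?_ ?_)
  · exact primrecPred_forall e (primrecPred_Rel (hx.comp f1) s1 s1)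
  · exact primrecPred_forall e (primrecPred_forall (e.comp f1) (primrecPred_forall (e.comp f2)
      (primrecPred_imp (primrecPred_Rel (hx.comp f3) s3 t3)
        (primrecPred_imp (primrecPred_Rel (hx.comp f3) t3 u3)
          (primrecPred_Rel (hx.comp f3) s3 u3)))))
  · exact primrecPred_forall e (primrecPred_forall (e.comp f1)
      (primrecPred_imp (primrecPred_Rel (hx.comp f2) s2 t2)
        (primrecPred_imp (primrecPred_eq s2 t2).not
          (Primrec.nat_lt.comp (primrec_rk s2) (primrec_rk t2)))))

theorem primrecPred_isExt {d : ℕ} {x y : α → State} (hx : Primrec x) (hy : Primrec y) :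
    PrimrecPred fun a => IsExt d (x a) (y a) := by
  have ex := primrec_elements hx
  have ey := primrec_elements hy
  have f1 : Primrec (Prod.fst : α × ℕ → α) := Primrec.fst
  have s1 : Primrec (Prod.snd : α × ℕ → ℕ) := Primrec.snd
  have f2 : Primrec fun q : (α × ℕ) × ℕ => q.1.1 := Primrec.fst.comp Primrec.fst
  have s2 : Primrec fun q : (α × ℕ) × ℕ => q.1.2 := Primrec.snd.comp Primrec.fst
  have t2 : Primrec fun q : (α × ℕ) × ℕ => q.2 := Primrec.snd
  have f3 : Primrec fun q : ((α × ℕ) × ℕ) × ℕ => q.1.1.1 := f2.comp Primrec.fst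
  have s3 : Primrec fun q : ((α × ℕ) × ℕ) × ℕ => q.1.1.2 := s2.comp Primrec.fst
  have t3 : Primrec fun q : ((α × ℕ) × ℕ) × ℕ => q.1.2 := t2.comp Primrec.fst
  have u3 : Primrec fun q : ((α × ℕ) × ℕ) × ℕ => q.2 := Primrec.snd
  refine PrimrecPred.and ?_ (PrimrecPred.and ?_ (PrimrecPred.and ?_ ?_))
  · exact primrecPred_forall ey (PrimrecPred.and (primrecPred_mem (primrec_pr s1) (ex.comp f1))
      (primrecPred_le (primrec_rk s1) (primrec_rk (primrec_pr s1))))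
  · exact primrecPred_forall ey (primrecPred_forall (ey.comp f1)
      (primrecPred_imp (primrecPred_Rel (hy.comp f2) s2 t2)
        (primrecPred_Rel (hx.comp f2) (primrec_pr s2) (primrec_pr t2))))
  · exact primrecPred_forall ey (primrecPred_forall (ex.comp f1)
      (primrecPred_imp (primrecPred_Rel (hx.comp f2) (primrec_pr s2) t2)
        (primrecPred_exists (ey.comp f2) (PrimrecPred.and (primrecPred_Rel (hy.comp f3) s3 u3)
          (PrimrecPred.and (primrecPred_eq (primrec_pr u3) t3)
            (primrecPred_eq (primrec_rk u3) (primrec_rk t3)))))))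
  · exact primrecPred_forall ex (primrecPred_exists (ey.comp f1)
      (primrecPred_eq (primrec_pr t2) s2))

theorem primrec_termValue (d : ℕ) : Primrec₂ (termValue d) := by
  classical
  refine primrec_treeRec [] ?_
  let T := State × ℕ × List ℕ × List ℕ × List ℕ
  have x0 : Primrec fun p : T => p.1 := Primrec.fst
  refine primrec_filter (primrec_elements x0) ?_
  have q0 : Primrec fun q : T × ℕ => q.1 := Primrec.fst
  have x1 : Primrec fun q : T × ℕ => q.1.1 := x0.comp q0
  have c1 : Primrec fun q : T × ℕ => q.1.2.1 := Primrec.fst.comp (Primrec.snd.comp q0)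
  have a1 : Primrec fun q : T × ℕ => q.1.2.2.2.1 :=
    Primrec.fst.comp (Primrec.snd.comp (Primrec.snd.comp (Primrec.snd.comp q0)))
  have b1 : Primrec fun q : T × ℕ => q.1.2.2.2.2 :=
    Primrec.snd.comp (Primrec.snd.comp (Primrec.snd.comp (Primrec.snd.comp q0)))
  have k1 : Primrec fun q : T × ℕ => q.2 := Primrec.snd
  have t1 := primrec_tag c1
  have r1 := primrec_arg c1
  have e1 := primrec_elements x1
  have v1 : Primrec fun q : T × ℕ => q.1.1.2.2 := Primrec.snd.comp (Primrec.snd.comp x1)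
  have q1 : Primrec fun q : (T × ℕ) × ℕ => q.1 := Primrec.fst
  have l2 : Primrec fun q : (T × ℕ) × ℕ => q.2 := Primrec.snd
  have q2 : Primrec fun q : ((T × ℕ) × ℕ) × ℕ => q.1 := Primrec.fst
  have m3 : Primrec fun q : ((T × ℕ) × ℕ) × ℕ => q.2 := Primrec.snd
  have tag : ∀ i, PrimrecPred fun q : T × ℕ => q.1.2.1.unpair.1 = i := fun i =>
    primrecPred_eq t1 (Primrec.const i)
  refine PrimrecPred.or ((tag 0).and ?_) (PrimrecPred.or (tag 2) (PrimrecPred.or ((tag 3).and ?_)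
    (PrimrecPred.or ((tag 4).and ?_) (PrimrecPred.or ((tag 5).and ?_) ((tag 6).and ?_)))))
  · exact primrecPred_exists ((Primrec.list_getD []).comp v1 r1)
      ((primrecPred_mem l2 (e1.comp q1)).and (primrecPred_Rel (x1.comp q1) (k1.comp q1) l2))
  · exact (primrecPred_mem k1 a1).or (primrecPred_mem k1 b1)
  · exact (primrecPred_mem k1 a1).and (primrecPred_mem k1 b1)
  · exact primrecPred_exists e1 ((primrecPred_Rel (x1.comp q1) (k1.comp q1) l2).and
      ((primrecPred_mem l2 (a1.comp q1)).and (primrecPred_mem l2 (b1.comp q1)).not))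
  · exact primrecPred_exists e1 ((primrecPred_Rel (x1.comp q1) (k1.comp q1) l2).and
      ((primrecPred_mem l2 (b1.comp q1)).and
        ((primrecPred_eq (primrec_rk l2) (primrec_tag (r1.comp q1))).and
          (primrecPred_forall (e1.comp q1) (primrecPred_imp
            (primrecPred_mem m3 ((b1.comp q1).comp q2)) (primrecPred_imp
              (primrecPred_Rel ((x1.comp q1).comp q2) (l2.comp q2) m3)
              (primrecPred_eq m3 (l2.comp q2))))))))

theorem primrec_pool (d : ℕ) : Primrec (pool d) := by
  have e : Primrec fun x : State => x.1 := Primrec.fst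
  refine Primrec.list_flatMap e ?_
  refine Primrec.list_map (Primrec.list_range.comp (Primrec.nat_mul.comp
    ((primrec_sizeBound (d + 1)).comp (Primrec.succ.comp (Primrec.list_length.comp
      (e.comp Primrec.fst)))) (Primrec.const (d + 1)))) ?_
  exact Primrec₂.natPair.comp (Primrec.snd.comp Primrec.fst) Primrec.snd

theorem primrec_pullback : Primrec₂ pullback := by
  classical
  have h1 : Primrec fun p : State × List ℕ => p.1.2.2 :=
    Primrec.snd.comp (Primrec.snd.comp Primrec.fst)
  refine Primrec.list_map h1 ?_
  have h2 : Primrec fun p : (State × List ℕ) × List ℕ => p.1.2 := Primrec.snd.comp Primrec.fst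
  refine primrec_filter (p := fun (p : (State × List ℕ) × List ℕ) k =>
    ∃ l ∈ p.2, l ∈ p.1.1.1 ∧ Rel p.1.1 (pr k) l) h2 ?_
  refine primrecPred_exists (Primrec.snd.comp Primrec.fst) ?_
  have hx : Primrec fun q : (((State × List ℕ) × List ℕ) × ℕ) × ℕ => q.1.1.1.1 :=
    Primrec.fst.comp (Primrec.fst.comp (Primrec.fst.comp Primrec.fst))
  exact (primrecPred_mem Primrec.snd (primrec_elements hx)).and
    (primrecPred_Rel hx (primrec_pr (Primrec.snd.comp Primrec.fst)) Primrec.snd)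

theorem primrec_extensions (d : ℕ) : Primrec (extensions d) := by
  classical
  refine primrec_filter ?_ ((primrecPred_isRanked Primrec.snd).and
    (primrecPred_isExt Primrec.fst Primrec.snd))
  refine Primrec.list_flatMap (primrec_sublists'.comp (primrec_pool d)) ?_
  have hE : Primrec fun q : State × List ℕ => q.2 := Primrec.snd
  refine Primrec.list_flatMap (primrec_sublists'.comp (Primrec.list_flatMap hE
    (Primrec.list_map (hE.comp Primrec.fst) (Primrec.pair (Primrec.snd.comp Primrec.fst)
      Primrec.snd)))) ?_
  refine Primrec.list_map (primrec_sublists'.comp (hE.comp Primrec.fst)) ?_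
  have hq : Primrec fun q : ((State × List ℕ) × List (ℕ × ℕ)) × List ℕ => q.1.1 :=
    Primrec.fst.comp Primrec.fst
  exact (Primrec.snd.comp hq).pair ((Primrec.snd.comp Primrec.fst).pair
    (Primrec.list_concat.comp (primrec_pullback.comp (Primrec.fst.comp hq) (Primrec.snd.comp hq))
      Primrec.snd))

/-- The recursive calls in the computation of `truth`. -/
noncomputable def calls (d : ℕ) (p : ℕ × State) : List (ℕ × State) :=
  if p.1.unpair.1 = 2 then
    [(p.1.unpair.2.unpair.1, p.2), (p.1.unpair.2.unpair.2, p.2)]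
  else if p.1.unpair.1 = 3 then (extensions d p.2).map (Prod.mk p.1.unpair.2)
  else []

/-- The value of `truth` from the values of the recursive calls. -/
noncomputable def truthStep (d : ℕ) (p : ℕ × State) (v : List Bool) : Bool :=
  if p.1.unpair.1 = 1 then
    decide (termValue d p.2 p.1.unpair.2.unpair.1 = termValue d p.2 p.1.unpair.2.unpair.2)
  else if p.1.unpair.1 = 2 then !(v.getD 0 false) || v.getD 1 false
  else if p.1.unpair.1 = 3 then decide (∀ b ∈ v, b = true)
  else false

theorem truthStep_calls (d : ℕ) (p : ℕ × State) :
    truthStep d p ((calls d p).map (truth d)) = truth d p := by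
  rw [truth, truthStep, calls]
  split_ifs with h1 h2 h3
  · rfl
  · rfl
  · rw [Bool.eq_iff_iff]
    simp
  · rfl

theorem lt_of_mem_calls {d : ℕ} {p q : ℕ × State} (h : q ∈ calls d p) : q.1 < p.1 := by
  have h1 := Nat.unpair_add_le p.1
  have h2 := Nat.unpair_left_le p.1.unpair.2
  have h3 := Nat.unpair_right_le p.1.unpair.2
  rw [calls] at h
  split_ifs at h with h4 h5
  · simp only [List.mem_cons, List.not_mem_nil, or_false] at h
    rcases h with rfl | rfl <;> dsimp only <;> omega
  · obtain ⟨y, -, rfl⟩ := List.mem_map.1 h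
    dsimp only
    omega
  · simp at h

theorem primrec_calls (d : ℕ) : Primrec (calls d) := by
  have t : Primrec fun p : ℕ × State => p.1.unpair.1 := primrec_tag Primrec.fst
  have r : Primrec fun p : ℕ × State => p.1.unpair.2 := primrec_arg Primrec.fst
  refine Primrec.ite (primrecPred_eq t (Primrec.const 2)) ?_
    (Primrec.ite (primrecPred_eq t (Primrec.const 3)) ?_ (Primrec.const _))
  · exact Primrec.list_cons.comp ((primrec_tag r).pair Primrec.snd)
      (Primrec.list_cons.comp ((primrec_arg r).pair Primrec.snd) (Primrec.const []))
  · exact Primrec.list_map ((primrec_extensions d).comp Primrec.snd)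
      ((r.comp Primrec.fst).pair Primrec.snd)

theorem primrec_truthStep (d : ℕ) : Primrec₂ (truthStep d) := by
  have p : Primrec fun q : (ℕ × State) × List Bool => q.1.1 := Primrec.fst.comp Primrec.fst
  have x : Primrec fun q : (ℕ × State) × List Bool => q.1.2 := Primrec.snd.comp Primrec.fst
  have v : Primrec fun q : (ℕ × State) × List Bool => q.2 := Primrec.snd
  have t := primrec_tag p
  have r := primrec_arg p
  refine Primrec.ite (primrecPred_eq t (Primrec.const 1)) ?_
    (Primrec.ite (primrecPred_eq t (Primrec.const 2)) ?_
      (Primrec.ite (primrecPred_eq t (Primrec.const 3)) ?_ (Primrec.const _)))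
  · exact PrimrecPred.decide (Primrec.eq.comp ((primrec_termValue d).comp x (primrec_tag r))
      ((primrec_termValue d).comp x (primrec_arg r)))
  · exact Primrec.or.comp
      (Primrec.not.comp ((Primrec.list_getD false).comp v (Primrec.const 0)))
      ((Primrec.list_getD false).comp v (Primrec.const 1))
  · exact PrimrecPred.decide (primrecPred_forall v (Primrec.eq.comp Primrec.snd
      (Primrec.const true)))

/-- The state varies in the recursive calls, while the formula code decreases; recursion along this
measure with an explicit finite list of calls is primitive recursive. -/
theorem primrec_truth (d : ℕ) : Primrec (truth d) :=
  Primrec.nat_omega_rec' (truth d) (g := fun p v => some (truthStep d p v)) Primrec.fst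
    (primrec_calls d) (Primrec.option_some.comp (primrec_truthStep d))
    (fun _ _ h => lt_of_mem_calls h) fun p => congrArg some (truthStep_calls d p)

end Primrec

end States

end Subscaled

namespace Subscaled

variable {d : ℕ}

/-! ### From states to ranked posets -/

section PosetOfState

variable {x y : State}

/-- The ranked poset of a state. -/
def IsRanked.poset (h : IsRanked d x) : RankedPoset d where
  carrier := {k // k ∈ x.1}
  finite := (List.finite_toSet x.1).to_subtype
  partialOrder :=
    { le := fun k l => Rel x k l
      lt := fun k l => Rel x k l ∧ ¬ Rel x l k
      le_refl := fun k => h.1 k k.2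
      le_trans := fun k l m => h.2.1 k k.2 l l.2 m m.2
      le_antisymm := fun k l hkl hlk => by
        by_contra hne
        have h1 := h.2.2 k k.2 l l.2 hkl fun e => hne (Subtype.ext e)
        have h2 := h.2.2 l l.2 k k.2 hlk fun e => hne (Subtype.ext e.symm)
        omega }
  rank k := rk d k
  strictMono := fun k l ⟨h1, h2⟩ => h.2.2 k k.2 l l.2 h1 fun e => h2 (e ▸ h.1 k k.2)
  rank_le k := Nat.le_of_lt_succ (Nat.mod_lt _ (Nat.succ_pos d))

/-- An element of a state, as a natural number. -/
def IsRanked.val (h : IsRanked d x) (k : h.poset.carrier) : ℕ := Subtype.val k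

theorem IsRanked.val_mem (h : IsRanked d x) (k : h.poset.carrier) : h.val k ∈ x.1 := Subtype.prop k

/-- The element of a state given by a natural number. -/
def IsRanked.elem (h : IsRanked d x) (k : ℕ) (hk : k ∈ x.1) : h.poset.carrier :=
  (⟨k, hk⟩ : {k // k ∈ x.1})

theorem IsRanked.val_injective (h : IsRanked d x) {k l : h.poset.carrier} (e : h.val k = h.val l) :
    k = l := Subtype.ext e

/-- The lower set generated by a list of elements of a state. -/
def IsRanked.value (h : IsRanked d x) (A : List ℕ) : h.poset.Alg :=
  Down.mk _ fun k => h.val k ∈ A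

/-- The tuple of a state. -/
def IsRanked.tuple (h : IsRanked d x) (n : ℕ) : Fin n → h.poset.Alg :=
  fun i => h.value (x.2.2.getD i [])

theorem IsRanked.mem_value (h : IsRanked d x) {A : List ℕ} {k : h.poset.carrier} :
    k ∈ h.value A ↔ ∃ l ∈ A, l ∈ x.1 ∧ Rel x (h.val k) l :=
  ⟨fun ⟨l, h1, h2⟩ => ⟨h.val l, h2, h.val_mem l, h1⟩,
    fun ⟨l, h1, h2, h3⟩ => ⟨h.elem l h2, h3, h1⟩⟩

end PosetOfState

/-! ### Correctness of term evaluation -/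

section Terms

variable {x : State}

theorem mem_termValue_zero {r k : ℕ} : k ∈ termValue d x (Nat.pair 0 r) ↔
    k ∈ x.1 ∧ ∃ l ∈ x.2.2.getD r [], l ∈ x.1 ∧ Rel x k l := by
  unfold termValue
  rw [treeRec]
  refine List.mem_filter.trans (and_congr_right fun _ => ?_)
  refine (@decide_eq_true_iff _ (Classical.propDecidable _)).trans ?_
  simp [TermMem]

theorem mem_termValue_pair {t r k : ℕ} (ht : 0 < t) : k ∈ termValue d x (Nat.pair t r) ↔
    k ∈ x.1 ∧ TermMem d (x, Nat.pair t r, termValue d x r, termValue d x r.unpair.1,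
      termValue d x r.unpair.2) k := by
  unfold termValue
  rw [treeRec_pair _ _ _ ht]
  refine List.mem_filter.trans (and_congr_right fun _ => ?_)
  exact @decide_eq_true_iff _ (Classical.propDecidable _)

/-- All values are filters of the same list, so equality of lists amounts to equality of sets and
equations can be tested literally. -/
theorem termValue_eq_iff {c c' : ℕ} : termValue d x c = termValue d x c' ↔
    ∀ k ∈ x.1, k ∈ termValue d x c ↔ k ∈ termValue d x c' := by
  have key : ∀ c, ∃ p : ℕ → Bool, termValue d x c = x.1.filter p := fun c => by
    unfold termValue
    rw [treeRec]
    exact ⟨_, rfl⟩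
  obtain ⟨p, hp⟩ := key c
  obtain ⟨q, hq⟩ := key c'
  rw [hp, hq]
  refine ⟨fun e k _ => by rw [e], fun e => List.filter_congr fun k hk => ?_⟩
  have := e k hk
  rw [List.mem_filter, List.mem_filter, and_iff_right hk, and_iff_right hk] at this
  exact Bool.eq_iff_iff.2 this

theorem mem_termValue_iff (h : IsRanked d x) {n : ℕ} (t : LSC.Term (Empty ⊕ Fin n))
    (k : h.poset.carrier) : h.val k ∈ termValue d x (termCode t) ↔
      k ∈ t.realize (Sum.elim default (h.tuple n)) := by
  have hc : Compatible h.poset.Alg := Down.compatible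
  induction t generalizing k with
  | var i =>
    rcases i with i | i
    · exact i.elim
    · rw [termCode, mem_termValue_zero, and_iff_right (h.val_mem k)]
      exact h.mem_value.symm
  | func f ts ih =>
    cases f with
    | zero =>
      change h.val k ∈ termValue d x (Nat.pair 1 0) ↔ _
      rw [mem_termValue_pair one_pos]
      refine ⟨fun h' => ?_, fun h' => ?_⟩
      · simp [TermMem] at h'
      · have e : (Term.func SCFunc.zero ts : LSC.Term (Empty ⊕ Fin n)) = tZero :=
          congrArg (Term.func (L := LSC) SCFunc.zero) (Subsingleton.elim _ _)
        rw [e, hc.realize_tZero] at h'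
        exact absurd h' Down.notMem_bot
    | one =>
      change h.val k ∈ termValue d x (Nat.pair 2 0) ↔ _
      rw [mem_termValue_pair two_pos, and_iff_right (h.val_mem k)]
      refine iff_of_true (by simp [TermMem]) ?_
      have e : (Term.func SCFunc.one ts : LSC.Term (Empty ⊕ Fin n)) = tOne :=
        congrArg (Term.func (L := LSC) SCFunc.one) (Subsingleton.elim _ _)
      rw [e, realize_tOne, hc.2.1]
      exact Down.mem_top
    | join =>
      have e : (Term.func SCFunc.join ts : LSC.Term (Empty ⊕ Fin n)) = tJoin (ts 0) (ts 1) :=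
        congrArg (Term.func (L := LSC) SCFunc.join) (by ext i; fin_cases i <;> rfl)
      change h.val k ∈ termValue d x (Nat.pair 3 (Nat.pair (termCode (ts 0)) (termCode (ts 1)))) ↔ _
      rw [mem_termValue_pair three_pos, and_iff_right (h.val_mem k), e,
        hc.realize_tJoin]
      refine Iff.trans ?_ ((or_congr (ih 0 k) (ih 1 k)).trans Down.mem_sup.symm)
      simp [TermMem]
    | meet =>
      have e : (Term.func SCFunc.meet ts : LSC.Term (Empty ⊕ Fin n)) = tMeet (ts 0) (ts 1) :=
        congrArg (Term.func (L := LSC) SCFunc.meet) (by ext i; fin_cases i <;> rfl)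
      change h.val k ∈ termValue d x (Nat.pair 4 (Nat.pair (termCode (ts 0)) (termCode (ts 1)))) ↔ _
      rw [mem_termValue_pair four_pos, and_iff_right (h.val_mem k), e,
        hc.realize_tMeet]
      refine Iff.trans ?_ ((and_congr (ih 0 k) (ih 1 k)).trans Down.mem_inf.symm)
      simp [TermMem]
    | sub =>
      have e : (Term.func SCFunc.sub ts : LSC.Term (Empty ⊕ Fin n)) = tSub (ts 0) (ts 1) :=
        congrArg (Term.func (L := LSC) SCFunc.sub) (by ext i; fin_cases i <;> rfl)
      change h.val k ∈ termValue d x (Nat.pair 5 (Nat.pair (termCode (ts 0)) (termCode (ts 1)))) ↔ _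
      rw [mem_termValue_pair (by norm_num), and_iff_right (h.val_mem k), e,
        hc.realize_tSub]
      rw [Down.mem_sdiff]
      simp only [TermMem, Nat.unpair_pair]
      constructor
      · intro h'
        obtain ⟨l, h1, h2, h3, h4⟩ : ∃ l ∈ x.1, Rel x (h.val k) l ∧ l ∈ termValue d x (termCode (ts 0)) ∧
          ¬ l ∈ termValue d x (termCode (ts 1)) := by simpa using h'
        exact ⟨h.elem l h1, h2, (ih 0 (h.elem l h1)).1 h3, fun h5 => h4 ((ih 1 (h.elem l h1)).2 h5)⟩
      · rintro ⟨l, h2, h3, h4⟩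
        have : ∃ l ∈ x.1, Rel x (h.val k) l ∧ l ∈ termValue d x (termCode (ts 0)) ∧
          ¬ l ∈ termValue d x (termCode (ts 1)) :=
          ⟨h.val l, h.val_mem l, h2, (ih 0 l).2 h3, fun h5 => h4 ((ih 1 l).1 h5)⟩
        simpa using this
    | comp i =>
      have e : (Term.func (SCFunc.comp i) ts : LSC.Term (Empty ⊕ Fin n)) = tComp i (ts 0) :=
        congrArg (Term.func (L := LSC) (SCFunc.comp i)) (by ext i; fin_cases i; rfl)
      change h.val k ∈ termValue d x (Nat.pair 6 (Nat.pair i (termCode (ts 0)))) ↔ _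
      rw [mem_termValue_pair (by norm_num), and_iff_right (h.val_mem k), e,
        realize_tComp, Down.compOp_eq, Down.mem_comp]
      simp only [TermMem, Nat.unpair_pair]
      constructor
      · intro h'
        obtain ⟨l, h1, h2, h3, h4, h5⟩ : ∃ l ∈ x.1, Rel x (h.val k) l ∧
          l ∈ termValue d x (termCode (ts 0)) ∧ rk d l = i ∧
            ∀ m ∈ x.1, m ∈ termValue d x (termCode (ts 0)) → Rel x l m → m = l := by simpa using h'
        exact ⟨h.elem l h1, h2, (ih 0 (h.elem l h1)).1 h3, h4, fun m hm hlm =>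
          h.val_injective (h5 _ (h.val_mem m) ((ih 0 m).2 hm) hlm)⟩
      · rintro ⟨l, h2, h3, h4, h5⟩
        have : ∃ l ∈ x.1, Rel x (h.val k) l ∧
          l ∈ termValue d x (termCode (ts 0)) ∧ rk d l = i ∧
            ∀ m ∈ x.1, m ∈ termValue d x (termCode (ts 0)) → Rel x l m → m = l :=
          ⟨h.val l, h.val_mem l, h2, (ih 0 l).2 h3, h4, fun m hm hm' hlm =>
            congrArg h.val (h5 (h.elem m hm) ((ih 0 (h.elem m hm)).1 hm') hlm)⟩
        simpa using this

end Terms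

/-! ### From ranked posets to states -/

section Codes

variable {x y : State}

/-- The state `y` is a copy of `Q`. -/
structure IsCode (Q : RankedPoset d) (code : Q.carrier → ℕ) (y : State) : Prop where
  rk_code : ∀ q, rk d (code q) = Q.rank q
  mem_iff : ∀ k, k ∈ y.1 ↔ ∃ q, code q = k
  rel_iff : ∀ p q, Rel y (code p) (code q) ↔ p ≤ q

namespace IsCode

variable {Q : RankedPoset d} {code : Q.carrier → ℕ}

theorem code_mem (h : IsCode Q code y) (q : Q.carrier) : code q ∈ y.1 := (h.mem_iff _).2 ⟨q, rfl⟩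

theorem isRanked (h : IsCode Q code y) : IsRanked d y := by
  refine ⟨fun i hi => ?_, fun i hi j hj k hk => ?_, fun i hi j hj => ?_⟩
  · obtain ⟨p, rfl⟩ := (h.mem_iff i).1 hi
    exact (h.rel_iff p p).2 le_rfl
  · obtain ⟨p, rfl⟩ := (h.mem_iff i).1 hi
    obtain ⟨q, rfl⟩ := (h.mem_iff j).1 hj
    obtain ⟨r, rfl⟩ := (h.mem_iff k).1 hk
    rw [h.rel_iff, h.rel_iff, h.rel_iff]
    exact le_trans
  · obtain ⟨p, rfl⟩ := (h.mem_iff i).1 hi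
    obtain ⟨q, rfl⟩ := (h.mem_iff j).1 hj
    rw [h.rel_iff, h.rk_code, h.rk_code]
    exact fun hpq hne => Q.strictMono (lt_of_le_of_ne hpq fun e => hne (congrArg code e))

theorem isPMap (h : IsCode Q code y) (hy : IsRanked d y) :
    IsPMap (J := hy.poset.carrier) Q.rank hy.poset.rank fun q => hy.elem (code q) (h.code_mem q) where
  mono p q hpq := (h.rel_iff p q).2 hpq
  dim_le q := (h.rk_code q).ge
  lift := by
    rintro p ⟨j, hj⟩ hpj
    obtain ⟨q, rfl⟩ := (h.mem_iff j).1 hj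
    exact ⟨q, (h.rel_iff p q).1 hpj, rfl, (h.rk_code q).symm⟩
  surj := by
    rintro ⟨j, hj⟩
    obtain ⟨q, rfl⟩ := (h.mem_iff j).1 hj
    exact ⟨q, rfl⟩

end IsCode

/-- The first half of a code records the projection; the second half is (d + 1) · index + rank, so
the rank is a residue and the index a quotient, which gives injectivity and the bound. -/
theorem exists_code (Q : RankedPoset d) (f : Q.carrier → ℕ) : ∃ code : Q.carrier → ℕ,
    Function.Injective code ∧ ∀ q, rk d (code q) = Q.rank q ∧ pr (code q) = f q ∧
      (code q).unpair.2 < Nat.card Q.carrier * (d + 1) := by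
  let idx := Finite.equivFin Q.carrier
  have h1 : ∀ q, Q.rank q < d + 1 := fun q => Nat.lt_succ_of_le (Q.rank_le q)
  refine ⟨fun q => Nat.pair (f q) ((d + 1) * idx q + Q.rank q), fun p q hpq => ?_, fun q =>
    ⟨?_, ?_, ?_⟩⟩
  · have h2 := congrArg (· / (d + 1)) (Nat.pair_eq_pair.1 hpq).2
    simp only [Nat.mul_add_div (Nat.succ_pos d), Nat.div_eq_of_lt (h1 _), add_zero] at h2
    exact idx.injective (Fin.ext h2)
  · rw [rk, Nat.unpair_pair, Nat.mul_add_mod, Nat.mod_eq_of_lt (h1 q)]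
  · rw [pr, Nat.unpair_pair]
  · rw [Nat.unpair_pair]
    have h2 : idx q + 1 ≤ Nat.card Q.carrier := (idx q).2
    have h3 := Nat.mul_le_mul_right (d + 1) h2
    have h4 := h1 q
    dsimp only
    nlinarith

open Classical in
/-- The order of `Q` on a list of codes. -/
noncomputable def codeRel (Q : RankedPoset d) (code : Q.carrier → ℕ) (E : List ℕ) :
    List (ℕ × ℕ) :=
  (E.flatMap fun k => E.map (Prod.mk k)).filter fun p => ∃ a b, code a = p.1 ∧ code b = p.2 ∧ a ≤ b

theorem isCode_codeRel {Q : RankedPoset d} {code : Q.carrier → ℕ} (h1 : Function.Injective code)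
    (h2 : ∀ q, rk d (code q) = Q.rank q) {E : List ℕ} (h3 : ∀ k, k ∈ E ↔ ∃ q, code q = k)
    (V : List (List ℕ)) : IsCode Q code (E, codeRel Q code E, V) where
  rk_code := h2
  mem_iff := h3
  rel_iff p q := by
    simp only [Rel, codeRel, List.mem_filter, List.mem_flatMap, List.mem_map, decide_eq_true_eq]
    constructor
    · rintro ⟨-, a, b, ha, hb, hab⟩
      rwa [← h1 ha, ← h1 hb]
    · exact fun h => ⟨⟨_, (h3 _).2 ⟨p, rfl⟩, _, (h3 _).2 ⟨q, rfl⟩, rfl⟩, p, q, rfl, rfl, h⟩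

/-- Every ranked poset is the poset of a state. -/
theorem exists_state (Q : RankedPoset d) :
    ∃ (x : State) (h : IsRanked d x), x.2.2 = [] ∧ Nonempty (h.poset.Alg ↪[LSC] Q.Alg) := by
  obtain ⟨code, h1, h2⟩ := exists_code Q fun _ => 0
  have h := isCode_codeRel h1 (fun q => (h2 q).1) (E := (Set.finite_range code).toFinset.toList)
    (fun k => by simp) []
  exact ⟨_, h.isRanked, rfl, ⟨(h.isPMap h.isRanked).embedding Q.strictMono⟩⟩

end Codes

/-! ### Extensions of states represent one-element extensions -/

section Extensions

variable {x y : State}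

theorem mem_extensions : y ∈ extensions d x ↔
    (∃ E ∈ (pool d x).sublists', ∃ R ∈ (E.flatMap fun k => E.map (Prod.mk k)).sublists',
      ∃ A ∈ E.sublists', (E, R, pullback x E ++ [A]) = y) ∧ IsRanked d y ∧ IsExt d x y := by
  simp only [extensions, List.mem_filter, List.mem_flatMap, List.mem_map, decide_eq_true_eq]

theorem IsExt.isPMap (h : IsExt d x y) (hx : IsRanked d x) (hy : IsRanked d y) :
    IsPMap (K := hy.poset.carrier) (J := hx.poset.carrier) hy.poset.rank hx.poset.rank
      fun k => hx.elem (pr (hy.val k)) (h.1 _ (hy.val_mem k)).1 where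
  mono k l hkl := h.2.1 k.1 k.2 l.1 l.2 hkl
  dim_le k := (h.1 k.1 k.2).2
  lift k j hkj := by
    obtain ⟨l, h1, h2, h3, h4⟩ := h.2.2.1 k.1 k.2 j.1 j.2 hkj
    exact ⟨⟨l, h1⟩, h2, Subtype.ext h3, h4⟩
  surj j := by
    obtain ⟨k, h1, h2⟩ := h.2.2.2 j.1 j.2
    exact ⟨⟨k, h1⟩, Subtype.ext h2⟩

/-- The old part of the tuple is carried to the extension by the embedding dual to the projection,
so later formulas see the same elements. -/
theorem mem_tuple_castSucc (h : IsExt d x y) (hx : IsRanked d x) (hy : IsRanked d y) {n : ℕ}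
    (hn : x.2.2.length = n) {A : List ℕ} (hA : y.2.2 = pullback x y.1 ++ [A]) (i : Fin n)
    (k : hy.poset.carrier) : k ∈ hy.tuple (n + 1) i.castSucc ↔
      hx.elem (pr (hy.val k)) (h.1 _ (hy.val_mem k)).1 ∈ hx.tuple n i := by
  have hk := hy.val_mem k
  subst hn
  have e : y.2.2.getD i.castSucc [] = y.1.filter fun k => open Classical in
      decide (∃ l ∈ x.2.2.getD i [], l ∈ x.1 ∧ Rel x (pr k) l) := by
    rw [hA, List.getD_eq_getElem?_getD, List.getElem?_append_left (by simp [pullback]),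
      List.getD_eq_getElem _ _ i.2]
    simp [pullback]
  unfold IsRanked.tuple
  rw [e, hy.mem_value, hx.mem_value]
  simp only [List.mem_filter, decide_eq_true_eq]
  constructor
  · rintro ⟨j, ⟨hj, l, h1, h2, h3⟩, -, h4⟩
    exact ⟨l, h1, h2, hx.2.1 _ (h.1 _ hk).1 _ (h.1 j hj).1 _ h2 (h.2.1 _ hk j hj h4) h3⟩
  · intro h'
    exact ⟨hy.val k, ⟨hk, h'⟩, hk, hy.1 _ hk⟩

theorem tuple_last (hy : IsRanked d y) {n : ℕ} {A : List ℕ} {V : List (List ℕ)}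
    (hV : V.length = n) (hA : y.2.2 = V ++ [A]) : hy.tuple (n + 1) (Fin.last n) = hy.value A := by
  subst hV
  unfold IsRanked.tuple
  rw [hA]
  simp

/-- Every one-element extension of the tuple of a state comes from an extension of the state. -/
theorem exists_extension {N : Type*} [LSC.Structure N] (hN : IsSubscaled d N) (hx : IsRanked d x)
    {n : ℕ} (hn : x.2.2.length = n) (e : hx.poset.Alg ↪[LSC] N) (m : N) :
    ∃ y ∈ extensions d x, y.2.2.length = n + 1 ∧ ∃ (hy : IsRanked d y) (e' : hy.poset.Alg ↪[LSC] N),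
      ⇑e' ∘ hy.tuple (n + 1) = (Fin.snoc (e ∘ hx.tuple n) m : Fin (n + 1) → N) := by
  classical
  obtain ⟨Q, e₀, g, hcard, hg, B, hB⟩ := exists_ranked_extension hN hx.poset e m
  obtain ⟨f, hf, hfg⟩ := exists_pmap hx.poset.strictMono Q.strictMono g
  obtain ⟨code, h1, h2⟩ := exists_code Q fun q => hx.val (f q)
  -- Filtering the pool, rather than listing the codes directly, makes the points a sublist of it,
  -- as the search in `extensions` requires; the order and the subset are obtained by filtering too.
  let E := (pool d x).filter fun k => decide (∃ q, code q = k)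
  let A := E.filter fun k => decide (∃ q ∈ B, code q = k)
  have hxc : Nat.card hx.poset.carrier ≤ x.1.length := by
    have : Nat.card {k // k ∈ x.1} = x.1.toFinset.card := by
      rw [Nat.card_eq_fintype_card, Fintype.card_of_subtype x.1.toFinset (by simp)]
    exact this.trans_le x.1.toFinset_card_le
  have hE : ∀ k, k ∈ E ↔ ∃ q, code q = k := by
    intro k
    simp only [E, List.mem_filter, decide_eq_true_eq, and_iff_right_iff_imp]
    rintro ⟨q, rfl⟩
    simp only [pool, List.mem_flatMap, List.mem_map, List.mem_range]
    refine ⟨pr (code q), ?_, (code q).unpair.2, ?_, Nat.pair_unpair _⟩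
    · rw [(h2 q).2.1]
      exact hx.val_mem (f q)
    · exact (h2 q).2.2.trans_le (Nat.mul_le_mul_right _ (hcard.trans
        (sizeBound_mono _ (Nat.succ_le_succ hxc))))
  have hy := isCode_codeRel h1 (fun q => (h2 q).1) hE (pullback x E ++ [A])
  set y : State := (E, codeRel Q code E, pullback x E ++ [A]) with hydef
  have hext : IsExt d x y := by
    refine ⟨fun k hk => ?_, fun k hk l hl => ?_, fun k hk j hj hkj => ?_, fun j hj => ?_⟩
    · obtain ⟨q, rfl⟩ := (hy.mem_iff k).1 hk
      rw [(h2 q).1, (h2 q).2.1]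
      exact ⟨hx.val_mem (f q), hf.dim_le q⟩
    · obtain ⟨p, rfl⟩ := (hy.mem_iff k).1 hk
      obtain ⟨q, rfl⟩ := (hy.mem_iff l).1 hl
      rw [hy.rel_iff, (h2 p).2.1, (h2 q).2.1]
      exact fun h => hf.mono h
    · obtain ⟨p, rfl⟩ := (hy.mem_iff k).1 hk
      rw [(h2 p).2.1] at hkj
      obtain ⟨q, hq1, hq2, hq3⟩ := hf.lift p (hx.elem j hj) hkj
      refine ⟨code q, hy.code_mem q, (hy.rel_iff p q).2 hq1, ?_, ?_⟩
      · rw [(h2 q).2.1, hq2]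
        rfl
      · rw [(h2 q).1, hq3]
        rfl
    · obtain ⟨q, hq⟩ := hf.surj (hx.elem j hj)
      exact ⟨code q, hy.code_mem q, (h2 q).2.1.trans (congrArg hx.val hq)⟩
  have hr := hy.isRanked
  have hlen : (pullback x E).length = n := by simpa [pullback] using hn
  refine ⟨y, mem_extensions.2 ⟨⟨E, List.mem_sublists'.2 List.filter_sublist, codeRel Q code E,
    List.mem_sublists'.2 List.filter_sublist, A, List.mem_sublists'.2 List.filter_sublist, rfl⟩,
    hr, hext⟩, by simp [hydef, hlen], hr,
    e₀.comp ((hy.isPMap hr).embedding Q.strictMono), funext fun i => ?_⟩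
  change e₀ ((hy.isPMap hr).embedding Q.strictMono (hr.tuple (n + 1) i)) = _
  refine Fin.lastCases ?_ (fun i => ?_) i
  · rw [Fin.snoc_last, ← hB, tuple_last hr hlen rfl]
    refine congrArg e₀ (Down.ext fun q => ?_)
    refine (IsPMap.mem_embedding _ _).trans (hr.mem_value.trans ?_)
    constructor
    · rintro ⟨l, hl, -, hql⟩
      obtain ⟨-, q', hq', rfl⟩ : l ∈ E ∧ ∃ q ∈ B, code q = l := by simpa [A] using hl
      exact Down.mem_of_le ((hy.rel_iff q q').1 hql) hq'
    · intro hq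
      have : code q ∈ E ∧ ∃ q' ∈ B, code q' = code q := ⟨(hE _).2 ⟨q, rfl⟩, q, hq, rfl⟩
      exact ⟨code q, by simpa [A] using this, this.1, (hy.rel_iff q q).2 le_rfl⟩
  · rw [Fin.snoc_castSucc]
    change _ = e (hx.tuple n i)
    rw [← hg]
    refine congrArg e₀ (Down.ext fun q => ?_)
    refine (IsPMap.mem_embedding _ _).trans
      ((mem_tuple_castSucc hext hx hr hn rfl i (hr.elem (code q) (hy.code_mem q))).trans ?_)
    rw [hfg]
    have : hx.elem (pr (code q)) (hext.1 _ (hy.code_mem q)).1 = f q :=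
      hx.val_injective (h2 q).2.1
    exact iff_of_eq (congrArg (· ∈ hx.tuple n i) this)

end Extensions

/-! ### Correctness of the truth computation and decidability -/

section Truth

/-- Only the quantifier needs an argument. Every element of N arises from a listed extension of the
state by local finiteness, and every listed extension embeds in N over the current embedding because
N is super scaled; so a finite search decides a quantifier over N. -/
theorem truth_iff {N : Type*} [LSC.Structure N] (hN : IsSuperScaled d N) {n : ℕ}
    (φ : LSC.BoundedFormula Empty n) (x : State) (hx : IsRanked d x) (hn : x.2.2.length = n)
    (e : hx.poset.Alg ↪[LSC] N) :
    truth d (formulaCode φ, x) = true ↔ φ.Realize default (e ∘ hx.tuple n) := by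
  induction φ generalizing x with
  | falsum =>
    rw [truth]
    simp [formulaCode, BoundedFormula.Realize]
  | equal s t =>
    have h1 := (BoundedFormula.IsAtomic.equal s t).isQF.realize_embedding e (v := default)
      (xs := hx.tuple _)
    rw [Subsingleton.elim (default : Empty → N) (e ∘ default)]
    refine Iff.trans ?_ h1.symm
    rw [truth]
    simp only [formulaCode, Nat.unpair_pair, if_true, decide_eq_true_eq]
    rw [termValue_eq_iff]
    change _ ↔ s.realize _ = t.realize _
    constructor
    · intro h
      refine Down.ext fun k => ?_
      rw [← mem_termValue_iff hx, ← mem_termValue_iff hx]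
      exact h _ (hx.val_mem k)
    · intro h k hk
      refine (mem_termValue_iff hx s (hx.elem k hk)).trans
        (Iff.trans ?_ (mem_termValue_iff hx t (hx.elem k hk)).symm)
      rw [h]
  | rel r _ => exact Empty.elim r
  | imp φ ψ ih1 ih2 =>
    rw [truth, BoundedFormula.realize_imp, ← ih1 x hx hn e, ← ih2 x hx hn e]
    simp only [formulaCode, Nat.unpair_pair]
    cases truth d (formulaCode φ, x) <;> simp
  | @all n φ ih =>
    have h1 : truth d (formulaCode φ.all, x) = true ↔
        ∀ y ∈ extensions d x, truth d (formulaCode φ, y) = true := by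
      rw [truth]
      simp [formulaCode]
    rw [h1, BoundedFormula.realize_all]
    constructor
    · intro h m
      obtain ⟨y, hy, hyn, hr, e', he'⟩ := exists_extension hN.isSubscaled hx hn e m
      rw [← he']
      exact (ih y hr hyn e').1 (h y hy)
    · intro h y hy
      obtain ⟨⟨E, -, R, -, A, -, rfl⟩, hr, hext⟩ := mem_extensions.1 hy
      obtain ⟨e', he'⟩ := exists_alg_extension hN e
        ((hext.isPMap hx hr).embedding hr.poset.strictMono)
      refine (ih _ hr (by simp [pullback, hn]) e').2 ?_
      have h2 := h (e' (hr.tuple (n + 1) (Fin.last n)))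
      convert h2 using 1
      funext i
      refine Fin.lastCases ?_ (fun i => ?_) i
      · rw [Fin.snoc_last]
        rfl
      · rw [Fin.snoc_castSucc]
        change _ = e (hx.tuple n i)
        rw [← he']
        refine congrArg e' (Down.ext fun k => ?_)
        exact (mem_tuple_castSucc hext hx hr hn rfl i k).trans
          (IsPMap.mem_embedding (hext.isPMap hx hr) hr.poset.strictMono).symm

/-- Besides evaluating truth at finitely many states, the procedure must reject numbers that are not
codes of sentences, which the arity test does. -/
theorem isDecidable_of_truth {T : LSC.Theory} (xs : List State)
    (h : ∀ φ : LSC.Sentence, T ⊨ᵇ φ ↔ ∀ x ∈ xs, truth d (formulaCode φ, x) = true) :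
    IsDecidable T := by
  have h1 : PrimrecPred fun k : ℕ => arity k = some 0 ∧ ∀ x ∈ xs, truth d (k, x) = true :=
    (Primrec.eq.comp primrec_arity (Primrec.const _)).and (primrecPred_forall (Primrec.const xs)
      (Primrec.eq.comp (primrec_truth d) (Primrec.const true)))
  obtain ⟨_, h2⟩ := h1
  have h3 : ComputablePred fun k : ℕ => arity k = some 0 ∧ ∀ x ∈ xs, truth d (k, x) = true :=
    ⟨inferInstance, h2.to_comp⟩
  refine h3.of_eq fun k => ?_
  rw [← exists_sentence_iff]
  constructor
  · rintro ⟨⟨φ, rfl⟩, h4⟩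
    exact ⟨φ, rfl, (h φ).2 h4⟩
  · rintro ⟨φ, rfl, h4⟩
    exact ⟨⟨φ, rfl⟩, (h φ).1 h4⟩

theorem exists_truth_iff (P : RankedPoset d) : ∃ x : State, ∀ (N : Type u) [LSC.Structure N],
    IsSuperScaled d N → (P.Alg ↪[LSC] N) → ∀ φ : LSC.Sentence,
      N ⊨ φ ↔ truth d (formulaCode φ, x) = true := by
  obtain ⟨x, hx, hn, ⟨i⟩⟩ := exists_state P
  refine ⟨x, fun N _ hN j φ => ?_⟩
  rw [truth_iff hN φ x hx (by simp [hn]) (j.comp i), Subsingleton.elim (_ ∘ _) default]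
  rfl

theorem isDecidable_superTheoryOver {P : Type} [LSC.Structure P] (hP : IsPrimeSubscaled d P) :
    IsDecidable (superTheoryOver d P) := by
  obtain ⟨R, -, ⟨e⟩⟩ := hP.exists_ranked
  obtain ⟨x, hx⟩ := exists_truth_iff.{0} R
  obtain ⟨N, _, -, hN, ⟨i⟩⟩ := exists_superScaled_over hP
  have : N ⊨ superTheoryOver d P := (models_superTheoryOver_iff hP).2 ⟨hN, ⟨i⟩⟩
  have : Nonempty N := ⟨zeroOp N⟩
  refine isDecidable_of_truth (d := d) [x] fun φ => ?_
  rw [← (isComplete_superTheoryOver hP).realize_sentence_iff φ N,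
    hx N hN (i.comp e.toEmbedding) φ]
  simp

/-- Every model contains one of finitely many prime lattices, which decides its complete theory, and
each prime lattice occurs in some model. A consequence is therefore a sentence that is true at all
the corresponding states. -/
theorem isDecidable_superTheory (d : ℕ) : IsDecidable (superTheory d) := by
  obtain ⟨n, F, hF, hlist⟩ := exists_prime_list.{0} d
  choose x hx using fun i => exists_truth_iff.{0} (F i)
  refine isDecidable_of_truth (d := d) (List.ofFn x) fun φ => ?_
  rw [List.forall_mem_ofFn_iff]
  constructor
  · intro h i
    obtain ⟨N, _, -, hN, ⟨j⟩⟩ := exists_superScaled_over (hF i)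
    exact (hx i N hN j φ).1 (realize_of_models h (models_superTheory_iff.2 hN))
  · intro h
    refine models_of_realize fun N _ hN => ?_
    have hN' := models_superTheory_iff.1 hN
    obtain ⟨i, ⟨f⟩⟩ := hlist (Core N) (isPrimeSubscaled_core hN'.isSubscaled)
    exact (hx i N hN' ((Substructure.subtype _).comp f.symm.toEmbedding) φ).2 (h i)

end Truth

end Subscaled

/-! ### Assembly of the theorem -/

theorem mainTheorem2 (d : ℕ) :
    -- `d`-subscaled lattices are the models of their theory, which is universal
    (∀ (M : Type u) [Subscaled.LSC.Structure M],
      M ⊨ Subscaled.subscaledTheory d ↔ Subscaled.IsSubscaled d M) ∧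
    (∃ U : Subscaled.LSC.Theory, (∀ φ ∈ U, φ.IsUniversal) ∧
      ∀ (M : Type u) [Subscaled.LSC.Structure M], M ⊨ U ↔ Subscaled.IsSubscaled d M) ∧
    -- super `d`-scaled lattices are the models of their theory
    (∀ (M : Type u) [Subscaled.LSC.Structure M],
      M ⊨ Subscaled.superTheory d ↔ Subscaled.IsSuperScaled d M) ∧
    -- model-completion and quantifier elimination
    Subscaled.IsModelCompletion.{u} (Subscaled.subscaledTheory d) (Subscaled.superTheory d) ∧
    Subscaled.EliminatesQuantifiers (Subscaled.superTheory d) ∧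
    -- finite axiomatization, up to the triviality of the operations `C^i` for `i > d`
    (∃ F : Subscaled.LSC.Theory, F.Finite ∧ ∀ (M : Type u) [Subscaled.LSC.Structure M],
      Subscaled.IsSuperScaled d M ↔
        M ⊨ F ∧ ∀ i : ℕ, d < i → ∀ a : M, Subscaled.compOp i a = Subscaled.zeroOp M) ∧
    -- finitely many prime `d`-subscaled lattices, all of them finite
    (∃ (n : ℕ) (P : Fin n → Type) (_ : ∀ i, Subscaled.LSC.Structure (P i)),
      (∀ i, Subscaled.IsPrimeSubscaled d (P i) ∧ Finite (P i)) ∧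
      ∀ (Q : Type u) [Subscaled.LSC.Structure Q], Subscaled.IsPrimeSubscaled d Q →
        ∃ i, Nonempty (Q ≃[Subscaled.LSC] P i)) ∧
    -- each of them determines a completion
    (∀ (P : Type) [Subscaled.LSC.Structure P], Subscaled.IsPrimeSubscaled d P →
      (∀ (M : Type u) [Subscaled.LSC.Structure M], M ⊨ Subscaled.superTheoryOver d P ↔
        Subscaled.IsSuperScaled d M ∧ Nonempty (P ↪[Subscaled.LSC] M)) ∧
      (Subscaled.superTheoryOver d P).IsComplete) ∧
    -- every completion is of that kind, `ℵ₀`-categorical and decidable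
    (∀ T : Subscaled.LSC.Theory, Subscaled.superTheory d ⊆ T → T.IsComplete →
      (∃ (P : Type) (_ : Subscaled.LSC.Structure P), Subscaled.IsPrimeSubscaled d P ∧
        ∀ φ : Subscaled.LSC.Sentence, T ⊨ᵇ φ ↔ Subscaled.superTheoryOver d P ⊨ᵇ φ) ∧
      Cardinal.Categorical Cardinal.aleph0.{0} T ∧ Subscaled.IsDecidable T) ∧
    -- finitely many prime models, and every model contains one of them elementarily
    (∃ (n : ℕ) (P : Fin n → Type) (_ : ∀ i, Subscaled.LSC.Structure (P i)),
      (∀ i, Subscaled.IsPrimeModel (Subscaled.superTheory d) (P i)) ∧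
      (∀ (Q : Type) [Subscaled.LSC.Structure Q],
        Subscaled.IsPrimeModel (Subscaled.superTheory d) Q →
          ∃ i, Nonempty (Q ≃[Subscaled.LSC] P i)) ∧
      ∀ (N : Type u) [Subscaled.LSC.Structure N], Subscaled.IsSuperScaled d N →
        ∃ i, Nonempty (P i ↪ₑ[Subscaled.LSC] N)) ∧
    -- decidability
    Subscaled.IsDecidable (Subscaled.superTheory d) := by
  refine ⟨fun M _ => Subscaled.models_subscaledTheory_iff,
    ⟨Subscaled.subscaledAxiomsTheory d, Subscaled.isUniversal_subscaledAxiomsTheory d,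
      fun M _ => Subscaled.models_subscaledAxiomsTheory_iff⟩,
    fun M _ => Subscaled.models_superTheory_iff, Subscaled.isModelCompletion_superTheory d,
    Subscaled.eliminatesQuantifiers_superTheory d,
    ⟨Subscaled.finiteSuperAxioms d, Subscaled.finiteSuperAxioms_finite d,
      fun M _ => Subscaled.isSuperScaled_iff⟩, ?_, fun P _ hP =>
        ⟨fun M _ => Subscaled.models_superTheoryOver_iff hP,
          Subscaled.isComplete_superTheoryOver hP⟩, fun T hT hc =>
      ⟨Subscaled.exists_prime_of_isComplete hT hc, Subscaled.categorical_of_isComplete hT hc, ?_⟩,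
    Subscaled.exists_primeModel_list d, Subscaled.isDecidable_superTheory d⟩
  · obtain ⟨n, F, hF, hlist⟩ := Subscaled.exists_prime_list.{u} d
    exact ⟨n, fun i => (F i).Alg, fun i => inferInstance,
      fun i => ⟨hF i, inferInstanceAs (Finite (Subscaled.Down (F i).rank))⟩, hlist⟩
  · obtain ⟨P, _, hP, hφ⟩ := Subscaled.exists_prime_of_isComplete hT hc
    simp only [Subscaled.IsDecidable, hφ]
    exact Subscaled.isDecidable_superTheoryOver hP
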